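/- An \emph{abstract tropical curve} $\Gamma$ is the space obtained from a finite connected nonempty multigraph (loops allowed) with edge lengths in $(0,\infty]$, where $\infty$ is allowed on leaf edges only, by identifying every edge $e$ with the interval $[0,\ell(e)]$, the leaf end of an edge of infinite length being identified with $\infty$. The set of these points at infinity is $\Gamma_\infty$. A \emph{ray} of $\Gamma$ is an edge of infinite length in some such model of $\Gamma$. Let $\mathbf T=(\mathbb R\cup\{-\infty\},\oplus=\max,\odot=+)$. $\mathrm{Rat}(\Gamma)$ is the set of continuous functions $f:\Gamma\to\mathbb R\cup\{\pm\infty\}$ that are identically $-\infty$, or piecewise affine with integer slopes and finitely many pieces and with the values $\pm\infty$ only at points at infinity; with the pointwise maximum $\oplus$ and the pointwise sum $\odot$ (extended by continuity to $\Gamma_\infty$) it is a semifield over $\mathbf T$, embedded as the constants. The semifield $\mathrm{Rat}(\Gamma')$ is defined in the same way for a connected closed subset $\Gamma'\subset\Gamma$ other than a point at infinity. For nonempty $A\subset\Gamma$ and $l\in(0,\infty]$ put $\mathrm{CF}(A,l)(x)=-\min\{\mathrm{dist}(A,x),l\}$. A \emph{tropical curve with parallel rays} $\Gamma_{\mathrm{par}}$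 is a tropical curve $\Gamma$ with an equivalence relation on its rays (being \emph{parallel}) such that rays $L_1\subset L_2$ are always parallel. $\mathrm{Rat}(\Gamma_{\mathrm{par}})\subset\mathrm{Rat}(\Gamma)$ consists of $-\infty$ and of all $f\in\mathrm{Rat}(\Gamma)$ that have the same slope at infinity along any two parallel rays. \textbf{Proposition.} For every tropical curve with parallel rays $\Gamma_{\mathrm{par}}$ with underlying tropical curve $\Gamma$, the set $\mathrm{Rat}(\Gamma_{\mathrm{par}})$ is a subsemifield over $\mathbf T$ of $\mathrm{Rat}(\Gamma)$ (it contains the constants and is closed under $\oplus$, $\odot$ and inverses of elements $\neq-\infty$) and is finitely generated as a semifield over $\mathbf T$. More precisely, there is a nonempty connected closed subset $\Gamma'\subset\Gamma$ without points at infinity (equivalently, a connected subgraph containing no ray) such that the closure of every connected component of $\Gamma\setminus\Gamma'$ is a ray of $\Gamma$. For every such $\Gamma'$ the set $\mathcal L$ of these closures is finite, the semifield $\mathrm{Rat}(\Gamma')$ is finitely generated over $\mathbf T$, and the map $\varphi:\Gamma\to\Gamma'$ that is the identity on $\Gamma'$ and contracts every $L\in\mathcal L$ to its boundary point is continuous and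 induces a $\mathbf T$-algebra homomorphism $\varphi^*:\mathrm{Rat}(\Gamma')\to\mathrm{Rat}(\Gamma)$, $f\mapsto f\circ\varphi$. For every real $\varepsilon>0$ and every $L\in\mathcal L$, the functions $$g_L=\mathrm{CF}\Big(\Gamma'\cup\overline{\Gamma\setminus\textstyle\bigcup\{L'\in\mathcal L: L'\text{ parallel to }L\}},\ \infty\Big),\qquad h_L=\mathrm{CF}(L,\varepsilon)$$ are in $\mathrm{Rat}(\Gamma)$, and for every set $S$ that generates $\mathrm{Rat}(\Gamma')$ as a semifield over $\mathbf T$, the semifield $\mathrm{Rat}(\Gamma_{\mathrm{par}})$ is generated over $\mathbf T$ by all $g_L$, all $h_L$ ($L\in\mathcal L$) and $\varphi^*(S)$. -/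

import Mathlib

open Set Filter Topology
open scoped ENNReal NNReal

/-! ### The tropical semifield -/

/-- The tropical (max-plus) semifield `ℝ ∪ {-∞}`, where `-∞` is `⊥`. -/
def TropR : Type := WithBot ℝ

namespace TropR

/-- The element `-∞`. -/
def bot : TropR := (⊥ : WithBot ℝ)

/-- A real number as an element of the tropical semifield. -/
def ofReal (a : ℝ) : TropR := (a : WithBot ℝ)

/-- The inclusion of `ℝ ∪ {-∞}` in the extended reals. -/
noncomputable def toEReal : TropR → EReal := WithBot.recBotCoe (C := fun _ => EReal) ⊥ (fun a : ℝ => (a : EReal))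

@[simp] theorem toEReal_bot : toEReal bot = ⊥ := rfl

@[simp] theorem toEReal_ofReal (a : ℝ) : toEReal (ofReal a) = a := rfl

theorem cases' {p : TropR → Prop} (h₁ : p bot) (h₂ : ∀ a, p (ofReal a)) (x : TropR) : p x :=
  WithBot.recBotCoe (C := fun y : WithBot ℝ => p y) h₁ h₂ x

theorem toEReal_injective : Function.Injective toEReal := by
  intro x y
  induction x using cases' with
  | h₁ =>
    induction y using cases' with
    | h₁ => intro _; rfl
    | h₂ b => intro h; simp at h
  | h₂ a =>
    induction y using cases' with
    | h₁ => intro h; simp at h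
    | h₂ b => intro h; rw [toEReal_ofReal, toEReal_ofReal, EReal.coe_eq_coe_iff] at h; rw [h]

/-- Tropical addition is the maximum. -/
instance : Add TropR := ⟨fun x y : WithBot ℝ => (max x y : WithBot ℝ)⟩

/-- Tropical multiplication is the usual addition. -/
noncomputable instance : Mul TropR := ⟨fun x y : WithBot ℝ => (x + y : WithBot ℝ)⟩

instance : Zero TropR := ⟨bot⟩

noncomputable instance : One TropR := ⟨ofReal 0⟩

/-- The tropical inverse of a real number is its negative. -/
noncomputable instance : Inv TropR :=
  ⟨WithBot.recBotCoe (C := fun _ => TropR) bot (fun a : ℝ => ofReal (-a))⟩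

theorem zero_def : (0 : TropR) = bot := rfl

theorem one_def : (1 : TropR) = ofReal 0 := rfl

@[simp] theorem bot_add (y : TropR) : bot + y = y := max_eq_right (α := WithBot ℝ) bot_le

@[simp] theorem add_bot (y : TropR) : y + bot = y := max_eq_left (α := WithBot ℝ) bot_le

@[simp] theorem toEReal_add (x y : TropR) : toEReal (x + y) = max (toEReal x) (toEReal y) := by
  induction x using cases' with
  | h₁ => rw [toEReal_bot, max_eq_right _root_.bot_le, bot_add]
  | h₂ a =>
    induction y using cases' with
    | h₁ => rw [toEReal_bot, max_eq_left _root_.bot_le, add_bot]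
    | h₂ b =>
      have h : ofReal a + ofReal b = ofReal (max a b) := (WithBot.coe_max a b).symm
      rw [h]
      exact EReal.coe_strictMono.monotone.map_max

@[simp] theorem toEReal_mul (x y : TropR) : toEReal (x * y) = toEReal x + toEReal y := by
  induction x using cases' with
  | h₁ =>
    have h : bot * y = bot := WithBot.bot_add (α := ℝ) y
    simp [h]
  | h₂ a =>
    induction y using cases' with
    | h₁ =>
      have h : ofReal a * bot = bot := WithBot.add_bot (α := ℝ) (a : WithBot ℝ)
      simp [h]
    | h₂ b =>
      have h : ofReal a * ofReal b = ofReal (a + b) := (WithBot.coe_add a b).symm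
      simp [h]

@[simp] theorem toEReal_zero : toEReal 0 = ⊥ := rfl

@[simp] theorem toEReal_one : toEReal 1 = 0 := rfl

theorem inv_ofReal (a : ℝ) : (ofReal a)⁻¹ = ofReal (-a) := rfl

noncomputable instance : Semifield TropR where
  add_assoc x y z := toEReal_injective (by simp [max_assoc])
  zero_add x := toEReal_injective (by simp)
  add_zero x := toEReal_injective (by simp)
  add_comm x y := toEReal_injective (by simp [max_comm])
  left_distrib x y z := toEReal_injective (by simp [max_add_add_left])
  right_distrib x y z := toEReal_injective (by simp [max_add_add_right])
  zero_mul x := toEReal_injective (by simp)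
  mul_zero x := toEReal_injective (by simp)
  mul_assoc x y z := toEReal_injective (by simp [add_assoc])
  one_mul x := toEReal_injective (by simp)
  mul_one x := toEReal_injective (by simp)
  mul_comm x y := toEReal_injective (by simp [add_comm])
  nsmul := nsmulRec
  exists_pair_ne := ⟨0, 1, fun h => by
    have := congrArg toEReal h
    simp at this⟩
  mul_inv_cancel x hx := by
    induction x using cases' with
    | h₁ => exact absurd rfl hx
    | h₂ a =>
      apply toEReal_injective
      rw [toEReal_mul, inv_ofReal, toEReal_ofReal, toEReal_ofReal, ← EReal.coe_add]
      simp
  inv_zero := rfl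
  nnqsmul := _
  nnqsmul_def := fun _ _ => rfl

end TropR

/-! ### Subsemifields over a semifield -/

/-- The smallest subsemifield over `T` of `K` that contains `s`: the intersection of all
`T`-subalgebras of `K` that contain `s` and are closed under inversion. -/
def semifieldAdjoin (T : Type*) {K : Type*} [Semifield T] [Semifield K] [Algebra T K]
    (s : Set K) : Subalgebra T K :=
  sInf {S : Subalgebra T K | s ⊆ S ∧ ∀ x ∈ S, x⁻¹ ∈ S}

/-! ### Tropical curves -/

/-- A model `(G, l)` of an abstract tropical curve: a finite connected nonempty multigraph (loops
allowed) with a length in `(0, ∞]` for every edge, infinite lengths being allowed on leaf edges only.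
The edges are oriented, only in order to identify the edge `e` with `[0, len e]`, and edges of
infinite length are oriented towards the leaf end that is identified with `∞`. -/
structure TropModel (V E : Type*) where
  src : E → V
  tgt : E → V
  len : E → ℝ≥0∞
  finite_vertices : Finite V
  finite_edges : Finite E
  nonempty_vertices : Nonempty V
  connected : ∀ u v : V, Relation.EqvGen (fun a b => ∃ e, src e = a ∧ tgt e = b) u v
  len_pos : ∀ e, 0 < len e
  leaf_src : ∀ e, len e = ⊤ → ∀ e', src e' ≠ tgt e
  leaf_tgt : ∀ e, len e = ⊤ → ∀ e', tgt e' = tgt e → e' = e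

namespace TropModel

variable {V E : Type*}

/-- The disjoint union of the vertices and of the closed intervals `[0, len e]`. -/
def PrePoint (G : TropModel V E) : Type _ := V ⊕ (Σ e : E, Set.Iic (G.len e))

/-- The vertices carry the discrete topology, and `[0, len e]` the topology of an interval of
`[0, ∞]`. -/
instance (G : TropModel V E) : TopologicalSpace G.PrePoint :=
  letI : TopologicalSpace V := ⊥
  inferInstanceAs (TopologicalSpace (V ⊕ (Σ e : E, Set.Iic (G.len e))))

/-- The ends of the intervals are glued to the vertices. -/
inductive Glue (G : TropModel V E) : G.PrePoint → G.PrePoint → Prop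
  | src (e : E) : Glue G (Sum.inl (G.src e)) (Sum.inr ⟨e, ⟨0, Set.mem_Iic.2 bot_le⟩⟩)
  | tgt (e : E) : Glue G (Sum.inl (G.tgt e)) (Sum.inr ⟨e, ⟨G.len e, Set.mem_Iic.2 le_rfl⟩⟩)

/-- The abstract tropical curve `Γ` with the given model, as a topological space. -/
def Curve (G : TropModel V E) : Type _ := Quot G.Glue

instance (G : TropModel V E) : TopologicalSpace G.Curve :=
  inferInstanceAs (TopologicalSpace (Quot G.Glue))

/-- The point of `Γ` given by a vertex. -/
def vertex (G : TropModel V E) (v : V) : G.Curve := Quot.mk G.Glue (Sum.inl v)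

/-- The point of `Γ` with coordinate `t` on the edge `e`. -/
def onEdge (G : TropModel V E) (e : E) (t : Set.Iic (G.len e)) : G.Curve :=
  Quot.mk G.Glue (Sum.inr ⟨e, t⟩)

/-- The set `Γ_∞` of points at infinity. -/
def infPts (G : TropModel V E) : Set G.Curve :=
  {x | ∃ e, G.len e = ⊤ ∧ x = G.vertex (G.tgt e)}

/-- `G.Reach x y r` says that one can go from `x` to `y` along finitely many segments, each inside
an edge, of total length `r`. In `[0, ∞]` the distance of `s` and `t` is `max (s - t) (t - s)`
(truncated subtraction), so that it is infinite if exactly one of them is `∞`. -/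
inductive Reach (G : TropModel V E) (x : G.Curve) : G.Curve → ℝ≥0∞ → Prop
  | refl : Reach G x x 0
  | step (e : E) (s t : Set.Iic (G.len e)) (r : ℝ≥0∞) :
      Reach G x (G.onEdge e s) r →
      Reach G x (G.onEdge e t) (r + max (s.1 - t.1) (t.1 - s.1))

/-- The (extended) path distance on `Γ`. -/
noncomputable def dist (G : TropModel V E) (x y : G.Curve) : ℝ≥0∞ :=
  sInf {r | G.Reach x y r}

/-- The chip firing move `CF(A, l)(x) = - min {dist(A, x), l}`. -/
noncomputable def chipFiring (G : TropModel V E) (A : Set G.Curve) (l : ℝ≥0∞) (x : G.Curve) :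
    EReal :=
  -((min (⨅ y ∈ A, G.dist y x) l : ℝ≥0∞) : EReal)

/-! ### Rational functions -/

/-- A function on a subset `C` of `Γ` is piecewise affine with integer slopes and finitely many
pieces: on every edge the finite coordinates are covered by finitely many intervals such that on
each of them (as far as it belongs to `C`) the function is `t ↦ a + m * t` with `a ∈ ℝ`, `m ∈ ℤ`. -/
def PiecewiseAffine (G : TropModel V E) (C : Set G.Curve) (f : C → EReal) : Prop :=
  ∀ e : E, ∃ P : Set (Set ℝ≥0), P.Finite ∧ ⋃₀ P = Set.univ ∧
    ∀ I ∈ P, I.OrdConnected ∧ ∃ (a : ℝ) (m : ℤ), ∀ t ∈ I, ∀ ht : (t : ℝ≥0∞) ≤ G.len e,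
      ∀ hC : G.onEdge e ⟨t, ht⟩ ∈ C, f ⟨G.onEdge e ⟨t, ht⟩, hC⟩ = ((a + m * t : ℝ) : EReal)

/-- Rational functions on a subset `C` of `Γ`: continuous functions with values in `ℝ ∪ {±∞}` that
are either identically `-∞`, or piecewise affine with integer slopes and finitely many pieces and
infinite only at points at infinity. -/
def IsRational (G : TropModel V E) (C : Set G.Curve) (f : C → EReal) : Prop :=
  Continuous f ∧ ((∀ x, f x = ⊥) ∨
    ((∀ x : C, x.1 ∉ G.infPts → f x ≠ ⊥ ∧ f x ≠ ⊤) ∧ G.PiecewiseAffine C f))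

/-- The closed subsets of `Γ` on which rational functions are considered: nonempty closed subsets
without isolated points at infinity. -/
structure Region (G : TropModel V E) where
  carrier : Set G.Curve
  nonempty : carrier.Nonempty
  closed : IsClosed carrier
  mem_closure : ∀ x ∈ carrier, x ∈ closure (carrier ∩ G.infPtsᶜ)

/-- The rational functions on a region. -/
structure Rat (G : TropModel V E) (C : G.Region) where
  toFun : C.carrier → EReal
  isRational : G.IsRational C.carrier toFun

instance (G : TropModel V E) (C : G.Region) : CoeFun (G.Rat C) (fun _ => C.carrier → EReal) :=
  ⟨Rat.toFun⟩

/-- The finite points of a region, as a subset of the region. -/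
def Region.fin {G : TropModel V E} (C : G.Region) : Set C.carrier := {x | x.1 ∉ G.infPts}


/-! ### Facts needed for the semifield structure -/

theorem vertex_src (G : TropModel V E) (e : E) :
    G.vertex (G.src e) = G.onEdge e ⟨0, Set.mem_Iic.2 bot_le⟩ := Quot.sound (Glue.src e)

theorem vertex_tgt (G : TropModel V E) (e : E) :
    G.vertex (G.tgt e) = G.onEdge e ⟨G.len e, Set.mem_Iic.2 le_rfl⟩ := Quot.sound (Glue.tgt e)

theorem continuous_onEdge (G : TropModel V E) (e : E) : Continuous (G.onEdge e) := by
  let _ : TopologicalSpace V := ⊥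
  have h1 : Continuous (fun t : Set.Iic (G.len e) =>
      (Sum.inr ⟨e, t⟩ : V ⊕ (Σ e : E, Set.Iic (G.len e)))) :=
    continuous_inr.comp (continuous_sigmaMk (σ := fun e : E => Set.Iic (G.len e)))
  have h2 : Continuous (Quot.mk G.Glue) := continuous_quot_mk
  exact h2.comp h1

/-- The neighbourhoods `(T, ∞]` of the point at infinity of an edge of infinite length. -/
def tail (G : TropModel V E) (e : E) (he : G.len e = ⊤) (T : ℝ≥0) : Set G.Curve :=
  {x | Quot.lift (r := G.Glue)
    (Sum.elim (fun v => v = G.tgt e) (fun p => p.1 = e ∧ (T : ℝ≥0∞) < p.2.1))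
    (by
      intro a b hab
      cases hab with
      | src e' =>
        refine propext ⟨fun h => absurd h (G.leaf_src e he e'), fun h => ?_⟩
        exact absurd h.2 (not_lt.2 bot_le)
      | tgt e' =>
        refine propext ⟨fun h => ?_, fun h => ?_⟩
        · have := G.leaf_tgt e he e' h
          subst this
          refine ⟨rfl, ?_⟩
          show (T : ℝ≥0∞) < G.len e'
          rw [he]
          exact ENNReal.coe_lt_top
        · have h1 : e' = e := h.1
          subst h1
          rfl) x}

theorem isOpen_tail (G : TropModel V E) (e : E) (he : G.len e = ⊤) (T : ℝ≥0) :
    IsOpen (G.tail e he T) := by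
  let _ : TopologicalSpace V := ⊥
  have : DiscreteTopology V := ⟨rfl⟩
  have h : IsOpen ((Quot.mk G.Glue) ⁻¹' G.tail e he T) := by
    refine isOpen_sum_iff.2 ⟨isOpen_discrete _, isOpen_sigma_iff.2 fun e' => ?_⟩
    by_cases h : e' = e
    · have : IsOpen {t : Set.Iic (G.len e') | (T : ℝ≥0∞) < t.1} :=
        isOpen_lt continuous_const continuous_subtype_val
      convert this using 1
      ext t
      exact ⟨fun ht => ht.2, fun ht => ⟨h, ht⟩⟩
    · convert isOpen_empty using 1
      ext t
      exact ⟨fun ht => h ht.1, fun ht => ht.elim⟩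
  exact h

theorem onEdge_notMem_infPts (G : TropModel V E) (e : E) (t : ℝ≥0) (ht : (t : ℝ≥0∞) ≤ G.len e) :
    G.onEdge e ⟨t, ht⟩ ∉ G.infPts := by
  rintro ⟨e', he', h⟩
  have h1 : G.vertex (G.tgt e') ∈ G.tail e' he' t := rfl
  rw [← h] at h1
  exact absurd h1.2 (lt_irrefl _)

theorem mem_tail (G : TropModel V E) (e : E) (he : G.len e = ⊤) (T : ℝ≥0) (x : G.Curve)
    (hx : x ∈ G.tail e he T) (hfin : x ∉ G.infPts) :
    ∃ t : ℝ≥0, T < t ∧ ∃ ht : (t : ℝ≥0∞) ≤ G.len e, x = G.onEdge e ⟨t, ht⟩ := by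
  induction x using Quot.ind with
  | mk p =>
    rcases p with v | ⟨e', t, ht⟩
    · have : v = G.tgt e := hx
      exact absurd ⟨e, he, by rw [← this]; rfl⟩ hfin
    · obtain ⟨h1, h2⟩ : e' = e ∧ (T : ℝ≥0∞) < t := hx
      subst h1
      have h3 : t ≠ ⊤ := by
        rintro rfl
        refine hfin ⟨e', he, ?_⟩
        rw [vertex_tgt]
        have : (⟨⊤, ht⟩ : Set.Iic (G.len e')) = ⟨G.len e', Set.mem_Iic.2 le_rfl⟩ :=
          Subtype.ext he.symm
        exact congrArg (G.onEdge e') this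
      lift t to ℝ≥0 using h3
      exact ⟨t, by exact_mod_cast h2, ht, rfl⟩

/-- The whole curve. -/
def whole (G : TropModel V E) : G.Region where
  carrier := Set.univ
  nonempty := by
    obtain ⟨v⟩ := G.nonempty_vertices
    exact ⟨G.vertex v, trivial⟩
  closed := isClosed_univ
  mem_closure := by
    intro x _
    rw [Set.univ_inter]
    by_cases hx : x ∈ G.infPts
    · obtain ⟨e, he, rfl⟩ := hx
      rw [vertex_tgt]
      have hle : ∀ t : ℝ≥0∞, t ≤ G.len e := fun t => he ▸ le_top
      have h1 : Tendsto (fun n : ℕ => G.onEdge e ⟨(n : ℝ≥0∞), hle n⟩) atTop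
          (𝓝 (G.onEdge e ⟨G.len e, Set.mem_Iic.2 le_rfl⟩)) := by
        refine ((G.continuous_onEdge e).tendsto _).comp ?_
        rw [tendsto_subtype_rng]
        simp only [he]
        exact ENNReal.tendsto_nat_nhds_top
      refine mem_closure_of_tendsto h1 (Eventually.of_forall fun n => ?_)
      have := G.onEdge_notMem_infPts e (n : ℝ≥0) (by exact_mod_cast hle n)
      simpa using this
    · exact subset_closure hx

theorem Region.dense_fin {G : TropModel V E} (C : G.Region) : Dense C.fin := by
  intro x
  rw [closure_subtype]
  refine closure_mono ?_ (C.mem_closure x.1 x.2)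
  rintro y ⟨hy, hy'⟩
  exact ⟨⟨y, hy⟩, hy', rfl⟩

theorem eventually_fin (G : TropModel V E) (C : G.Region) (e : E) (he : G.len e = ⊤)
    (x : C.carrier) (hx : x.1 = G.vertex (G.tgt e)) (p : C.carrier → Prop) (T : ℝ≥0)
    (h : ∀ t : ℝ≥0, T < t → ∀ (ht : (t : ℝ≥0∞) ≤ G.len e) (hC : G.onEdge e ⟨t, ht⟩ ∈ C.carrier),
      p ⟨G.onEdge e ⟨t, ht⟩, hC⟩) :
    ∀ᶠ y in 𝓝[C.fin] x, p y := by
  have h1 : Subtype.val ⁻¹' G.tail e he T ∈ 𝓝 x :=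
    ((G.isOpen_tail e he T).preimage continuous_subtype_val).mem_nhds (by
      show x.1 ∈ G.tail e he T
      rw [hx]
      rfl)
  filter_upwards [mem_nhdsWithin_of_mem_nhds h1, self_mem_nhdsWithin] with y hy hy'
  obtain ⟨t, h2, ht, h3⟩ := G.mem_tail e he T y.1 hy hy'
  have h4 : G.onEdge e ⟨t, ht⟩ ∈ C.carrier := h3 ▸ y.2
  have h5 : y = ⟨G.onEdge e ⟨t, ht⟩, h4⟩ := Subtype.ext h3
  rw [h5]
  exact h t h2 ht h4

theorem exists_tail_subset {P : Set (Set ℝ≥0)} (hP : P.Finite) (hU : ⋃₀ P = Set.univ)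
    (hI : ∀ I ∈ P, I.OrdConnected) : ∃ I ∈ P, ∃ T, ∀ t, T < t → t ∈ I := by
  by_contra hcon
  push Not at hcon
  have h1 : BddAbove (⋃₀ P) := by
    rw [Set.sUnion_eq_biUnion]
    refine (hP.bddAbove_biUnion).2 fun I hIP => ?_
    by_contra hb
    have hne : I.Nonempty := by
      by_contra h
      rw [Set.not_nonempty_iff_eq_empty] at h
      exact hb (h ▸ bddAbove_empty)
    obtain ⟨T, hT⟩ := hne
    obtain ⟨t, ht, htI⟩ := hcon I hIP T
    obtain ⟨s, hs, hts⟩ := not_bddAbove_iff.1 hb t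
    exact htI ((hI I hIP).out hT hs ⟨ht.le, hts.le⟩)
  rw [hU] at h1
  exact not_bddAbove_univ h1

theorem PiecewiseAffine.common {G : TropModel V E} {C : Set G.Curve} {f g : C → EReal}
    (hf : G.PiecewiseAffine C f) (hg : G.PiecewiseAffine C g) (e : E) :
    ∃ P : Set (Set ℝ≥0), P.Finite ∧ ⋃₀ P = Set.univ ∧
      ∀ I ∈ P, I.OrdConnected ∧ ∃ (a : ℝ) (m : ℤ) (b : ℝ) (n : ℤ), ∀ t ∈ I,
        ∀ ht : (t : ℝ≥0∞) ≤ G.len e, ∀ hC : G.onEdge e ⟨t, ht⟩ ∈ C,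
          f ⟨G.onEdge e ⟨t, ht⟩, hC⟩ = ((a + m * t : ℝ) : EReal) ∧
          g ⟨G.onEdge e ⟨t, ht⟩, hC⟩ = ((b + n * t : ℝ) : EReal) := by
  obtain ⟨P, hP, hPU, hPI⟩ := hf e
  obtain ⟨Q, hQ, hQU, hQI⟩ := hg e
  refine ⟨Set.image2 (· ∩ ·) P Q, hP.image2 _ hQ, ?_, ?_⟩
  · refine Set.eq_univ_of_forall fun t => ?_
    obtain ⟨I, hI, htI⟩ : t ∈ ⋃₀ P := hPU ▸ trivial
    obtain ⟨J, hJ, htJ⟩ : t ∈ ⋃₀ Q := hQU ▸ trivial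
    exact ⟨I ∩ J, Set.mem_image2_of_mem hI hJ, htI, htJ⟩
  · rintro _ ⟨I, hI, J, hJ, rfl⟩
    obtain ⟨h1, a, m, h2⟩ := hPI I hI
    obtain ⟨h3, b, n, h4⟩ := hQI J hJ
    exact ⟨h1.inter h3, a, m, b, n, fun t ht h5 h6 => ⟨h2 t ht.1 h5 h6, h4 t ht.2 h5 h6⟩⟩

namespace Rat

variable {G : TropModel V E} {C : G.Region}

theorem ext' {f g : G.Rat C} (h : f.toFun = g.toFun) : f = g := by
  cases f
  cases g
  cases h
  rfl

theorem ext_fin {f g : G.Rat C} (h : ∀ x ∈ C.fin, f x = g x) : f = g :=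
  ext' (Continuous.ext_on C.dense_fin f.2.1 g.2.1 h)

theorem ne_top (f : G.Rat C) {x : C.carrier} (hx : x ∈ C.fin) : f x ≠ ⊤ := by
  rcases f.2.2 with h | h
  · rw [h x]; exact bot_ne_top
  · exact (h.1 x hx).2

theorem exists_lim (f g : G.Rat C) (x : C.carrier) :
    ∃ y, Tendsto (fun z => f z + g z) (𝓝[C.fin] x) (𝓝 y) := by
  rcases f.2.2 with hf | hf
  · exact ⟨⊥, by simpa [hf] using tendsto_const_nhds⟩
  rcases g.2.2 with hg | hg
  · exact ⟨⊥, by simpa [hg] using tendsto_const_nhds⟩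
  by_cases hx : x ∈ C.fin
  · refine ⟨f x + g x, Tendsto.mono_left ?_ nhdsWithin_le_nhds⟩
    have h1 := hf.1 x hx
    have h2 := hg.1 x hx
    have h3 : ContinuousAt (fun p : EReal × EReal => p.1 + p.2) (f x, g x) :=
      EReal.continuousAt_add (Or.inl h1.2) (Or.inl h1.1)
    exact Tendsto.comp (x := 𝓝 x) h3 ((f.2.1.tendsto x).prodMk_nhds (g.2.1.tendsto x))
  · obtain ⟨e, he, hxe⟩ : x.1 ∈ G.infPts := not_not.1 hx
    obtain ⟨P, hP, hU, hI⟩ := hf.2.common hg.2 e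
    obtain ⟨I, hIP, T, hT⟩ := exists_tail_subset hP hU (fun I hI' => (hI I hI').1)
    obtain ⟨-, a, m, b, n, hab⟩ := hI I hIP
    have key : ∀ t : ℝ≥0, T < t → ∀ (ht : (t : ℝ≥0∞) ≤ G.len e)
        (hC : G.onEdge e ⟨t, ht⟩ ∈ C.carrier),
        f ⟨G.onEdge e ⟨t, ht⟩, hC⟩ + g ⟨G.onEdge e ⟨t, ht⟩, hC⟩ =
          (((a + b) + (m + n : ℤ) * t : ℝ) : EReal) := by
      intro t h1 ht hC
      rw [(hab t (hT t h1) ht hC).1, (hab t (hT t h1) ht hC).2, ← EReal.coe_add]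
      congr 1
      push_cast
      ring
    rcases lt_trichotomy (m + n) 0 with hk | hk | hk
    · refine ⟨⊥, EReal.tendsto_nhds_bot_iff_real.2 fun r => ?_⟩
      refine G.eventually_fin C e he x hxe _ (max T (Real.toNNReal (a + b - r))) ?_
      intro t h1 ht hC
      rw [key t (lt_of_le_of_lt (le_max_left _ _) h1) ht hC, EReal.coe_lt_coe_iff]
      have h2 : a + b - r < t :=
        lt_of_le_of_lt (Real.le_coe_toNNReal _) (by exact_mod_cast lt_of_le_of_lt (le_max_right _ _) h1)
      have h3 : ((m + n : ℤ) : ℝ) ≤ -1 := by exact_mod_cast Int.le_sub_one_of_lt hk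
      nlinarith [t.2]
    · refine ⟨((a + b : ℝ) : EReal), tendsto_const_nhds.congr' ?_⟩
      refine G.eventually_fin C e he x hxe _ T ?_
      intro t h1 ht hC
      refine Eq.trans ?_ (key t h1 ht hC).symm
      rw [hk]
      simp
    · refine ⟨⊤, EReal.tendsto_nhds_top_iff_real.2 fun r => ?_⟩
      refine G.eventually_fin C e he x hxe _ (max T (Real.toNNReal (r - (a + b)))) ?_
      intro t h1 ht hC
      rw [key t (lt_of_le_of_lt (le_max_left _ _) h1) ht hC, EReal.coe_lt_coe_iff]
      have h2 : r - (a + b) < t :=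
        lt_of_le_of_lt (Real.le_coe_toNNReal _) (by exact_mod_cast lt_of_le_of_lt (le_max_right _ _) h1)
      have h3 : (1 : ℝ) ≤ ((m + n : ℤ) : ℝ) := by exact_mod_cast hk
      nlinarith [t.2]

theorem extendFrom_fin (f g : G.Rat C) {x : C.carrier} (hx : x ∈ C.fin) :
    extendFrom C.fin (fun z => f z + g z) x = f x + g x := by
  obtain ⟨y, hy⟩ := exists_lim f g x
  rw [extendFrom_eq (subset_closure hx) hy]
  have h1 : Tendsto (fun z => f z + g z) (pure x) (𝓝 y) :=
    hy.mono_left (pure_le_nhdsWithin hx)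
  exact (tendsto_nhds_unique h1 (tendsto_pure_nhds _ x))

theorem isRational_max (f g : G.Rat C) :
    G.IsRational C.carrier (fun x => max (f x) (g x)) := by
  refine ⟨f.2.1.max g.2.1, ?_⟩
  rcases f.2.2 with hf | hf
  · simpa [hf] using g.2.2
  rcases g.2.2 with hg | hg
  · simpa [hg] using Or.inr hf
  refine Or.inr ⟨fun x hx => ?_, fun e => ?_⟩
  · show max (f x) (g x) ≠ ⊥ ∧ max (f x) (g x) ≠ ⊤
    rcases max_choice (f x) (g x) with h | h <;> rw [h]
    · exact hf.1 x hx
    · exact hg.1 x hx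
  · obtain ⟨P, hP, hU, hI⟩ := hf.2.common hg.2 e
    choose! hI a m b n hab using hI
    let A : Set ℝ≥0 → Set ℝ≥0 := fun I => I ∩ {t | a I + m I * (t : ℝ) ≤ b I + n I * (t : ℝ)}
    let B : Set ℝ≥0 → Set ℝ≥0 := fun I => I ∩ {t | b I + n I * (t : ℝ) ≤ a I + m I * (t : ℝ)}
    have aux : ∀ (a b : ℝ) (m n : ℤ),
        Set.OrdConnected {t : ℝ≥0 | a + m * (t : ℝ) ≤ b + n * (t : ℝ)} := by
      intro a b m n
      refine ⟨fun s hs t ht u hu => ?_⟩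
      have h1 : (s : ℝ) ≤ u := hu.1
      have h2 : (u : ℝ) ≤ t := hu.2
      simp only [Set.mem_ofPred_eq] at hs ht ⊢
      rcases le_total (m : ℝ) n with h | h <;> nlinarith
    refine ⟨A '' P ∪ B '' P, (hP.image A).union (hP.image B), ?_, ?_⟩
    · refine Set.eq_univ_of_forall fun t => ?_
      obtain ⟨I, hI, htI⟩ : t ∈ ⋃₀ P := hU ▸ trivial
      rcases le_total (a I + m I * (t : ℝ)) (b I + n I * (t : ℝ)) with h | h
      · exact ⟨A I, Or.inl ⟨I, hI, rfl⟩, htI, h⟩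
      · exact ⟨B I, Or.inr ⟨I, hI, rfl⟩, htI, h⟩
    · rintro _ (⟨I, hIP, rfl⟩ | ⟨I, hIP, rfl⟩)
      · refine ⟨(hI I hIP).inter (aux _ _ _ _), b I, n I, fun t ht h1 h2 => ?_⟩
        obtain ⟨h3, h4⟩ := hab I hIP t ht.1 h1 h2
        refine (congrArg₂ max h3 h4).trans ?_
        exact max_eq_right (EReal.coe_le_coe_iff.2 ht.2)
      · refine ⟨(hI I hIP).inter (aux _ _ _ _), a I, m I, fun t ht h1 h2 => ?_⟩
        obtain ⟨h3, h4⟩ := hab I hIP t ht.1 h1 h2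
        refine (congrArg₂ max h3 h4).trans ?_
        exact max_eq_left (EReal.coe_le_coe_iff.2 ht.2)

theorem isRational_extend (f g : G.Rat C) :
    G.IsRational C.carrier (extendFrom C.fin (fun z => f z + g z)) := by
  refine ⟨continuous_extendFrom C.dense_fin (exists_lim f g), ?_⟩
  have hbot : (∀ z, f z + g z = ⊥) → ∀ x, extendFrom C.fin (fun z => f z + g z) x = ⊥ := by
    intro h x
    refine extendFrom_eq (C.dense_fin x) ?_
    simpa [h] using tendsto_const_nhds
  rcases f.2.2 with hf | hf
  · exact Or.inl (hbot fun z => by simp [hf])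
  rcases g.2.2 with hg | hg
  · exact Or.inl (hbot fun z => by simp [hg])
  refine Or.inr ⟨fun x hx => ?_, fun e => ?_⟩
  · rw [extendFrom_fin f g hx]
    have h1 := hf.1 x hx
    have h2 := hg.1 x hx
    exact ⟨fun h => (EReal.add_eq_bot_iff.1 h).elim h1.1 h2.1, EReal.add_ne_top h1.2 h2.2⟩
  · obtain ⟨P, hP, hU, hI⟩ := hf.2.common hg.2 e
    refine ⟨P, hP, hU, fun I hIP => ?_⟩
    obtain ⟨h1, a, m, b, n, hab⟩ := hI I hIP
    refine ⟨h1, a + b, m + n, fun t ht h2 h3 => ?_⟩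
    rw [extendFrom_fin f g (x := ⟨_, h3⟩) (G.onEdge_notMem_infPts e t h2), (hab t ht h2 h3).1,
      (hab t ht h2 h3).2, ← EReal.coe_add]
    congr 1
    push_cast
    ring

theorem isRational_neg (f : G.Rat C) (h : ¬ ∀ x, f x = ⊥) :
    G.IsRational C.carrier (fun x => -f x) := by
  refine ⟨continuous_neg.comp f.2.1, Or.inr ?_⟩
  obtain ⟨h1, h2⟩ := f.2.2.resolve_left h
  refine ⟨fun x hx => ⟨fun h => (h1 x hx).2 (EReal.neg_eq_bot_iff.1 h),
    fun h => (h1 x hx).1 (EReal.neg_eq_top_iff.1 h)⟩, fun e => ?_⟩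
  obtain ⟨P, hP, hU, hI⟩ := h2 e
  refine ⟨P, hP, hU, fun I hIP => ?_⟩
  obtain ⟨h3, a, m, hab⟩ := hI I hIP
  refine ⟨h3, -a, -m, fun t ht h4 h5 => ?_⟩
  show -f.1 _ = _
  rw [hab t ht h4 h5, ← EReal.coe_neg]
  congr 1
  push_cast
  ring

theorem isRational_const (a : TropR) :
    G.IsRational C.carrier (fun _ => a.toEReal) := by
  refine ⟨continuous_const, ?_⟩
  induction a using TropR.cases' with
  | h₁ => exact Or.inl fun _ => rfl
  | h₂ a =>
    refine Or.inr ⟨fun _ _ => ⟨EReal.coe_ne_bot a, EReal.coe_ne_top a⟩, fun e => ?_⟩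
    refine ⟨{Set.univ}, Set.finite_singleton _, Set.sUnion_singleton _, ?_⟩
    rintro _ rfl
    exact ⟨Set.ordConnected_univ, a, 0, fun t _ _ _ => by simp⟩

/-- The constant rational functions. -/
noncomputable def const (a : TropR) : G.Rat C := ⟨fun _ => a.toEReal, isRational_const a⟩

noncomputable instance : Zero (G.Rat C) := ⟨const 0⟩

noncomputable instance : One (G.Rat C) := ⟨const 1⟩

/-- Tropical addition is the pointwise maximum. -/
noncomputable instance : Add (G.Rat C) := ⟨fun f g => ⟨_, isRational_max f g⟩⟩

/-- Tropical multiplication is the pointwise sum at finite points, extended by continuity to the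
points at infinity. -/
noncomputable instance : Mul (G.Rat C) := ⟨fun f g => ⟨_, isRational_extend f g⟩⟩

open Classical in
/-- The tropical inverse of a rational function other than `-∞` is its negative. -/
noncomputable instance : Inv (G.Rat C) :=
  ⟨fun f => if h : ∀ x, f x = ⊥ then 0 else ⟨_, isRational_neg f h⟩⟩

@[simp] theorem const_apply (a : TropR) (x : C.carrier) : (const a : G.Rat C) x = a.toEReal := rfl

@[simp] theorem zero_apply (x : C.carrier) : (0 : G.Rat C) x = ⊥ := rfl

@[simp] theorem one_apply (x : C.carrier) : (1 : G.Rat C) x = 0 := rfl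

@[simp] theorem add_apply (f g : G.Rat C) (x : C.carrier) : (f + g) x = max (f x) (g x) := rfl

theorem mul_apply (f g : G.Rat C) {x : C.carrier} (hx : x ∈ C.fin) : (f * g) x = f x + g x :=
  extendFrom_fin f g hx

theorem inv_apply (f : G.Rat C) (hf : f ≠ 0) (x : C.carrier) : (f⁻¹) x = -f x := by
  have h : ¬ ∀ x, f x = ⊥ := fun h => hf (ext' (funext h))
  have : f⁻¹ = ⟨_, isRational_neg f h⟩ := dif_neg h
  rw [this]

/-- The rational function semifield. -/
noncomputable instance : Semifield (G.Rat C) where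
  add_assoc f g h := ext_fin fun x _ => by simp [max_assoc]
  zero_add f := ext_fin fun x _ => by simp
  add_zero f := ext_fin fun x _ => by simp
  add_comm f g := ext_fin fun x _ => by simp [max_comm]
  left_distrib f g h := ext_fin fun x hx => by simp [mul_apply, hx, max_add_add_left]
  right_distrib f g h := ext_fin fun x hx => by simp [mul_apply, hx, max_add_add_right]
  zero_mul f := ext_fin fun x hx => by simp [mul_apply, hx]
  mul_zero f := ext_fin fun x hx => by simp [mul_apply, hx]
  mul_assoc f g h := ext_fin fun x hx => by simp [mul_apply, hx, add_assoc]
  one_mul f := ext_fin fun x hx => by simp [mul_apply, hx]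
  mul_one f := ext_fin fun x hx => by simp [mul_apply, hx]
  mul_comm f g := ext_fin fun x hx => by simp [mul_apply, hx, add_comm]
  nsmul := nsmulRec
  exists_pair_ne := ⟨0, 1, fun h => by
    obtain ⟨x, hx⟩ := C.nonempty
    have := congrArg (fun f : G.Rat C => f ⟨x, hx⟩) h
    simp at this⟩
  mul_inv_cancel f hf := ext_fin fun x hx => by
    have h : ¬ ∀ x, f x = ⊥ := fun h => hf (ext' (funext h))
    obtain ⟨h1, -⟩ := f.2.2.resolve_left h
    rw [mul_apply _ _ hx, inv_apply f hf, one_apply]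
    have h2 := h1 x hx
    lift f.1 x to ℝ using ⟨h2.2, h2.1⟩ with r
    rw [← EReal.coe_neg, ← EReal.coe_add]
    simp
  inv_zero := dif_pos fun _ => rfl
  nnqsmul := _
  nnqsmul_def := fun _ _ => rfl

/-- The rational function semifield is a semifield over `ℝ ∪ {-∞}` by the constant functions. -/
noncomputable instance : Algebra TropR (G.Rat C) :=
  RingHom.toAlgebra
    { toFun := const
      map_one' := rfl
      map_zero' := rfl
      map_add' := fun a b => ext_fin fun x _ => by simp
      map_mul' := fun a b => ext_fin fun x hx => by simp [mul_apply, hx] }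

end Rat

/-! ### Rays and parallelism -/

/-- `p` is an isometric parametrization by `[0, ∞]` of a ray of `Γ`, that is, of an edge of infinite
length in some model of `Γ`: the image of `(0, ∞]` is open in `Γ`. -/
def IsRayChart (G : TropModel V E) (p : ℝ≥0∞ → G.Curve) : Prop :=
  Continuous p ∧ (∀ s t, G.dist (p s) (p t) = max (s - t) (t - s)) ∧ IsOpen (p '' Set.Ioi 0)

/-- The rays of `Γ`. -/
def IsRay (G : TropModel V E) (L : Set G.Curve) : Prop :=
  ∃ p, G.IsRayChart p ∧ Set.range p = L

/-- A parallelization of `Γ`: an equivalence relation on its rays such that rays `L ⊆ L'` are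
equivalent. With it, `Γ` is a tropical curve with parallel rays. -/
structure Parallelization (G : TropModel V E) where
  rel : Setoid {L : Set G.Curve // G.IsRay L}
  rel_of_subset : ∀ L L' : {L : Set G.Curve // G.IsRay L}, L.1 ⊆ L'.1 → rel L L'

/-- Two subsets of `Γ` are parallel rays. -/
def Parallelization.Parallel {G : TropModel V E} (R : G.Parallelization) (L L' : Set G.Curve) :
    Prop :=
  ∃ (h : G.IsRay L) (h' : G.IsRay L'), R.rel ⟨L, h⟩ ⟨L', h'⟩

/-- The rational function `f` on `Γ` has the slope `m` at infinity along the ray `L`. -/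
def HasSlopeAtInfinity (G : TropModel V E) (f : G.Rat G.whole) (L : Set G.Curve) (m : ℤ) : Prop :=
  ∃ p, G.IsRayChart p ∧ Set.range p = L ∧ ∃ (a : ℝ) (T : ℝ≥0), ∀ t : ℝ≥0, T ≤ t →
    f ⟨p t, trivial⟩ = ((a + m * t : ℝ) : EReal)

/-- The rational functions on the tropical curve with parallel rays: those with the same slope at
infinity along any two parallel rays, and the function `-∞`. -/
def Parallelization.ratPar {G : TropModel V E} (R : G.Parallelization) : Set (G.Rat G.whole) :=
  {f | (∀ x, f x = ⊥) ∨ ∀ L L', R.Parallel L L' →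
    ∃ m, G.HasSlopeAtInfinity f L m ∧ G.HasSlopeAtInfinity f L' m}

/-! ### Cores -/

/-- The closures of the connected components of the complement of a region. -/
def Region.outerRays {G : TropModel V E} (C : G.Region) : Set (Set G.Curve) :=
  {L | ∃ x ∈ C.carrierᶜ, L = closure (connectedComponentIn C.carrierᶜ x)}

/-- A core of `Γ`: a connected subgraph without rays (equivalently, without points at infinity) such
that the closure of every connected component of its complement is a ray. -/
structure Region.IsCore {G : TropModel V E} (C : G.Region) : Prop where
  connected : IsConnected C.carrier
  finite_points : Disjoint C.carrier G.infPts
  isRay : ∀ L ∈ C.outerRays, G.IsRay L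

/-- `r` is the map from `Γ` to the core `C` that is the identity on `C` and contracts every outer ray
to its boundary point, the only point that it shares with `C`. -/
def Region.IsContraction {G : TropModel V E} (C : G.Region) (r : G.Curve → C.carrier) : Prop :=
  (∀ x : C.carrier, r x = x) ∧ ∀ L ∈ C.outerRays, ∀ x ∈ L, (r x : G.Curve) ∈ L

/-- The complement, up to closure, of the union of the outer rays parallel to `L`; the core belongs
to it. -/
def Parallelization.awayFrom {G : TropModel V E} (R : G.Parallelization) (C : G.Region)
    (L : Set G.Curve) : Set G.Curve :=
  C.carrier ∪ closure (⋃₀ {L' ∈ C.outerRays | R.Parallel L L'})ᶜ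

end TropModel

namespace TropModel

variable {V E : Type*} {G : TropModel V E}

/-! ### Points of a curve -/

/-- The point with coordinate `t` on the edge `e`, where coordinates beyond the end are cut off. -/
noncomputable def pt (G : TropModel V E) (e : E) (t : ℝ≥0∞) : G.Curve :=
  G.onEdge e ⟨min t (G.len e), mem_Iic.2 (min_le_right _ _)⟩

theorem pt_of_le {e : E} {t : ℝ≥0∞} (h : t ≤ G.len e) : G.pt e t = G.onEdge e ⟨t, h⟩ := by
  unfold pt
  congr 2
  exact min_eq_left h

theorem continuous_pt (e : E) : Continuous (G.pt e) :=
  (G.continuous_onEdge e).comp (by fun_prop)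

theorem pt_zero (e : E) : G.pt e 0 = G.vertex (G.src e) := by
  rw [vertex_src, pt_of_le (zero_le : (0 : ℝ≥0∞) ≤ _)]

theorem pt_len (e : E) : G.pt e (G.len e) = G.vertex (G.tgt e) := by
  rw [vertex_tgt, pt_of_le le_rfl]

theorem vertex_or_pt (x : G.Curve) :
    (∃ v, x = G.vertex v) ∨ ∃ e t, t ≤ G.len e ∧ x = G.pt e t := by
  induction x using Quot.ind with
  | mk p =>
    rcases p with v | ⟨e, t, ht⟩
    · exact Or.inl ⟨v, rfl⟩
    · exact Or.inr ⟨e, t, ht, (pt_of_le (mem_Iic.1 ht)).symm⟩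

/-- The function on `Γ` that is given by `c` at the vertices and by `F e` on the edge `e`. -/
def glue {α : Type*} (G : TropModel V E) (c : V → α) (F : E → ℝ≥0∞ → α)
    (h0 : ∀ e, F e 0 = c (G.src e)) (h1 : ∀ e, F e (G.len e) = c (G.tgt e)) : G.Curve → α :=
  Quot.lift (Sum.elim c fun p => F p.1 p.2.1) (by
    intro a b hab
    cases hab with
    | src e => exact (h0 e).symm
    | tgt e => exact (h1 e).symm)

section glue

variable {α : Type*} {c : V → α} {F : E → ℝ≥0∞ → α} {h0 : ∀ e, F e 0 = c (G.src e)}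
  {h1 : ∀ e, F e (G.len e) = c (G.tgt e)}

theorem glue_vertex (v : V) : G.glue c F h0 h1 (G.vertex v) = c v := rfl

theorem glue_pt {e : E} {t : ℝ≥0∞} (h : t ≤ G.len e) : G.glue c F h0 h1 (G.pt e t) = F e t := by
  rw [pt_of_le h]; rfl

end glue

theorem continuous_of_edges {α : Type*} [TopologicalSpace α] {f : G.Curve → α}
    (h : ∀ e, ContinuousOn (fun t => f (G.pt e t)) (Iic (G.len e))) : Continuous f := by
  let _ : TopologicalSpace V := ⊥
  have : DiscreteTopology V := ⟨rfl⟩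
  refine (continuous_quot_lift (r := G.Glue) (f := fun p => f (Quot.mk _ p))
    (fun a b hab => congrArg f (Quot.sound hab)) ?_).congr fun x => ?_
  · refine continuous_sum_dom.2 ⟨continuous_of_discreteTopology, continuous_sigma fun e => ?_⟩
    refine (continuousOn_iff_continuous_domRestrict.1 (h e)).congr fun t => ?_
    exact congrArg f (pt_of_le t.2)
  · induction x using Quot.ind with
    | mk p => rfl

open Classical in
/-- The normal form of a point: either a vertex, or an inner point of an edge. -/
noncomputable def nf (G : TropModel V E) : G.Curve → V ⊕ (E × ℝ≥0∞) :=
  G.glue Sum.inl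
    (fun e t => if t = 0 then .inl (G.src e) else if t = G.len e then .inl (G.tgt e) else .inr (e, t))
    (fun e => if_pos rfl) (fun e => by rw [if_neg (G.len_pos e).ne', if_pos rfl])

theorem nf_vertex (v : V) : G.nf (G.vertex v) = .inl v := rfl

theorem nf_pt {e : E} {t : ℝ≥0∞} (h0 : 0 < t) (h1 : t < G.len e) : G.nf (G.pt e t) = .inr (e, t) := by
  rw [nf, glue_pt h1.le, if_neg h0.ne', if_neg h1.ne]

theorem vertex_injective : Function.Injective G.vertex := fun v w h => by
  simpa [nf_vertex] using congrArg G.nf h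

theorem pt_ne_vertex {e : E} {t : ℝ≥0∞} (h0 : 0 < t) (h1 : t < G.len e) (v : V) :
    G.pt e t ≠ G.vertex v := fun h => by
  simpa [nf_vertex, nf_pt h0 h1] using congrArg G.nf h

theorem pt_eq_pt {e e' : E} {t t' : ℝ≥0∞} (h0 : 0 < t) (h1 : t < G.len e) (h2 : t' ≤ G.len e')
    (h : G.pt e t = G.pt e' t') : e = e' ∧ t = t' := by
  rcases eq_or_lt_of_le (zero_le : 0 ≤ t') with rfl | h3
  · exact absurd (h.trans (pt_zero e')) (pt_ne_vertex h0 h1 _)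
  rcases eq_or_lt_of_le h2 with rfl | h4
  · exact absurd (h.trans (pt_len e')) (pt_ne_vertex h0 h1 _)
  simpa [nf_pt h0 h1, nf_pt h3 h4] using congrArg G.nf h

/-- The coordinates of the end points of the edges. -/
def IsEnd (G : TropModel V E) (p : E × ℝ≥0∞) : Prop := p.2 = 0 ∨ p.2 = G.len p.1

theorem finite_isEnd (G : TropModel V E) : {p | G.IsEnd p}.Finite := by
  have := G.finite_edges
  refine ((finite_range fun e : E => (e, (0 : ℝ≥0∞))).union
    (finite_range fun e : E => (e, G.len e))).subset ?_
  rintro ⟨e, t⟩ (h | h)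
  · exact Or.inl ⟨e, by rw [← h]⟩
  · exact Or.inr ⟨e, Prod.ext rfl h.symm⟩

/-- An inner point of an edge has a single coordinate, and any other point is a vertex, which only
end coordinates represent. -/
theorem finite_fiber (x : G.Curve) : {p : E × ℝ≥0∞ | p.2 ≤ G.len p.1 ∧ G.pt p.1 p.2 = x}.Finite := by
  by_cases h : ∃ e t, 0 < t ∧ t < G.len e ∧ x = G.pt e t
  · obtain ⟨e, t, h0, h1, rfl⟩ := h
    refine (finite_singleton (e, t)).subset ?_
    rintro ⟨e', t'⟩ ⟨h2, h3⟩
    obtain ⟨rfl, rfl⟩ := pt_eq_pt h0 h1 h2 h3.symm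
    rfl
  · refine G.finite_isEnd.subset ?_
    rintro ⟨e, t⟩ ⟨h2, h3⟩
    by_contra hc
    simp only [IsEnd, mem_ofPred_eq, not_or] at hc
    exact h ⟨e, t, pos_iff_ne_zero.2 hc.1, lt_of_le_of_ne h2 hc.2, h3.symm⟩

/-- Saturating a closed set adds only vertices and ends of intervals, of which there are finitely
many, so the saturation is closed. This gives the T1 property and reduces neighbourhoods of a point
to neighbourhoods of its fibre. -/
theorem isClosedMap_mk (G : TropModel V E) : IsClosedMap (Quot.mk G.Glue) := by
  let _ : TopologicalSpace V := ⊥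
  have : DiscreteTopology V := ⟨rfl⟩
  have hT : T1Space G.PrePoint := inferInstanceAs (T1Space (V ⊕ (Σ e : E, Set.Iic (G.len e))))
  have := G.finite_vertices
  have := G.finite_edges
  intro F hF
  have hq : IsQuotientMap (Quot.mk G.Glue) := isQuotientMap_quot_mk
  rw [← hq.isClosed_preimage]
  let S : Set G.PrePoint := range Sum.inl ∪ {p | ∃ e t, p = Sum.inr ⟨e, t⟩ ∧ G.IsEnd (e, t.1)}
  have hS : S.Finite := by
    refine (finite_range _).union ?_
    have h1 : {s : Σ e : E, Set.Iic (G.len e) | G.IsEnd (s.1, s.2.1)}.Finite := by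
      refine Set.Finite.preimage (f := fun s : Σ e : E, Set.Iic (G.len e) => (s.1, s.2.1)) ?_
        G.finite_isEnd
      rintro ⟨e, t, ht⟩ _ ⟨e', t', ht'⟩ _ h
      simp only [Prod.mk.injEq] at h
      obtain ⟨rfl, rfl⟩ := h
      rfl
    refine (h1.image (Sum.inr : _ → V ⊕ (Σ e : E, Set.Iic (G.len e)))).subset ?_
    rintro _ ⟨e, t, rfl, h⟩
    exact ⟨⟨e, t⟩, h, rfl⟩
  have key : Quot.mk G.Glue ⁻¹' (Quot.mk G.Glue '' F) =
      F ∪ (Quot.mk G.Glue ⁻¹' (Quot.mk G.Glue '' F) ∩ S) := by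
    refine Subset.antisymm ?_ (union_subset (subset_preimage_image _ _) inter_subset_left)
    rintro p hp
    by_cases hpS : p ∈ S
    · exact Or.inr ⟨hp, hpS⟩
    left
    obtain ⟨r, hr, hrp⟩ := hp
    rcases p with v | ⟨e, t, ht⟩
    · exact absurd (Or.inl ⟨v, rfl⟩) hpS
    have hend : ¬ G.IsEnd (e, t) := fun h => hpS (Or.inr ⟨e, ⟨t, ht⟩, rfl, h⟩)
    have h0 : 0 < t := pos_iff_ne_zero.2 fun h => hend (Or.inl h)
    have h1 : t < G.len e := lt_of_le_of_ne ht fun h => hend (Or.inr h)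
    have h2 : G.pt e t = Quot.mk G.Glue (Sum.inr ⟨e, t, ht⟩) := pt_of_le h1.le
    rw [← h2] at hrp
    rcases r with v | ⟨e', t', ht'⟩
    · exact absurd hrp.symm (pt_ne_vertex h0 h1 v)
    · obtain ⟨rfl, rfl⟩ := pt_eq_pt h0 h1 (mem_Iic.1 ht') (hrp.symm.trans (pt_of_le _).symm)
      exact hr
  rw [key]
  exact hF.union (hS.subset inter_subset_right).isClosed

instance (G : TropModel V E) : CompactSpace G.Curve := by
  let _ : TopologicalSpace V := ⊥
  have := G.finite_vertices
  have := G.finite_edges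
  have h : ∀ e, CompactSpace (Set.Iic (G.len e)) := fun e =>
    isCompact_iff_compactSpace.1 isClosed_Iic.isCompact
  have : CompactSpace G.PrePoint :=
    inferInstanceAs (CompactSpace (V ⊕ (Σ e : E, Set.Iic (G.len e))))
  exact inferInstanceAs (CompactSpace (Quot G.Glue))

theorem pt_notMem_infPts {e : E} {t : ℝ≥0∞} (ht : t ≠ ⊤) : G.pt e t ∉ G.infPts := by
  have h : min t (G.len e) ≠ ⊤ := fun h => ht (top_le_iff.1 (h ▸ min_le_left _ _))
  have h1 := G.onEdge_notMem_infPts e (min t (G.len e)).toNNReal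
    (by rw [ENNReal.coe_toNNReal h]; exact min_le_right _ _)
  convert h1 using 2
  unfold pt
  congr 2
  rw [ENNReal.coe_toNNReal h]

theorem pt_ofReal_notMem_infPts {e : E} {t : ℝ} : G.pt e (ENNReal.ofReal t) ∉ G.infPts :=
  pt_notMem_infPts ENNReal.ofReal_ne_top

theorem pt_top_mem_infPts {e : E} (he : G.len e = ⊤) : G.pt e ⊤ ∈ G.infPts :=
  ⟨e, he, by rw [← pt_len, he]⟩

theorem pt_mem_infPts_iff {e : E} {t : ℝ≥0∞} (ht : t ≤ G.len e) : G.pt e t ∈ G.infPts ↔ t = ⊤ := by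
  refine ⟨fun h => by_contra fun h' => pt_notMem_infPts h' h, ?_⟩
  rintro rfl
  exact pt_top_mem_infPts (top_le_iff.1 ht)

theorem mem_infPts_iff {x : G.Curve} : x ∈ G.infPts ↔ ∃ e, G.len e = ⊤ ∧ x = G.pt e ⊤ := by
  constructor
  · rintro ⟨e, he, rfl⟩
    exact ⟨e, he, by rw [← pt_len, he]⟩
  · rintro ⟨e, he, rfl⟩
    exact pt_top_mem_infPts he

theorem pt_top_injective {e e' : E} (he : G.len e = ⊤) (he' : G.len e' = ⊤)
    (h : G.pt e ⊤ = G.pt e' ⊤) : e = e' := by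
  have h1 : G.vertex (G.tgt e) = G.vertex (G.tgt e') := by rw [← pt_len, ← pt_len, he, he', h]
  exact G.leaf_tgt e' he' e (vertex_injective h1)

theorem pt_mem_tail {e : E} (he : G.len e = ⊤) {T : ℝ≥0} {t : ℝ≥0∞} (h : (T : ℝ≥0∞) < t) :
    G.pt e t ∈ G.tail e he T := by
  rw [pt_of_le (he ▸ le_top)]
  exact ⟨rfl, h⟩

theorem tail_eq {e : E} (he : G.len e = ⊤) (T : ℝ≥0) : G.tail e he T = G.pt e '' Ioi (T : ℝ≥0∞) := by
  refine Subset.antisymm (fun x hx => ?_) ?_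
  · by_cases hfin : x ∈ G.infPts
    · obtain ⟨e', he', rfl⟩ := mem_infPts_iff.1 hfin
      rw [pt_of_le (le_of_le_of_eq le_top he'.symm)] at hx
      obtain ⟨h1, h2⟩ : e' = e ∧ _ := hx
      subst h1
      exact ⟨⊤, h2, rfl⟩
    · obtain ⟨t, h1, h2, rfl⟩ := G.mem_tail e he T x hx hfin
      exact ⟨t, by simpa using h1, pt_of_le _⟩
  · rintro _ ⟨t, ht, rfl⟩
    exact pt_mem_tail he ht

theorem pt_injective {e : E} (he : G.len e = ⊤) : Function.Injective (G.pt e) := by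
  intro s t h
  have aux : ∀ s t, s ≠ ⊤ → G.pt e s = G.pt e t → s ≤ t := by
    intro s t hs h
    rcases eq_or_lt_of_le (zero_le : 0 ≤ s) with rfl | h0
    · exact bot_le
    · exact (pt_eq_pt h0 (he ▸ lt_top_iff_ne_top.2 hs) (he ▸ le_top) h).2.le
  by_cases hs : s = ⊤
  · subst hs
    have h1 := pt_top_mem_infPts he
    rw [h, pt_mem_infPts_iff (he ▸ le_top)] at h1
    exact h1.symm
  · have ht : t ≠ ⊤ := by
      rintro rfl
      have h1 := pt_top_mem_infPts he
      rw [← h, pt_mem_infPts_iff (he ▸ le_top)] at h1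
      exact hs h1
    exact le_antisymm (aux s t hs h) (aux t s ht h.symm)

end TropModel

/-- If S missed the frontier, the interior of A and the complement of its closure would separate it.
Applied to segments of edges, this turns a finite frontier into eventual membership or
non-membership. -/
theorem IsPreconnected.exists_mem_frontier {X : Type*} [TopologicalSpace X] {S A : Set X}
    (hS : IsPreconnected S) {x y : X} (hx : x ∈ S) (hxA : x ∈ A) (hy : y ∈ S) (hyA : y ∉ A) :
    ∃ z ∈ S, z ∈ frontier A := by
  by_contra hc
  push Not at hc
  have h1 : S ⊆ interior A ∪ (closure A)ᶜ := fun z hz => by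
    by_contra h
    simp only [mem_union, mem_compl_iff, not_or, not_not] at h
    exact hc z hz ⟨h.2, h.1⟩
  have hx' : x ∈ interior A := (h1 hx).resolve_right fun h => h (subset_closure hxA)
  have hy' : y ∈ (closure A)ᶜ := (h1 hy).resolve_left fun h => hyA (interior_subset h)
  obtain ⟨z, -, hz1, hz2⟩ := hS _ _ isOpen_interior isClosed_closure.isOpen_compl h1 ⟨x, hx, hx'⟩
    ⟨y, hy, hy'⟩
  exact hz2 (interior_subset_closure hz1)

namespace TropModel

variable {V E : Type*} {G : TropModel V E}

/-! ### Directions -/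

/-- A direction at a finite point: a coordinate on an edge, and whether it is going to increase or
to decrease. -/
structure Dir (G : TropModel V E) where
  edge : E
  pos : ℝ
  up : Bool
  pos_nonneg : 0 ≤ pos
  pos_le : ENNReal.ofReal pos ≤ G.len edge
  pos_lt_of_up : up = true → ENNReal.ofReal pos < G.len edge
  pos_of_down : up = false → 0 < pos

namespace Dir

/-- The sign of a direction. -/
def sgn (d : G.Dir) : ℝ := if d.up then 1 else -1

/-- The coordinate at distance `s` in the direction `d`. -/
def coord (d : G.Dir) (s : ℝ) : ℝ := d.pos + d.sgn * s

/-- The point at distance `s` in the direction `d`. -/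
noncomputable def path (d : G.Dir) (s : ℝ) : G.Curve := G.pt d.edge (ENNReal.ofReal (d.coord s))

/-- The point where a direction starts. -/
noncomputable def base (d : G.Dir) : G.Curve := G.pt d.edge (ENNReal.ofReal d.pos)

theorem coord_zero (d : G.Dir) : d.coord 0 = d.pos := by simp [coord]

theorem path_zero (d : G.Dir) : d.path 0 = d.base := by simp [path, base, coord_zero]

theorem base_notMem_infPts (d : G.Dir) : d.base ∉ G.infPts := pt_ofReal_notMem_infPts

theorem path_notMem_infPts (d : G.Dir) (s : ℝ) : d.path s ∉ G.infPts := pt_ofReal_notMem_infPts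

theorem continuous_coord (d : G.Dir) : Continuous d.coord := by unfold coord; fun_prop

theorem continuous_path (d : G.Dir) : Continuous d.path :=
  (continuous_pt _).comp (ENNReal.continuous_ofReal.comp d.continuous_coord)

theorem tendsto_path (d : G.Dir) : Tendsto d.path (𝓝[>] 0) (𝓝 d.base) := by
  rw [← d.path_zero]
  exact (d.continuous_path.tendsto 0).mono_left nhdsWithin_le_nhds

theorem sgn_cases (d : G.Dir) : (d.up = true ∧ d.sgn = 1) ∨ (d.up = false ∧ d.sgn = -1) := by
  unfold sgn
  cases d.up <;> simp

theorem eventually_inner (d : G.Dir) : ∀ᶠ s in 𝓝[>] (0 : ℝ),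
    0 < d.coord s ∧ ENNReal.ofReal (d.coord s) < G.len d.edge := by
  have hc : Tendsto d.coord (𝓝[>] 0) (𝓝 d.pos) := by
    rw [← d.coord_zero]
    exact (d.continuous_coord.tendsto 0).mono_left nhdsWithin_le_nhds
  rcases d.sgn_cases with ⟨h, hs⟩ | ⟨h, hs⟩
  · have h1 := (ENNReal.continuous_ofReal.tendsto _).comp hc
    filter_upwards [h1.eventually (gt_mem_nhds (d.pos_lt_of_up h)), self_mem_nhdsWithin] with s h2 h3
    refine ⟨?_, h2⟩
    rw [coord, hs]
    have := d.pos_nonneg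
    have : 0 < s := h3
    linarith
  · filter_upwards [hc.eventually (lt_mem_nhds (d.pos_of_down h)), self_mem_nhdsWithin] with s h2 h3
    refine ⟨h2, lt_of_lt_of_le ?_ d.pos_le⟩
    rw [ENNReal.ofReal_lt_ofReal_iff_of_nonneg h2.le, coord, hs]
    have : 0 < s := h3
    linarith

theorem eventually_path_ne_base (d : G.Dir) : ∀ᶠ s in 𝓝[>] (0 : ℝ), d.path s ≠ d.base := by
  filter_upwards [d.eventually_inner, self_mem_nhdsWithin] with s ⟨h1, h2⟩ h3 h
  have h4 := (pt_eq_pt (ENNReal.ofReal_pos.2 h1) h2 d.pos_le h).2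
  rw [ENNReal.ofReal_eq_ofReal_iff h1.le d.pos_nonneg, coord] at h4
  have : 0 < s := h3
  rcases d.sgn_cases with ⟨-, hs⟩ | ⟨-, hs⟩ <;> rw [hs] at h4 <;> linarith

theorem ext_iff' {d d' : G.Dir} : d = d' ↔ d.edge = d'.edge ∧ d.pos = d'.pos ∧ d.up = d'.up := by
  constructor
  · rintro rfl
    exact ⟨rfl, rfl, rfl⟩
  · cases d
    cases d'
    simp only [mk.injEq]
    exact id

theorem eventually_path_ne {d d' : G.Dir} (hne : d ≠ d') :
    ∀ᶠ s in 𝓝[>] (0 : ℝ), d.path s ≠ d'.path s := by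
  -- Opposite directions on one edge that start at different positions can meet only at half the
  -- distance of these positions.
  have hev : ∀ᶠ s in 𝓝[>] (0 : ℝ), d.pos = d'.pos ∨ s < |d.pos - d'.pos| / 2 := by
    by_cases h : d.pos = d'.pos
    · exact Eventually.of_forall fun _ => Or.inl h
    · have : (0 : ℝ) < |d.pos - d'.pos| / 2 := half_pos (abs_pos.2 (sub_ne_zero.2 h))
      filter_upwards [mem_nhdsWithin_of_mem_nhds (gt_mem_nhds this)] with s hs
      exact Or.inr hs
  filter_upwards [d.eventually_inner, d'.eventually_inner, self_mem_nhdsWithin, hev]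
    with s ⟨h1, h2⟩ ⟨h1', h2'⟩ h3 h4 h
  have h3 : 0 < s := h3
  obtain ⟨h5, h6⟩ := pt_eq_pt (ENNReal.ofReal_pos.2 h1) h2 h2'.le h
  rw [ENNReal.ofReal_eq_ofReal_iff h1.le h1'.le, coord, coord] at h6
  have h7 : d.up = d'.up → d.pos ≠ d'.pos := fun h8 h9 => hne (ext_iff'.2 ⟨h5, h9, h8⟩)
  rcases d.sgn_cases with ⟨hu, hs⟩ | ⟨hu, hs⟩ <;> rcases d'.sgn_cases with ⟨hu', hs'⟩ | ⟨hu', hs'⟩ <;>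
    rw [hs, hs'] at h6
  · exact h7 (hu.trans hu'.symm) (by linarith)
  · rcases h4 with h4 | h4
    · linarith
    · rcases abs_cases (d.pos - d'.pos) with ⟨h8, -⟩ | ⟨h8, -⟩ <;> linarith
  · rcases h4 with h4 | h4
    · linarith
    · rcases abs_cases (d.pos - d'.pos) with ⟨h8, -⟩ | ⟨h8, -⟩ <;> linarith
  · exact h7 (hu.trans hu'.symm) (by linarith)

theorem finite_base (x : G.Curve) : {d : G.Dir | d.base = x}.Finite := by
  have h := ((finite_fiber x).prod (finite_univ : (univ : Set Bool).Finite))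
  refine Set.Finite.of_finite_image (f := fun d : G.Dir => ((d.edge, ENNReal.ofReal d.pos), d.up))
    (h.subset ?_) ?_
  · rintro _ ⟨d, hd, rfl⟩
    exact ⟨⟨d.pos_le, hd⟩, trivial⟩
  · intro d _ d' _ hdd
    simp only [Prod.mk.injEq] at hdd
    refine ext_iff'.2 ⟨hdd.1.1, ?_, hdd.2⟩
    exact (ENNReal.ofReal_eq_ofReal_iff d.pos_nonneg d'.pos_nonneg).1 hdd.1.2

end Dir

instance (G : TropModel V E) : T1Space G.Curve := by
  let _ : TopologicalSpace V := ⊥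
  have : DiscreteTopology V := ⟨rfl⟩
  have hT : T1Space G.PrePoint := inferInstanceAs (T1Space (V ⊕ (Σ e : E, Set.Iic (G.len e))))
  refine ⟨fun x => ?_⟩
  induction x using Quot.ind with
  | mk p =>
    have h := G.isClosedMap_mk {p} isClosed_singleton
    rw [image_singleton] at h
    exact h

theorem Dir.eventually_path_notMem (d : G.Dir) {S : Set G.Curve} (hS : S.Finite) :
    ∀ᶠ s in 𝓝[>] (0 : ℝ), d.path s ∉ S := by
  have : ∀ x ∈ S, ∀ᶠ s in 𝓝[>] (0 : ℝ), d.path s ≠ x := by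
    intro x _
    by_cases hx : x = d.base
    · rw [hx]; exact d.eventually_path_ne_base
    · exact d.tendsto_path.eventually (isOpen_ne.mem_nhds (Ne.symm hx))
  filter_upwards [(eventually_all_finite hS).2 this] with s hs hsS
  exact hs _ hsS rfl

theorem exists_pos_of_eventually {p : ℝ → Prop} (h : ∀ᶠ s in 𝓝[>] (0 : ℝ), p s) :
    ∃ δ > 0, ∀ s, 0 < s → s < δ → p s := by
  obtain ⟨δ, h1, h2⟩ := (mem_nhdsGT_iff_exists_Ioo_subset).1 h
  exact ⟨δ, h1, fun s h3 h4 => h2 ⟨h3, h4⟩⟩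

theorem eventually_of_pos {p : ℝ → Prop} {δ : ℝ} (hδ : 0 < δ) (h : ∀ s, 0 < s → s < δ → p s) :
    ∀ᶠ s in 𝓝[>] (0 : ℝ), p s :=
  (mem_nhdsGT_iff_exists_Ioo_subset).2 ⟨δ, hδ, fun s hs => h s hs.1 hs.2⟩

/-- If `A` has a finite frontier, then a direction either goes into `A` or out of it. -/
theorem Dir.eventually_mem_or (d : G.Dir) {A : Set G.Curve} (hA : (frontier A).Finite) :
    (∀ᶠ s in 𝓝[>] (0 : ℝ), d.path s ∈ A) ∨ ∀ᶠ s in 𝓝[>] (0 : ℝ), d.path s ∉ A := by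
  obtain ⟨δ, hδ, h⟩ := exists_pos_of_eventually (d.eventually_path_notMem hA)
  by_contra hc
  rw [not_or] at hc
  have h1 : ∃ s ∈ Ioo 0 δ, d.path s ∉ A := by
    by_contra h1
    push Not at h1
    exact hc.1 (eventually_of_pos hδ fun s h2 h3 => h1 s ⟨h2, h3⟩)
  have h1' : ∃ s ∈ Ioo 0 δ, d.path s ∈ A := by
    by_contra h1
    push Not at h1
    exact hc.2 (eventually_of_pos hδ fun s h2 h3 => h1 s ⟨h2, h3⟩)
  obtain ⟨s, hs, hsA⟩ := h1
  obtain ⟨t, ht, htA⟩ := h1'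
  obtain ⟨_, ⟨u, hu, rfl⟩, h2⟩ := (isPreconnected_Ioo.image _
    d.continuous_path.continuousOn).exists_mem_frontier (mem_image_of_mem _ ht) htA
    (mem_image_of_mem _ hs) hsA
  exact h u hu.1 hu.2 h2

/-- A property holds near a finite point if it holds in every direction. -/
theorem eventually_nhds_of_dir {x : G.Curve} (hx : x ∉ G.infPts) {p : G.Curve → Prop} (h : p x)
    (hd : ∀ d : G.Dir, d.base = x → ∀ᶠ s in 𝓝[>] (0 : ℝ), p (d.path s)) : ∀ᶠ y in 𝓝 x, p y := by
  let _ : TopologicalSpace V := ⊥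
  have : DiscreteTopology V := ⟨rfl⟩
  -- The quotient map is closed, so it is enough to verify the property near each of the points that
  -- are glued to x.
  have key := G.isClosedMap_mk.eventually_nhds_fiber (p := fun z => p (Quot.mk _ z)) x ?_
  · filter_upwards [key] with y hy
    induction y using Quot.ind with
    | mk z => exact hy z rfl
  rintro (v | ⟨e, t, ht⟩) hz
  · have h1 : 𝓝 (Sum.inl v : V ⊕ (Σ e : E, Set.Iic (G.len e))) = pure (Sum.inl v) := by
      rw [nhds_inl, nhds_discrete, map_pure]
    have h2 : @nhds G.PrePoint _ (Sum.inl v) ≤ pure (Sum.inl v : G.PrePoint) := h1.le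
    refine Eventually.filter_mono h2 (eventually_pure.2 ?_)
    have hz' : (Quot.mk _ (Sum.inl v : G.PrePoint) : G.Curve) = x := hz
    exact hz'.symm ▸ h
  have ht' : t ≤ G.len e := ht
  have hz' : G.pt e t = x := (pt_of_le ht').trans hz
  have htop : t ≠ ⊤ := fun h => hx (by rw [← hz', pt_mem_infPts_iff ht']; exact h)
  obtain ⟨a, ha, rfl⟩ : ∃ a : ℝ, 0 ≤ a ∧ t = ENNReal.ofReal a :=
    ⟨t.toReal, ENNReal.toReal_nonneg, (ENNReal.ofReal_toReal htop).symm⟩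
  have hup : ∃ δ > 0, ∀ b, a < b → b < a + δ → ENNReal.ofReal b ≤ G.len e →
      p (G.pt e (ENNReal.ofReal b)) := by
    by_cases hlt : ENNReal.ofReal a < G.len e
    · obtain ⟨δ, hδ, h1⟩ := exists_pos_of_eventually
        (hd ⟨e, a, true, ha, ht', fun _ => hlt, fun h => by simp at h⟩ hz')
      refine ⟨δ, hδ, fun b h2 h3 _ => ?_⟩
      have := h1 (b - a) (by linarith) (by linarith)
      simpa [Dir.path, Dir.coord, Dir.sgn] using this
    · refine ⟨1, one_pos, fun b h2 _ h3 => absurd h3 (not_le.2 ?_)⟩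
      refine lt_of_le_of_lt (not_lt.1 hlt) ?_
      rwa [ENNReal.ofReal_lt_ofReal_iff_of_nonneg ha]
  have hdown : ∃ δ > 0, ∀ b, 0 ≤ b → b < a → a - δ < b → p (G.pt e (ENNReal.ofReal b)) := by
    rcases eq_or_lt_of_le ha with rfl | hlt
    · exact ⟨1, one_pos, fun b h1 h2 => absurd h1 (not_le.2 h2)⟩
    · obtain ⟨δ, hδ, h1⟩ := exists_pos_of_eventually
        (hd ⟨e, a, false, ha, ht', fun h => by simp at h, fun _ => hlt⟩ hz')
      refine ⟨δ, hδ, fun b _ h2 h3 => ?_⟩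
      have := h1 (a - b) (by linarith) (by linarith)
      simpa [Dir.path, Dir.coord, Dir.sgn] using this
  obtain ⟨δ, hδ, hup⟩ := hup
  obtain ⟨δ', hδ', hdown⟩ := hdown
  have hnhds : ∀ᶠ w : ℝ≥0∞ in 𝓝 (ENNReal.ofReal a), w ≤ G.len e → p (G.pt e w) := by
    have h1 : ∀ᶠ w : ℝ≥0∞ in 𝓝 (ENNReal.ofReal a), w < ENNReal.ofReal (a + δ) :=
      gt_mem_nhds (by rw [ENNReal.ofReal_lt_ofReal_iff_of_nonneg ha]; linarith)
    have h2 : ∀ᶠ w : ℝ≥0∞ in 𝓝 (ENNReal.ofReal a), a = 0 ∨ ENNReal.ofReal (a - δ') < w := by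
      rcases eq_or_lt_of_le ha with rfl | hlt
      · exact Eventually.of_forall fun _ => Or.inl rfl
      · filter_upwards [lt_mem_nhds (show ENNReal.ofReal (a - δ') < ENNReal.ofReal a by
          rw [ENNReal.ofReal_lt_ofReal_iff hlt]; linarith)] with w hw
        exact Or.inr hw
    filter_upwards [h1, h2] with w h3 h4 h5
    obtain ⟨b, hb, rfl⟩ : ∃ b : ℝ, 0 ≤ b ∧ w = ENNReal.ofReal b :=
      ⟨w.toReal, ENNReal.toReal_nonneg, (ENNReal.ofReal_toReal (ne_top_of_lt h3)).symm⟩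
    rcases lt_trichotomy a b with hab | rfl | hab
    · exact hup b hab ((ENNReal.ofReal_lt_ofReal_iff_of_nonneg hb).1 h3) h5
    · rwa [hz']
    · refine hdown b hb hab ?_
      rcases h4 with rfl | h4
      · exact absurd hb (not_le.2 hab)
      · exact lt_of_not_ge fun h6 => absurd (ENNReal.ofReal_le_ofReal h6) (not_le.2 h4)
  have hmap : 𝓝 (Sum.inr ⟨e, ⟨ENNReal.ofReal a, ht⟩⟩ : V ⊕ (Σ e : E, Set.Iic (G.len e))) =
      map (fun w : Set.Iic (G.len e) => Sum.inr ⟨e, w⟩) (𝓝 ⟨ENNReal.ofReal a, ht⟩) := by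
    rw [nhds_inr, Sigma.nhds_mk, map_map]
    rfl
  have hmap' : @nhds G.PrePoint _ (Sum.inr ⟨e, ⟨ENNReal.ofReal a, ht⟩⟩) ≤
      map (fun w : Set.Iic (G.len e) => (Sum.inr ⟨e, w⟩ : G.PrePoint)) (𝓝 ⟨ENNReal.ofReal a, ht⟩) :=
    hmap.le
  refine Eventually.filter_mono hmap' (eventually_map.2 ?_)
  filter_upwards [(continuous_subtype_val.tendsto _).eventually hnhds] with w hw
  have h1 := hw w.2
  rwa [pt_of_le w.2] at h1

/-- A property holds near a point at infinity if it holds there and at all large coordinates. -/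
theorem eventually_nhds_pt_top {e : E} (he : G.len e = ⊤) {p : G.Curve → Prop} (h : p (G.pt e ⊤))
    (h' : ∀ᶠ t : ℝ in atTop, p (G.pt e (ENNReal.ofReal t))) : ∀ᶠ y in 𝓝 (G.pt e ⊤), p y := by
  obtain ⟨T, hT⟩ := eventually_atTop.1 h'
  filter_upwards [(G.isOpen_tail e he T.toNNReal).mem_nhds (pt_mem_tail he ENNReal.coe_lt_top)]
    with y hy
  rw [tail_eq] at hy
  obtain ⟨t, ht, rfl⟩ := hy
  by_cases h1 : t = ⊤
  · rwa [h1]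
  · rw [← ENNReal.ofReal_toReal h1]
    refine hT _ ?_
    have h2 : ENNReal.ofReal T < t := ht
    exact (ENNReal.ofReal_le_iff_le_toReal h1).1 h2.le

theorem tendsto_pt_top {e : E} :
    Tendsto (fun t : ℝ => G.pt e (ENNReal.ofReal t)) atTop (𝓝 (G.pt e ⊤)) :=
  ((continuous_pt e).tendsto _).comp (ENNReal.tendsto_ofReal_nhds_top.2 tendsto_id)

instance (G : TropModel V E) : ConnectedSpace G.Curve := by
  obtain ⟨v⟩ := G.nonempty_vertices
  have hedge : ∀ e s t, G.pt e s ∈ connectedComponent (G.pt e t) := fun e s t =>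
    (isPreconnected_range (continuous_pt e)).subset_connectedComponent (mem_range_self t)
      (mem_range_self s)
  have hv : ∀ u w, Relation.EqvGen (fun a b => ∃ e, G.src e = a ∧ G.tgt e = b) u w →
      connectedComponent (G.vertex u) = connectedComponent (G.vertex w) := by
    intro u w h
    induction h with
    | rel a b h =>
      obtain ⟨e, rfl, rfl⟩ := h
      rw [← pt_zero, ← pt_len]
      exact (connectedComponent_eq (hedge e _ _)).symm
    | refl => rfl
    | symm _ _ _ h => exact h.symm
    | trans _ _ _ _ _ h1 h2 => exact h1.trans h2
  refine connectedSpace_iff_connectedComponent.2 ⟨G.vertex v, eq_univ_of_forall fun x => ?_⟩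
  rcases vertex_or_pt x with ⟨w, rfl⟩ | ⟨e, t, -, rfl⟩
  · rw [hv v w (G.connected v w)]
    exact mem_connectedComponent
  · rw [hv v (G.src e) (G.connected _ _), ← pt_zero]
    exact hedge e _ _

/-! ### The path distance -/

/-- The distance of two coordinates. -/
noncomputable def gap (s t : ℝ≥0∞) : ℝ≥0∞ := max (s - t) (t - s)

theorem gap_comm (s t : ℝ≥0∞) : gap s t = gap t s := max_comm _ _

theorem gap_self (s : ℝ≥0∞) : gap s s = 0 := by simp [gap]

theorem gap_of_le {s t : ℝ≥0∞} (h : s ≤ t) : gap s t = t - s := by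
  rw [gap, tsub_eq_zero_of_le h]
  exact max_eq_right bot_le

theorem gap_ne_top {s t : ℝ≥0∞} (hs : s ≠ ⊤) (ht : t ≠ ⊤) : gap s t ≠ ⊤ := by
  rcases le_total s t with h | h
  · rw [gap_of_le h]; exact ENNReal.sub_ne_top ht
  · rw [gap_comm, gap_of_le h]; exact ENNReal.sub_ne_top hs

theorem le_add_gap (s t : ℝ≥0∞) : t ≤ s + gap s t :=
  le_add_tsub.trans (add_le_add le_rfl (le_max_right _ _))

theorem gap_le_of_mem_uIcc {s t w : ℝ≥0∞} (h : w ∈ uIcc s t) : gap w t ≤ gap s t := by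
  rcases le_total s t with h1 | h1
  · rw [uIcc_of_le h1] at h
    rw [gap_of_le h.2, gap_of_le h1]
    exact tsub_le_tsub_left h.1 _
  · rw [uIcc_of_ge h1] at h
    rw [gap_comm, gap_of_le h.1, gap_comm, gap_of_le h1]
    exact tsub_le_tsub_right h.2 _

/-- Functions of a coordinate that are Lipschitz with constant `1`. -/
def Lip (F : ℝ≥0∞ → ℝ≥0∞) : Prop := ∀ s t, F t ≤ F s + gap s t

namespace Lip

theorem id : Lip fun t => t := le_add_gap

theorem const (c : ℝ≥0∞) : Lip fun _ => c := fun _ _ => le_self_add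

theorem min {F F' : ℝ≥0∞ → ℝ≥0∞} (h : Lip F) (h' : Lip F') : Lip fun t => min (F t) (F' t) := by
  intro s t
  rw [min_add_add_right (F s) (F' s) (gap s t) |>.symm]
  exact min_le_min (h s t) (h' s t)

theorem max {F F' : ℝ≥0∞ → ℝ≥0∞} (h : Lip F) (h' : Lip F') : Lip fun t => max (F t) (F' t) := by
  intro s t
  rw [max_add_add_right (F s) (F' s) (gap s t) |>.symm]
  exact max_le_max (h s t) (h' s t)

theorem add_const {F : ℝ≥0∞ → ℝ≥0∞} (h : Lip F) (c : ℝ≥0∞) : Lip fun t => c + F t := by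
  intro s t
  rw [add_assoc]
  exact add_le_add le_rfl (h s t)

theorem const_sub (c : ℝ≥0∞) : Lip fun t => c - t := by
  intro s t
  refine tsub_le_iff_right.2 ?_
  calc c ≤ c - s + s := le_tsub_add
    _ ≤ c - s + (t + gap t s) := add_le_add le_rfl (le_add_gap t s)
    _ = c - s + gap s t + t := by rw [gap_comm t s]; ring

end Lip

/-- Functions on `Γ` that are Lipschitz with constant `1` along every edge. -/
def EdgeLip (G : TropModel V E) (Φ : G.Curve → ℝ≥0∞) : Prop :=
  ∀ e s t, s ≤ G.len e → t ≤ G.len e → Φ (G.pt e t) ≤ Φ (G.pt e s) + gap s t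

theorem dist_self (x : G.Curve) : G.dist x x = 0 :=
  le_antisymm (sInf_le Reach.refl) bot_le

theorem dist_pt_right_le (x : G.Curve) {e : E} {s t : ℝ≥0∞} (hs : s ≤ G.len e) (ht : t ≤ G.len e) :
    G.dist x (G.pt e t) ≤ G.dist x (G.pt e s) + gap s t := by
  unfold dist
  rw [ENNReal.sInf_add]
  refine le_iInf₂ fun r hr => sInf_le ?_
  rw [pt_of_le hs] at hr
  rw [pt_of_le ht]
  exact Reach.step e ⟨s, hs⟩ ⟨t, ht⟩ r hr

theorem dist_pt_le {e : E} {s t : ℝ≥0∞} (hs : s ≤ G.len e) (ht : t ≤ G.len e) :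
    G.dist (G.pt e s) (G.pt e t) ≤ gap s t := by
  have := dist_pt_right_le (G.pt e s) hs ht
  rwa [dist_self, zero_add] at this

namespace EdgeLip

variable {Φ : G.Curve → ℝ≥0∞}

/-- All lower bounds for `dist` come from here: the distance is an infimum over paths, and an
edgewise Lipschitz function cannot change faster than the path length. Recording both inequalities
makes the symmetry of `dist` dispensable. -/
theorem le_of_reach (h : G.EdgeLip Φ) {x y : G.Curve} {r : ℝ≥0∞} (hr : G.Reach x y r) :
    Φ y ≤ Φ x + r ∧ Φ x ≤ Φ y + r := by
  induction hr with
  | refl => simp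
  | step e s t r _ ih =>
    rw [← pt_of_le s.2] at ih
    rw [← pt_of_le t.2]
    constructor
    · refine (h e s t s.2 t.2).trans ?_
      rw [← add_assoc]
      exact add_le_add ih.1 le_rfl
    · refine ih.2.trans ((add_le_add (h e t s t.2 s.2) le_rfl).trans ?_)
      rw [gap_comm, add_assoc, add_comm r]
      rfl

theorem le_add_dist (h : G.EdgeLip Φ) (x y : G.Curve) : Φ y ≤ Φ x + G.dist x y := by
  unfold dist
  rw [add_comm, ENNReal.sInf_add]
  refine le_iInf₂ fun r hr => ?_
  rw [add_comm]
  exact (h.le_of_reach hr).1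

theorem le_add_dist' (h : G.EdgeLip Φ) (x y : G.Curve) : Φ x ≤ Φ y + G.dist x y := by
  unfold dist
  rw [add_comm, ENNReal.sInf_add]
  refine le_iInf₂ fun r hr => ?_
  rw [add_comm]
  exact (h.le_of_reach hr).2

/-- Two finite coordinates of an edge have a finite gap, so finiteness spreads along edges and, as
the graph is connected, to all finite points. -/
theorem ne_top (h : G.EdgeLip Φ) {x : G.Curve} (hx : x ∉ G.infPts) (hΦ : Φ x ≠ ⊤) {y : G.Curve}
    (hy : y ∉ G.infPts) : Φ y ≠ ⊤ := by
  -- A vertex at infinity is replaced by the other end of its unique edge, because Φ may be infinite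
  -- at infinity. With this modification the property is constant along every edge.
  let P : V → Prop := fun v => ∀ w, (w = v ∧ (∀ e, G.len e = ⊤ → G.tgt e ≠ v)) ∨
    (∃ e, G.len e = ⊤ ∧ G.tgt e = v ∧ G.src e = w) → Φ (G.vertex w) ≠ ⊤
  have hstep : ∀ e s t, s ≤ G.len e → t ≤ G.len e → s ≠ ⊤ → t ≠ ⊤ → Φ (G.pt e s) ≠ ⊤ →
      Φ (G.pt e t) ≠ ⊤ := fun e s t hs ht hs' ht' h1 h2 => by
    have h3 := h e s t hs ht
    rw [h2, top_le_iff] at h3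
    exact (ENNReal.add_ne_top.2 ⟨h1, gap_ne_top hs' ht'⟩) h3
  have hfin : ∀ v, (∀ e, G.len e = ⊤ → G.tgt e ≠ v) → (P v ↔ Φ (G.vertex v) ≠ ⊤) := by
    intro v hv
    refine ⟨fun hP => hP v (Or.inl ⟨rfl, hv⟩), ?_⟩
    rintro h1 w (⟨rfl, -⟩ | ⟨e, he, hev, -⟩)
    · exact h1
    · exact absurd hev (hv e he)
  have hinf : ∀ e, G.len e = ⊤ → (P (G.tgt e) ↔ Φ (G.vertex (G.src e)) ≠ ⊤) := by
    intro e he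
    refine ⟨fun hP => hP _ (Or.inr ⟨e, he, rfl, rfl⟩), ?_⟩
    rintro h1 w (⟨rfl, h2⟩ | ⟨e', -, h2, rfl⟩)
    · exact absurd rfl (h2 e he)
    · rwa [G.leaf_tgt e he e' h2]
  have hsrc : ∀ e, P (G.src e) ↔ Φ (G.vertex (G.src e)) ≠ ⊤ := fun e =>
    hfin _ fun e' he' h1 => G.leaf_src e' he' e h1.symm
  have hP : ∀ u v, Relation.EqvGen (fun a b => ∃ e, G.src e = a ∧ G.tgt e = b) u v →
      (P u ↔ P v) := by
    intro u v huv
    induction huv with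
    | rel a b h1 =>
      obtain ⟨e, rfl, rfl⟩ := h1
      by_cases he : G.len e = ⊤
      · rw [hsrc, hinf e he]
      · rw [hsrc, hfin (G.tgt e) fun e' he' h1 => he (by rw [G.leaf_tgt e' he' e h1.symm, he']),
          ← pt_zero, ← pt_len]
        exact ⟨hstep e _ _ bot_le le_rfl ENNReal.zero_ne_top he,
          hstep e _ _ le_rfl bot_le he ENNReal.zero_ne_top⟩
    | refl => rfl
    | symm _ _ _ ih => exact ih.symm
    | trans _ _ _ _ _ h1 h2 => exact h1.trans h2
  have hx' : ∀ x, x ∉ G.infPts → ∃ v, P v ↔ Φ x ≠ ⊤ := by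
    intro x hx
    rcases vertex_or_pt x with ⟨v, rfl⟩ | ⟨e, t, ht, rfl⟩
    · exact ⟨v, hfin v fun e he h1 => hx ⟨e, he, by rw [h1]⟩⟩
    · refine ⟨G.src e, ?_⟩
      have ht' : t ≠ ⊤ := fun h1 => hx ((pt_mem_infPts_iff ht).2 h1)
      rw [hsrc, ← pt_zero]
      exact ⟨hstep e _ _ bot_le ht ENNReal.zero_ne_top ht', hstep e _ _ ht bot_le ht' ENNReal.zero_ne_top⟩
  obtain ⟨v, hv⟩ := hx' x hx
  obtain ⟨w, hw⟩ := hx' y hy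
  exact hw.1 ((hP v w (G.connected v w)).1 (hv.2 hΦ))

end EdgeLip

/-- The distance from a set. -/
noncomputable def setDist (G : TropModel V E) (A : Set G.Curve) (x : G.Curve) : ℝ≥0∞ :=
  ⨅ y ∈ A, G.dist y x

theorem setDist_of_mem {A : Set G.Curve} {x : G.Curve} (hx : x ∈ A) : G.setDist A x = 0 :=
  le_antisymm ((iInf₂_le x hx).trans (dist_self x).le) bot_le

theorem edgeLip_setDist (A : Set G.Curve) : G.EdgeLip (G.setDist A) := by
  intro e s t hs ht
  unfold setDist
  simp_rw [ENNReal.iInf_add]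
  exact le_iInf₂ fun y hy => (iInf₂_le y hy).trans (dist_pt_right_le y hs ht)

theorem EdgeLip.le_setDist {Φ : G.Curve → ℝ≥0∞} (h : G.EdgeLip Φ) {A : Set G.Curve}
    (hA : ∀ y ∈ A, Φ y = 0) (x : G.Curve) : Φ x ≤ G.setDist A x := by
  refine le_iInf₂ fun y hy => ?_
  have := h.le_add_dist y x
  rwa [hA y hy, zero_add] at this

theorem setDist_ne_top {A : Set G.Curve} (hA : ∃ a ∈ A, a ∉ G.infPts) {x : G.Curve}
    (hx : x ∉ G.infPts) : G.setDist A x ≠ ⊤ := by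
  obtain ⟨a, ha, ha'⟩ := hA
  exact (edgeLip_setDist A).ne_top ha' (by rw [setDist_of_mem ha]; exact ENNReal.zero_ne_top) hx

theorem chipFiring_eq (A : Set G.Curve) (l : ℝ≥0∞) (x : G.Curve) :
    G.chipFiring A l x = -((min (G.setDist A x) l : ℝ≥0∞) : EReal) := rfl

/-! ### Finitely many functions that separate points -/

open Classical in
/-- The function that is `F` on the edge `e` and `0` on the other edges. -/
noncomputable def bump (G : TropModel V E) (e : E) (F : ℝ≥0∞ → ℝ≥0∞) (h0 : F 0 = 0)
    (h1 : G.len e ≠ ⊤ → F (G.len e) = 0) : G.Curve → ℝ≥0∞ :=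
  G.glue (fun v => if v = G.tgt e then F (G.len e) else 0) (fun e' t => if e' = e then F t else 0)
    (by
      intro e'
      have h2 : (if e' = e then F 0 else 0) = 0 := by split_ifs <;> simp [h0]
      rw [h2]
      by_cases he : G.len e = ⊤
      · rw [if_neg (G.leaf_src e he e')]
      · rw [h1 he, ite_self])
    (by
      intro e'
      by_cases he' : e' = e
      · rw [if_pos he', he', if_pos rfl]
      rw [if_neg he']
      by_cases he : G.len e = ⊤
      · rw [if_neg fun h => he' (G.leaf_tgt e he e' h)]
      · rw [h1 he, ite_self])

section bump

variable {e : E} {F : ℝ≥0∞ → ℝ≥0∞} {h0 : F 0 = 0} {h1 : G.len e ≠ ⊤ → F (G.len e) = 0}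

theorem bump_pt {t : ℝ≥0∞} (ht : t ≤ G.len e) : G.bump e F h0 h1 (G.pt e t) = F t := by
  rw [bump, glue_pt ht, if_pos rfl]

theorem bump_pt_of_ne {e' : E} (he : e' ≠ e) {t : ℝ≥0∞} (ht : t ≤ G.len e') :
    G.bump e F h0 h1 (G.pt e' t) = 0 := by
  rw [bump, glue_pt ht, if_neg he]

theorem bump_vertex {v : V} (h : G.len e = ⊤ → G.tgt e ≠ v) :
    G.bump e F h0 h1 (G.vertex v) = 0 := by
  rw [bump, glue_vertex]
  by_cases he : G.len e = ⊤
  · rw [if_neg fun h2 => h he h2.symm]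
  · rw [h1 he, ite_self]

theorem edgeLip_bump (hF : Lip F) : G.EdgeLip (G.bump e F h0 h1) := by
  intro e' s t hs ht
  by_cases he : e' = e
  · subst he
    rw [bump_pt hs, bump_pt ht]
    exact hF s t
  · rw [bump_pt_of_ne he ht]
    exact bot_le

theorem continuous_bump (hF : Continuous F) : Continuous (G.bump e F h0 h1) := by
  refine continuous_of_edges fun e' => ?_
  by_cases he : e' = e
  · subst he
    exact hF.continuousOn.congr fun t ht => bump_pt ht
  · exact continuousOn_const.congr fun t ht => bump_pt_of_ne he ht

end bump

/-- Distinct multiples of a small constant. Bounding them by every edge length leaves enough room on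
each edge to pass from one end value to the other with slope 1 or -1. -/
theorem exists_heights (G : TropModel V E) : ∃ c : V → ℝ≥0, Function.Injective c ∧
    ∀ v e, (c v : ℝ≥0∞) ≤ G.len e := by
  have := G.finite_vertices
  have := G.finite_edges
  obtain ⟨δ, hδ, h⟩ : ∃ δ : ℝ≥0, 0 < δ ∧ ∀ e, (δ : ℝ≥0∞) ≤ G.len e := by
    rcases isEmpty_or_nonempty E with hE | hE
    · exact ⟨1, one_pos, fun e => hE.elim e⟩
    obtain ⟨e₀, he₀⟩ := Finite.exists_min G.len
    have h1 : 0 < min 1 (G.len e₀) := lt_min one_pos (G.len_pos e₀)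
    have h2 : min 1 (G.len e₀) ≠ ⊤ := ne_top_of_le_ne_top ENNReal.one_ne_top (min_le_left _ _)
    refine ⟨(min 1 (G.len e₀)).toNNReal, ENNReal.toNNReal_pos h1.ne' h2, fun e => ?_⟩
    rw [ENNReal.coe_toNNReal h2]
    exact (min_le_right _ _).trans (he₀ e)
  obtain ⟨n, ⟨φ⟩⟩ := Finite.exists_equiv_fin V
  refine ⟨fun v => δ * ((φ v : ℕ) / (n : ℝ≥0)), fun v w hvw => ?_, fun v e => ?_⟩
  · have hn : (n : ℝ≥0) ≠ 0 := by
      have := (φ v).pos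
      positivity
    have h1 := mul_left_cancel₀ hδ.ne' hvw
    rw [div_left_inj' hn] at h1
    exact φ.injective (Fin.ext (by exact_mod_cast h1))
  · refine le_trans ?_ (h e)
    rw [ENNReal.coe_le_coe]
    refine mul_le_of_le_one_right bot_le (div_le_one_of_le₀ ?_ bot_le)
    exact_mod_cast (φ v).is_lt.le

/-- A function with distinct values at the vertices. -/
noncomputable def height (G : TropModel V E) : G.Curve → ℝ≥0∞ :=
  let c := G.exists_heights.choose
  -- On each edge the function climbs or falls with slope ±1 from the value at the source to the
  -- value at the target, and then stays there.
  G.glue (fun v => c v) (fun e t => max (min (c (G.src e) + t) (c (G.tgt e))) (c (G.src e) - t))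
    (fun e => by
      rw [add_zero, tsub_zero]
      exact max_eq_right (min_le_left _ _))
    (fun e => by
      have h := G.exists_heights.choose_spec.2
      rw [tsub_eq_zero_of_le (h _ e), min_eq_right ((h _ e).trans le_add_self)]
      exact max_eq_left bot_le)

theorem exists_height_pt (G : TropModel V E) (e : E) : ∃ a b : ℝ≥0, ∀ t ≤ G.len e,
    G.height (G.pt e t) = max (min (a + t) b) (a - t) :=
  ⟨G.exists_heights.choose (G.src e), G.exists_heights.choose (G.tgt e), fun t ht => by
    rw [height, glue_pt ht]⟩

theorem height_vertex_injective (G : TropModel V E) :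
    Function.Injective fun v => G.height (G.vertex v) := fun _ _ h =>
  G.exists_heights.choose_spec.1 (ENNReal.coe_injective h)

theorem edgeLip_height (G : TropModel V E) : G.EdgeLip G.height := by
  intro e s t hs ht
  obtain ⟨a, b, h⟩ := G.exists_height_pt e
  rw [h s hs, h t ht]
  exact ((Lip.id.add_const a).min (Lip.const b)).max (Lip.const_sub a) s t

theorem continuous_height (G : TropModel V E) : Continuous G.height := by
  refine continuous_of_edges fun e => ?_
  obtain ⟨a, b, h⟩ := G.exists_height_pt e
  refine ContinuousOn.congr (Continuous.continuousOn ?_) h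
  exact ((continuous_const.add continuous_id).min continuous_const).max
    (ENNReal.continuous_sub_left ENNReal.coe_ne_top)

/-- The end of the support of a tent function: all of the edge, or two thirds of it. -/
noncomputable def tentLen (l : ℝ) (b : Bool) : ℝ := if b then l else 2 / 3 * l

/-- A tent function on an edge of finite length, and the coordinate on an edge of infinite
length. -/
noncomputable def tent (l : ℝ≥0∞) (b : Bool) (t : ℝ≥0∞) : ℝ≥0∞ :=
  if l = ⊤ then t else min t (ENNReal.ofReal (tentLen l.toReal b) - t)

theorem tent_zero (l : ℝ≥0∞) (b : Bool) : tent l b 0 = 0 := by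
  simp [tent]

theorem tentLen_le {l : ℝ} (hl : 0 ≤ l) (b : Bool) : tentLen l b ≤ l := by
  unfold tentLen; split_ifs <;> linarith

theorem tent_len {l : ℝ≥0∞} (b : Bool) (hl : l ≠ ⊤) : tent l b l = 0 := by
  rw [tent, if_neg hl, tsub_eq_zero_of_le]
  · exact min_eq_right bot_le
  · exact ENNReal.ofReal_le_of_le_toReal (tentLen_le ENNReal.toReal_nonneg b)

theorem tent_top (b : Bool) (t : ℝ≥0∞) : tent ⊤ b t = t := if_pos rfl

theorem tent_ofReal {l : ℝ} (b : Bool) {t : ℝ} (hl : 0 ≤ l) (ht : 0 ≤ t) :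
    tent (ENNReal.ofReal l) b (ENNReal.ofReal t) = ENNReal.ofReal (min t (tentLen l b - t)) := by
  rw [tent, if_neg ENNReal.ofReal_ne_top, ENNReal.toReal_ofReal hl, ← ENNReal.ofReal_sub _ ht,
    ENNReal.ofReal_mono.map_min]

theorem lip_tent (l : ℝ≥0∞) (b : Bool) : Lip (tent l b) := by
  unfold tent
  split_ifs
  · exact Lip.id
  · exact Lip.id.min (Lip.const_sub _)

theorem continuous_tent (l : ℝ≥0∞) (b : Bool) : Continuous (tent l b) := by
  unfold tent
  split_ifs
  · exact continuous_id
  · exact continuous_id.min (ENNReal.continuous_sub_left ENNReal.ofReal_ne_top)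

theorem tent_pos {l t : ℝ≥0∞} (h0 : 0 < t) (h1 : t < l) : 0 < tent l true t := by
  unfold tent
  split_ifs with h
  · exact h0
  · refine lt_min h0 (tsub_pos_of_lt ?_)
    rwa [tentLen, if_pos rfl, ENNReal.ofReal_toReal h]

/-- The symmetric tent determines a coordinate up to the reflection t ↦ l - t; the tent supported on
two thirds of the edge, with its peak at l / 3, breaks this symmetry. -/
theorem tent_injective {l s t : ℝ≥0∞} (hs : 0 < s) (hs' : s < l) (ht : 0 < t) (ht' : t < l)
    (h : ∀ b, tent l b s = tent l b t) : s = t := by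
  by_cases hl : l = ⊤
  · subst hl
    simpa [tent_top] using h true
  wlog hst : s < t generalizing s t
  · by_contra hne
    exact hne (this ht ht' hs hs' (fun b => (h b).symm)
      (lt_of_le_of_ne (not_lt.1 hst) (Ne.symm hne))).symm
  exfalso
  obtain ⟨l, rfl⟩ : ∃ r : ℝ, l = ENNReal.ofReal r := ⟨_, (ENNReal.ofReal_toReal hl).symm⟩
  obtain ⟨a, rfl⟩ : ∃ r : ℝ, s = ENNReal.ofReal r :=
    ⟨_, (ENNReal.ofReal_toReal (ne_top_of_lt hs')).symm⟩
  obtain ⟨b, rfl⟩ : ∃ r : ℝ, t = ENNReal.ofReal r :=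
    ⟨_, (ENNReal.ofReal_toReal (ne_top_of_lt ht')).symm⟩
  rw [ENNReal.ofReal_pos] at hs ht
  rw [ENNReal.ofReal_lt_ofReal_iff_of_nonneg hs.le] at hs' hst
  rw [ENNReal.ofReal_lt_ofReal_iff_of_nonneg ht.le] at ht'
  have h1 := h true
  have h2 := h false
  simp only [tent_ofReal _ (hs.le.trans hs'.le) hs.le, tent_ofReal _ (hs.le.trans hs'.le) ht.le,
    tentLen, if_true, Bool.false_eq_true, if_false] at h1 h2
  rw [ENNReal.ofReal_eq_ofReal_iff (le_min hs.le (by linarith)) (le_min ht.le (by linarith))] at h1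
  have h3 : b = l - a := by
    rcases min_cases a (l - a) with ⟨h3, h4⟩ | ⟨h3, h4⟩ <;>
      rcases min_cases b (l - b) with ⟨h5, h6⟩ | ⟨h5, h6⟩ <;> linarith
  subst h3
  have h4 : 0 < min a (2 / 3 * l - a) := lt_min hs (by linarith)
  have h5 := ENNReal.ofReal_pos.2 h4
  rw [h2, ENNReal.ofReal_pos] at h5
  rw [ENNReal.ofReal_eq_ofReal_iff h4.le h5.le] at h2
  rcases min_cases a (2 / 3 * l - a) with ⟨h6, h7⟩ | ⟨h6, h7⟩ <;>
    rcases min_cases (l - a) (2 / 3 * l - (l - a)) with ⟨h8, h9⟩ | ⟨h8, h9⟩ <;> linarith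

/-- A tent function on the edge `e`, extended by `0`. -/
noncomputable def tentOn (G : TropModel V E) (e : E) (b : Bool) : G.Curve → ℝ≥0∞ :=
  G.bump e (tent (G.len e) b) (tent_zero _ b) (tent_len b)

theorem tentOn_pt {e : E} {b : Bool} {t : ℝ≥0∞} (ht : t ≤ G.len e) :
    G.tentOn e b (G.pt e t) = tent (G.len e) b t := bump_pt ht

theorem tentOn_pt_of_ne {e e' : E} {b : Bool} (he : e' ≠ e) {t : ℝ≥0∞} (ht : t ≤ G.len e') :
    G.tentOn e b (G.pt e' t) = 0 := bump_pt_of_ne he ht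

theorem tentOn_vertex {e : E} {b : Bool} {v : V} (h : G.len e = ⊤ → G.tgt e ≠ v) :
    G.tentOn e b (G.vertex v) = 0 := bump_vertex h

/-- Finitely many functions that separate points: the height, and two functions for every edge. -/
noncomputable def sep (G : TropModel V E) : Option (E × Bool) → G.Curve → ℝ≥0∞
  | none => G.height
  | some (e, b) => G.tentOn e b

theorem edgeLip_sep : ∀ i, G.EdgeLip (G.sep i)
  | none => G.edgeLip_height
  | some (e, b) => (edgeLip_bump (lip_tent _ b) : G.EdgeLip (G.tentOn e b))

theorem continuous_sep : ∀ i, Continuous (G.sep i)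
  | none => G.continuous_height
  | some (e, b) => (continuous_bump (continuous_tent _ b) : Continuous (G.tentOn e b))

theorem vertex_or_inner (x : G.Curve) :
    (∃ v, x = G.vertex v) ∨ ∃ e t, 0 < t ∧ t < G.len e ∧ x = G.pt e t := by
  rcases vertex_or_pt x with h | ⟨e, t, ht, rfl⟩
  · exact Or.inl h
  rcases eq_or_lt_of_le ht with rfl | h1
  · exact Or.inl ⟨_, pt_len e⟩
  rcases eq_or_lt_of_le (zero_le : 0 ≤ t) with rfl | h0
  · exact Or.inl ⟨_, pt_zero e⟩
  exact Or.inr ⟨e, t, h0, h1, rfl⟩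

/-- Vertices differ in height. A full tent is positive inside its own edge and vanishes at finite
vertices and on the other edges; at the point at infinity of an infinite edge it takes the value ∞,
which differs from all inner coordinates. -/
theorem exists_sep_ne {x y : G.Curve} (h : x ≠ y) : ∃ i, G.sep i x ≠ G.sep i y := by
  have aux : ∀ v e t, 0 < t → t < G.len e →
      G.sep (some (e, true)) (G.vertex v) ≠ G.sep (some (e, true)) (G.pt e t) := by
    intro v e t h0 h1
    show G.tentOn e true _ ≠ G.tentOn e true _
    rw [tentOn_pt h1.le]
    by_cases he : G.len e = ⊤ ∧ G.tgt e = v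
    · rw [← he.2, ← pt_len, tentOn_pt le_rfl, he.1, tent_top, tent_top]
      exact (he.1 ▸ h1).ne'
    · rw [tentOn_vertex fun h2 h3 => he ⟨h2, h3⟩]
      exact (tent_pos h0 h1).ne
  rcases vertex_or_inner x with ⟨v, rfl⟩ | ⟨e, t, h0, h1, rfl⟩ <;>
    rcases vertex_or_inner y with ⟨w, rfl⟩ | ⟨e', t', h0', h1', rfl⟩
  · exact ⟨none, fun h2 => h (congrArg _ (G.height_vertex_injective h2))⟩
  · exact ⟨_, aux v e' t' h0' h1'⟩
  · exact ⟨_, (aux w e t h0 h1).symm⟩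
  · by_cases he : e' = e
    · subst he
      by_contra hc
      push Not at hc
      refine h (congrArg _ (tent_injective h0 h1 h0' h1' fun b => ?_))
      have h2 : G.tentOn e' b _ = G.tentOn e' b _ := hc (some (e', b))
      rwa [tentOn_pt h1.le, tentOn_pt h1'.le] at h2
    · refine ⟨some (e, true), ?_⟩
      show G.tentOn e true _ ≠ G.tentOn e true _
      rw [tentOn_pt h1.le, tentOn_pt_of_ne he h1'.le]
      exact (tent_pos h0 h1).ne'

instance (G : TropModel V E) : T2Space G.Curve :=
  T2Space.of_injective_continuous (f := fun x i => G.sep i x)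
    (fun x y h => by_contra fun hne => by
      obtain ⟨i, hi⟩ := exists_sep_ne hne
      exact hi (congrFun h i))
    (continuous_pi continuous_sep)

/-- Near each y in A, one of the finitely many functions `sep` stays away from its value at x, which
bounds the distance from below by the Lipschitz property. Compactness of A makes the bound uniform.
-/
theorem setDist_pos {A : Set G.Curve} (hA : IsClosed A) {x : G.Curve} (hx : x ∉ A) :
    0 < G.setDist A x := by
  obtain ⟨c, hc, h⟩ : ∃ c : ℝ≥0∞, 0 < c ∧ ∀ y ∈ A, c ≤ G.dist y x := by
    refine hA.isCompact.induction_on (p := fun S => ∃ c : ℝ≥0∞, 0 < c ∧ ∀ y ∈ S, c ≤ G.dist y x)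
      ⟨1, one_pos, by simp⟩ ?_ ?_ ?_
    · rintro S T hST ⟨c, hc, h⟩
      exact ⟨c, hc, fun y hy => h y (hST hy)⟩
    · rintro S T ⟨c, hc, h⟩ ⟨c', hc', h'⟩
      refine ⟨min c c', lt_min hc hc', ?_⟩
      rintro y (hy | hy)
      · exact (min_le_left _ _).trans (h y hy)
      · exact (min_le_right _ _).trans (h' y hy)
    · intro y hy
      obtain ⟨i, hi⟩ := exists_sep_ne (ne_of_mem_of_not_mem hy hx)
      rcases lt_or_gt_of_ne hi with hlt | hlt
      · obtain ⟨m, h1, h2⟩ := exists_between hlt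
        refine ⟨_, mem_nhdsWithin_of_mem_nhds (((continuous_sep i).tendsto y).eventually
          (gt_mem_nhds h1)), G.sep i x - m, tsub_pos_of_lt h2, fun z hz => ?_⟩
        have hz' : G.sep i z < m := hz
        refine tsub_le_iff_left.2 (((edgeLip_sep i).le_add_dist z x).trans ?_)
        exact add_le_add hz'.le le_rfl
      · obtain ⟨m, h1, h2⟩ := exists_between hlt
        refine ⟨_, mem_nhdsWithin_of_mem_nhds (((continuous_sep i).tendsto y).eventually
          (lt_mem_nhds h2)), m - G.sep i x, tsub_pos_of_lt h1, fun z hz => ?_⟩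
        have hz' : m < G.sep i z := hz
        exact tsub_le_iff_left.2 (hz'.le.trans ((edgeLip_sep i).le_add_dist' z x))
  exact lt_of_lt_of_le hc (le_iInf₂ h)

/-! ### Values of rational functions -/

theorem exists_notMem_infPts (G : TropModel V E) : ∃ x : G.Curve, x ∉ G.infPts := by
  obtain ⟨x, hx⟩ := G.whole.nonempty
  by_contra hc
  push Not at hc
  have h := G.whole.mem_closure x hx
  have h2 : G.whole.carrier ∩ G.infPtsᶜ = ∅ := eq_empty_of_forall_notMem fun y hy => hy.2 (hc y)
  rw [h2, closure_empty] at h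
  exact h

namespace Rat

/-- The value of a rational function at a point. -/
def val (f : G.Rat G.whole) (x : G.Curve) : EReal := f ⟨x, mem_univ x⟩

theorem continuous_val (f : G.Rat G.whole) : Continuous f.val :=
  f.2.1.comp (Continuous.subtype_mk continuous_id _)

theorem ext_val {f g : G.Rat G.whole} (h : ∀ x, x ∉ G.infPts → f.val x = g.val x) : f = g :=
  ext_fin fun x hx => h x.1 hx

@[simp] theorem val_zero (x : G.Curve) : (0 : G.Rat G.whole).val x = ⊥ := rfl

@[simp] theorem val_add (f g : G.Rat G.whole) (x : G.Curve) :
    (f + g).val x = max (f.val x) (g.val x) := rfl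

@[simp] theorem val_algebraMap (a : TropR) (x : G.Curve) :
    (algebraMap TropR (G.Rat G.whole) a).val x = a.toEReal := rfl

theorem val_mul (f g : G.Rat G.whole) {x : G.Curve} (hx : x ∉ G.infPts) :
    (f * g).val x = f.val x + g.val x := mul_apply f g hx

theorem val_inv {f : G.Rat G.whole} (hf : f ≠ 0) (x : G.Curve) : (f⁻¹).val x = -f.val x :=
  inv_apply f hf _

theorem val_ne {f : G.Rat G.whole} (hf : f ≠ 0) {x : G.Curve} (hx : x ∉ G.infPts) :
    f.val x ≠ ⊥ ∧ f.val x ≠ ⊤ :=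
  (f.2.2.resolve_left fun h => hf (ext' (funext h))).1 ⟨x, mem_univ x⟩ hx

theorem ne_zero_of_val_ne {f : G.Rat G.whole} {x : G.Curve} (h : f.val x ≠ ⊥) : f ≠ 0 := by
  rintro rfl
  exact h rfl

end Rat

/-! ### Slopes -/

/-- The function `f` is affine with slope `m` and initial value `a` in the direction `d`. -/
def HasSlope (f : G.Curve → EReal) (d : G.Dir) (a : ℝ) (m : ℤ) : Prop :=
  ∀ᶠ s in 𝓝[>] (0 : ℝ), f (d.path s) = ((a + m * s : ℝ) : EReal)

/-- The function `f` is given by `t ↦ a + m * t` for large coordinates `t` on the edge `e`. -/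
def HasEndSlope (f : G.Curve → EReal) (e : E) (a : ℝ) (m : ℤ) : Prop :=
  ∀ᶠ t : ℝ in atTop, f (G.pt e (ENNReal.ofReal t)) = ((a + m * t : ℝ) : EReal)

/-- The sign of a direction, as an integer. -/
def Dir.isgn (d : G.Dir) : ℤ := if d.up then 1 else -1

theorem Dir.coe_isgn (d : G.Dir) : (d.isgn : ℝ) = d.sgn := by
  unfold isgn sgn
  split_ifs <;> simp

/-- One of the finitely many intervals contains points arbitrarily close to the start, hence an
initial segment of the direction. The condition is imposed only at points of C, so that the result
also applies to functions on a core. -/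
theorem PiecewiseAffine.exists_slope {C : Set G.Curve} {f : C → EReal} (hf : G.PiecewiseAffine C f)
    (d : G.Dir) : ∃ (a : ℝ) (m : ℤ), ∀ᶠ s in 𝓝[>] (0 : ℝ), ∀ h : d.path s ∈ C,
      f ⟨d.path s, h⟩ = ((a + m * s : ℝ) : EReal) := by
  obtain ⟨P, hP, hU, hI⟩ := hf d.edge
  have h1 : ∃ I ∈ P, ∀ᶠ s in 𝓝[>] (0 : ℝ), (d.coord s).toNNReal ∈ I := by
    by_contra hc
    push Not at hc
    have h2 : ∀ I ∈ P, ∀ᶠ s in 𝓝[>] (0 : ℝ), (d.coord s).toNNReal ∉ I := by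
      intro I hIP
      by_contra hcon
      have hfreq : ∀ δ > 0, ∃ s, 0 < s ∧ s < δ ∧ (d.coord s).toNNReal ∈ I := by
        intro δ hδ
        by_contra h3
        push Not at h3
        exact hcon (eventually_of_pos hδ h3)
      obtain ⟨s₁, h3, -, h4⟩ := hfreq 1 one_pos
      refine hc I hIP (eventually_of_pos h3 fun s h5 h6 => ?_)
      obtain ⟨s₂, h7, h8, h9⟩ := hfreq s h5
      refine not_not.2 ((hI I hIP).1.uIcc_subset h9 h4 ?_)
      rcases d.sgn_cases with ⟨-, hs⟩ | ⟨-, hs⟩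
      · refine mem_uIcc_of_le ?_ ?_ <;> refine Real.toNNReal_le_toNNReal ?_ <;>
          simp only [Dir.coord, hs] <;> linarith
      · refine mem_uIcc_of_ge ?_ ?_ <;> refine Real.toNNReal_le_toNNReal ?_ <;>
          simp only [Dir.coord, hs] <;> linarith
    obtain ⟨s, hs⟩ := ((eventually_all_finite hP).2 h2).exists
    obtain ⟨I, hIP, hsI⟩ : (d.coord s).toNNReal ∈ ⋃₀ P := hU ▸ mem_univ _
    exact hs I hIP hsI
  obtain ⟨I, hIP, h1⟩ := h1
  obtain ⟨-, a, m, ham⟩ := hI I hIP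
  refine ⟨a + m * d.pos, m * d.isgn, ?_⟩
  filter_upwards [h1, d.eventually_inner] with s h2 h3 h4
  have h5 : d.path s = G.onEdge d.edge ⟨((d.coord s).toNNReal : ℝ≥0∞), h3.2.le⟩ := pt_of_le h3.2.le
  have h6 := ham _ h2 h3.2.le (h5 ▸ h4)
  have h7 : f ⟨d.path s, h4⟩ = f ⟨_, h5 ▸ h4⟩ := congrArg f (Subtype.ext h5)
  rw [h7, h6, Real.coe_toNNReal _ h3.1.le]
  congr 1
  push_cast
  rw [d.coe_isgn, Dir.coord]
  ring

theorem PiecewiseAffine.exists_endSlope {C : Set G.Curve} {f : C → EReal}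
    (hf : G.PiecewiseAffine C f) {e : E} (he : G.len e = ⊤) : ∃ (a : ℝ) (m : ℤ),
      ∀ᶠ t : ℝ in atTop, ∀ h : G.pt e (ENNReal.ofReal t) ∈ C,
        f ⟨G.pt e (ENNReal.ofReal t), h⟩ = ((a + m * t : ℝ) : EReal) := by
  obtain ⟨P, hP, hU, hI⟩ := hf e
  obtain ⟨I, hIP, T, hT⟩ := exists_tail_subset hP hU fun I hI' => (hI I hI').1
  obtain ⟨-, a, m, ham⟩ := hI I hIP
  refine ⟨a, m, ?_⟩
  filter_upwards [eventually_gt_atTop (T : ℝ)] with t h1 h2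
  have h0 : 0 ≤ t := T.2.trans h1.le
  have hle : ((t.toNNReal : ℝ≥0) : ℝ≥0∞) ≤ G.len e := he ▸ le_top
  have h5 : G.pt e (ENNReal.ofReal t) = G.onEdge e ⟨(t.toNNReal : ℝ≥0∞), hle⟩ := pt_of_le hle
  have h6 := ham _ (hT _ (Real.lt_toNNReal_iff_coe_lt.2 h1)) hle (h5 ▸ h2)
  have h7 : f ⟨_, h2⟩ = f ⟨_, h5 ▸ h2⟩ := congrArg f (Subtype.ext h5)
  rw [h7, h6, Real.coe_toNNReal _ h0]

/-- A function that has slopes in all directions is piecewise affine, by compactness. -/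
theorem piecewiseAffine_of_slopes {F : G.Curve → EReal}
    (hfin : ∀ x, x ∉ G.infPts → F x ≠ ⊥ ∧ F x ≠ ⊤)
    (hdir : ∀ d : G.Dir, ∃ a m, HasSlope F d a m)
    (hend : ∀ e, G.len e = ⊤ → ∃ a m, HasEndSlope F e a m) :
    G.PiecewiseAffine G.whole.carrier fun x => F x.1 := by
  intro e
  let Aff : Set ℝ≥0 → Prop := fun I => I.OrdConnected ∧ ∃ (a : ℝ) (m : ℤ), ∀ t ∈ I,
    (t : ℝ≥0∞) ≤ G.len e → F (G.pt e t) = ((a + m * t : ℝ) : EReal)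
  have key : ∃ P : Set (Set ℝ≥0), P.Finite ∧ (∀ t : ℝ≥0, (t : ℝ≥0∞) ∈ Iic (G.len e) → t ∈ ⋃₀ P) ∧
      ∀ I ∈ P, Aff I := by
    refine (isClosed_Iic (a := G.len e)).isCompact.induction_on (p := fun S =>
      ∃ P : Set (Set ℝ≥0), P.Finite ∧ (∀ t : ℝ≥0, (t : ℝ≥0∞) ∈ S → t ∈ ⋃₀ P) ∧ ∀ I ∈ P, Aff I)
      ⟨∅, finite_empty, by simp⟩ ?_ ?_ ?_
    · rintro S T hST ⟨P, h1, h2, h3⟩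
      exact ⟨P, h1, fun t ht => h2 t (hST ht), h3⟩
    · rintro S T ⟨P, h1, h2, h3⟩ ⟨P', h1', h2', h3'⟩
      refine ⟨P ∪ P', h1.union h1', ?_, fun I hI => hI.elim (h3 I) (h3' I)⟩
      rintro t (ht | ht)
      · exact sUnion_subset_sUnion subset_union_left (h2 t ht)
      · exact sUnion_subset_sUnion subset_union_right (h2' t ht)
    · intro t₀ ht₀
      by_cases htop : t₀ = ⊤
      · subst htop
        have he : G.len e = ⊤ := top_le_iff.1 ht₀
        obtain ⟨a, m, ham⟩ := hend e he
        obtain ⟨T, hT⟩ := eventually_atTop.1 ham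
        refine ⟨Ioi (T.toNNReal : ℝ≥0∞), mem_nhdsWithin_of_mem_nhds (Ioi_mem_nhds ENNReal.coe_lt_top),
          {Ioi T.toNNReal}, finite_singleton _, ?_, ?_⟩
        · intro t ht
          rw [sUnion_singleton]
          exact ENNReal.coe_lt_coe.1 ht
        · rintro _ rfl
          refine ⟨ordConnected_Ioi, a, m, fun t ht _ => ?_⟩
          have := hT t (Real.toNNReal_le_iff_le_coe.1 (le_of_lt ht))
          rwa [ENNReal.ofReal_coe_nnreal] at this
      lift t₀ to ℝ≥0 using htop
      have hbase : ENNReal.ofReal (t₀ : ℝ) ≤ G.len e := by rwa [ENNReal.ofReal_coe_nnreal]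
      obtain ⟨δ, hδ, hup⟩ : ∃ δ : ℝ≥0, 0 < δ ∧ Aff (Ioo t₀ (t₀ + δ)) := by
        by_cases hlt : (t₀ : ℝ≥0∞) < G.len e
        · let d : G.Dir := ⟨e, t₀, true, t₀.2, hbase, fun _ => by rwa [ENNReal.ofReal_coe_nnreal],
            fun h => by simp at h⟩
          obtain ⟨a, m, ham⟩ := hdir d
          obtain ⟨δ, hδ, h⟩ := exists_pos_of_eventually ham
          refine ⟨δ.toNNReal, Real.toNNReal_pos.2 hδ, ordConnected_Ioo, a - m * t₀, m, ?_⟩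
          rintro t ⟨h1, h2⟩ -
          have h1 : (t₀ : ℝ) < t := h1
          have h2 : (t : ℝ) < t₀ + δ := by
            have : (t : ℝ) < t₀ + δ.toNNReal := h2
            rwa [Real.coe_toNNReal _ hδ.le] at this
          have h3 := h (t - t₀) (by linarith) (by linarith)
          have h4 : d.path (t - t₀) = G.pt e t := by
            show G.pt e (ENNReal.ofReal _) = _
            rw [show d.coord (t - t₀) = t by simp [Dir.coord, Dir.sgn, d], ENNReal.ofReal_coe_nnreal]
          rw [← h4, h3]
          congr 1
          ring
        · refine ⟨1, one_pos, ordConnected_Ioo, 0, 0, fun t ht h => absurd h (not_le.2 ?_)⟩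
          exact lt_of_le_of_lt (not_lt.1 hlt) (ENNReal.coe_lt_coe.2 ht.1)
      obtain ⟨δ', hδ', hdown⟩ : ∃ δ : ℝ≥0, 0 < δ ∧ Aff {t | t < t₀ ∧ t₀ < t + δ} := by
        have hord : ∀ δ : ℝ≥0, OrdConnected {t | t < t₀ ∧ t₀ < t + δ} := by
          refine fun δ => ⟨fun s hs t ht u hu => ⟨hu.2.trans_lt ht.1, hs.2.trans_le ?_⟩⟩
          exact add_le_add hu.1 le_rfl
        rcases eq_or_lt_of_le (zero_le : 0 ≤ t₀) with h0 | hlt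
        · refine ⟨1, one_pos, hord 1, 0, 0, fun t ht h => ?_⟩
          exact absurd ht.1 (by rw [← h0]; exact not_lt_bot)
        · let d : G.Dir := ⟨e, t₀, false, t₀.2, hbase, fun h => by simp at h, fun _ => hlt⟩
          obtain ⟨a, m, ham⟩ := hdir d
          obtain ⟨δ, hδ, h⟩ := exists_pos_of_eventually ham
          refine ⟨δ.toNNReal, Real.toNNReal_pos.2 hδ, hord _, a + m * t₀, -m, ?_⟩
          rintro t ⟨h1, h2⟩ -
          have h1 : (t : ℝ) < t₀ := h1
          have h2 : (t₀ : ℝ) < t + δ := by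
            have : (t₀ : ℝ) < t + δ.toNNReal := h2
            rwa [Real.coe_toNNReal _ hδ.le] at this
          have h3 := h (t₀ - t) (by linarith) (by linarith)
          have h4 : d.path (t₀ - t) = G.pt e t := by
            show G.pt e (ENNReal.ofReal _) = _
            rw [show d.coord (t₀ - t) = t by simp [Dir.coord, Dir.sgn, d], ENNReal.ofReal_coe_nnreal]
          rw [← h4, h3]
          congr 1
          push_cast
          ring
      have hS : {w : ℝ≥0∞ | w < t₀ + δ ∧ (t₀ : ℝ≥0∞) < w + δ'} ∈ 𝓝 (t₀ : ℝ≥0∞) := by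
        refine inter_mem (gt_mem_nhds ?_) ?_
        · exact_mod_cast lt_add_of_pos_right t₀ hδ
        · have hc : Continuous fun w : ℝ≥0∞ => w + δ' := continuous_id.add continuous_const
          refine (hc.tendsto _).eventually (lt_mem_nhds ?_)
          exact_mod_cast lt_add_of_pos_right t₀ hδ'
      -- The coordinate itself is a piece of its own, which is why continuity of F plays no role
      -- here.
      refine ⟨_, mem_nhdsWithin_of_mem_nhds hS,
        {Ioo t₀ (t₀ + δ), {t | t < t₀ ∧ t₀ < t + δ'}, {t₀}}, by simp, ?_, ?_⟩
      · rintro t ⟨h1, h2⟩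
        have h1 : t < t₀ + δ := by exact_mod_cast h1
        have h2 : t₀ < t + δ' := by exact_mod_cast h2
        rcases lt_trichotomy t t₀ with h | rfl | h
        · exact ⟨_, Or.inr (Or.inl rfl), h, h2⟩
        · exact ⟨_, Or.inr (Or.inr rfl), rfl⟩
        · exact ⟨_, Or.inl rfl, h, h1⟩
      · rintro _ (rfl | rfl | rfl)
        · exact hup
        · exact hdown
        · have h := hfin (G.pt e t₀) (pt_notMem_infPts ENNReal.coe_ne_top)
          refine ⟨ordConnected_singleton, (F (G.pt e t₀)).toReal, 0, ?_⟩
          rintro _ rfl -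
          rw [Int.cast_zero, zero_mul, add_zero, EReal.coe_toReal h.2 h.1]
  obtain ⟨P, h1, h2, h3⟩ := key
  -- The pieces must cover all of `ℝ≥0`; the coordinates beyond the end form one more piece, on
  -- which the condition is vacuous.
  refine ⟨insert {t : ℝ≥0 | G.len e < t} P, h1.insert _, eq_univ_of_forall fun t => ?_, ?_⟩
  · rcases le_or_gt (t : ℝ≥0∞) (G.len e) with h | h
    · exact sUnion_subset_sUnion (subset_insert _ _) (h2 t h)
    · exact ⟨_, Or.inl rfl, h⟩
  · rintro I (rfl | hI)
    · refine ⟨⟨fun s hs t _ u hu => ?_⟩, 0, 0, fun t ht h => absurd h (not_le.2 ht)⟩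
      exact lt_of_lt_of_le hs (ENNReal.coe_le_coe.2 hu.1)
    · obtain ⟨h4, a, m, ham⟩ := h3 I hI
      refine ⟨h4, a, m, fun t ht hle _ => ?_⟩
      rw [← ham t ht hle, pt_of_le hle]

namespace Rat

/-- The rational function with given values. -/
def ofSlopes (F : G.Curve → EReal) (hF : Continuous F)
    (hfin : ∀ x, x ∉ G.infPts → F x ≠ ⊥ ∧ F x ≠ ⊤) (hdir : ∀ d : G.Dir, ∃ a m, HasSlope F d a m)
    (hend : ∀ e, G.len e = ⊤ → ∃ a m, HasEndSlope F e a m) : G.Rat G.whole :=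
  ⟨fun x => F x.1, hF.comp continuous_subtype_val,
    Or.inr ⟨fun x hx => hfin x.1 hx, piecewiseAffine_of_slopes hfin hdir hend⟩⟩

theorem exists_slope {f : G.Rat G.whole} (hf : f ≠ 0) (d : G.Dir) : ∃ a m, HasSlope f.val d a m := by
  obtain ⟨a, m, h⟩ := (f.2.2.resolve_left fun h => hf (ext' (funext h))).2.exists_slope d
  exact ⟨a, m, h.mono fun s hs => hs (mem_univ _)⟩

theorem exists_endSlope {f : G.Rat G.whole} (hf : f ≠ 0) {e : E} (he : G.len e = ⊤) :
    ∃ a m, HasEndSlope f.val e a m := by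
  obtain ⟨a, m, h⟩ := (f.2.2.resolve_left fun h => hf (ext' (funext h))).2.exists_endSlope he
  exact ⟨a, m, h.mono fun s hs => hs (mem_univ _)⟩

end Rat

theorem HasSlope.eq_base {f : G.Curve → EReal} (hf : Continuous f) {d : G.Dir} {a : ℝ} {m : ℤ}
    (h : HasSlope f d a m) : f d.base = a := by
  have h1 : Tendsto (fun s => f (d.path s)) (𝓝[>] 0) (𝓝 (f d.base)) :=
    (hf.tendsto _).comp d.tendsto_path
  have h2 : Tendsto (fun s : ℝ => ((a + m * s : ℝ) : EReal)) (𝓝[>] 0) (𝓝 (a : EReal)) := by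
    have h3 : Continuous fun s : ℝ => ((a + m * s : ℝ) : EReal) :=
      continuous_coe_real_ereal.comp (by fun_prop)
    have h4 := (h3.tendsto 0).mono_left (nhdsWithin_le_nhds (s := Ioi 0))
    simpa using h4
  exact tendsto_nhds_unique h1 (h2.congr' (h.mono fun _ hs => hs.symm))

theorem HasEndSlope.unique {f : G.Curve → EReal} {e : E} {a b : ℝ} {m n : ℤ}
    (h : HasEndSlope f e a m) (h' : HasEndSlope f e b n) : a = b ∧ m = n := by
  obtain ⟨T, hT⟩ := eventually_atTop.1 (h.and h')
  have h2 : ∀ t, T ≤ t → a + m * t = b + n * t := fun t ht => by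
    obtain ⟨h3, h4⟩ := hT t ht
    exact_mod_cast h3.symm.trans h4
  have h3 := h2 T le_rfl
  have h4 := h2 (T + 1) (by linarith)
  have h5 : (m : ℝ) = n := by linarith
  have h6 : m = n := by exact_mod_cast h5
  subst h6
  exact ⟨by linarith, rfl⟩

/-- The difference of the values at t + 1 and t is the slope m, and it tends to 0 because the values
converge to a real number. -/
theorem HasEndSlope.eq_zero {f : G.Curve → EReal} (hf : Continuous f) {e : E} {a : ℝ} {m : ℤ}
    (h : HasEndSlope f e a m) (hreal : f (G.pt e ⊤) ≠ ⊥ ∧ f (G.pt e ⊤) ≠ ⊤) :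
    m = 0 ∧ f (G.pt e ⊤) = a := by
  have h1 : Tendsto (fun t : ℝ => f (G.pt e (ENNReal.ofReal t))) atTop (𝓝 (f (G.pt e ⊤))) :=
    (hf.tendsto _).comp tendsto_pt_top
  lift f (G.pt e ⊤) to ℝ using ⟨hreal.2, hreal.1⟩ with r
  have h2 : Tendsto (fun t : ℝ => a + m * t) atTop (𝓝 r) :=
    EReal.tendsto_coe.1 (h1.congr' h)
  have h3 : Tendsto (fun t : ℝ => a + m * (t + 1)) atTop (𝓝 r) :=
    h2.comp (tendsto_atTop_add_const_right _ _ tendsto_id)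
  have h4 : Tendsto (fun _ : ℝ => (m : ℝ)) atTop (𝓝 (r - r)) :=
    (h3.sub h2).congr fun t => by ring
  rw [sub_self] at h4
  have h5 : (m : ℝ) = 0 := tendsto_nhds_unique tendsto_const_nhds h4
  refine ⟨by exact_mod_cast h5, ?_⟩
  simp only [h5, zero_mul, add_zero] at h2
  rw [tendsto_nhds_unique h2 tendsto_const_nhds]

/-! ### Slopes under the semifield operations -/

section algebra

variable {f g : G.Rat G.whole} {d : G.Dir} {e : E} {a b : ℝ} {m n : ℤ}

theorem HasSlope.ne_zero (h : HasSlope f.val d a m) : f ≠ 0 := by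
  obtain ⟨s, hs⟩ := h.exists
  exact Rat.ne_zero_of_val_ne (x := d.path s) (by rw [hs]; exact EReal.coe_ne_bot _)

theorem HasSlope.mul (hf : HasSlope f.val d a m) (hg : HasSlope g.val d b n) :
    HasSlope (f * g).val d (a + b) (m + n) := by
  filter_upwards [hf, hg] with s h1 h2
  rw [Rat.val_mul f g (d.path_notMem_infPts s), h1, h2, ← EReal.coe_add]
  congr 1
  push_cast
  ring

theorem HasSlope.inv (hf : HasSlope f.val d a m) : HasSlope (f⁻¹).val d (-a) (-m) := by
  filter_upwards [hf] with s h1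
  rw [Rat.val_inv hf.ne_zero, h1, ← EReal.coe_neg]
  congr 1
  push_cast
  ring

theorem HasSlope.add (hf : HasSlope f.val d a m) (hg : HasSlope g.val d a n) :
    HasSlope (f + g).val d a (max m n) := by
  filter_upwards [hf, hg, self_mem_nhdsWithin] with s h1 h2 h3
  have h3 : 0 < s := h3
  rw [Rat.val_add, h1, h2]
  rcases le_total m n with h | h
  · rw [max_eq_right h]
    refine max_eq_right (EReal.coe_le_coe_iff.2 ?_)
    have : (m : ℝ) ≤ n := by exact_mod_cast h
    nlinarith
  · rw [max_eq_left h]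
    refine max_eq_left (EReal.coe_le_coe_iff.2 ?_)
    have : (n : ℝ) ≤ m := by exact_mod_cast h
    nlinarith

theorem hasSlope_algebraMap (d : G.Dir) (a : ℝ) :
    HasSlope (algebraMap TropR (G.Rat G.whole) (TropR.ofReal a)).val d a 0 :=
  Eventually.of_forall fun s => by simp

theorem HasEndSlope.ne_zero (h : HasEndSlope f.val e a m) : f ≠ 0 := by
  obtain ⟨s, hs⟩ := h.exists
  exact Rat.ne_zero_of_val_ne (x := G.pt e (ENNReal.ofReal s)) (by rw [hs]; exact EReal.coe_ne_bot _)

theorem HasEndSlope.mul (hf : HasEndSlope f.val e a m) (hg : HasEndSlope g.val e b n) :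
    HasEndSlope (f * g).val e (a + b) (m + n) := by
  filter_upwards [hf, hg] with s h1 h2
  rw [Rat.val_mul f g pt_ofReal_notMem_infPts, h1, h2, ← EReal.coe_add]
  congr 1
  push_cast
  ring

theorem HasEndSlope.inv (hf : HasEndSlope f.val e a m) : HasEndSlope (f⁻¹).val e (-a) (-m) := by
  filter_upwards [hf] with s h1
  rw [Rat.val_inv hf.ne_zero, h1, ← EReal.coe_neg]
  congr 1
  push_cast
  ring

theorem HasEndSlope.add_of_lt (hf : HasEndSlope f.val e a m) (hg : HasEndSlope g.val e b n)
    (h : m < n) : HasEndSlope (f + g).val e b n := by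
  filter_upwards [hf, hg, eventually_ge_atTop (max 0 (a - b))] with s h1 h2 h3
  rw [Rat.val_add, h1, h2]
  refine max_eq_right (EReal.coe_le_coe_iff.2 ?_)
  have h4 : (m : ℝ) + 1 ≤ n := by exact_mod_cast h
  have h5 := (le_max_left _ _).trans h3
  have h6 := (le_max_right _ _).trans h3
  nlinarith

theorem HasEndSlope.exists_add (hf : HasEndSlope f.val e a m) (hg : HasEndSlope g.val e b n) :
    ∃ c, HasEndSlope (f + g).val e c (max m n) := by
  rcases lt_trichotomy m n with h | rfl | h
  · rw [max_eq_right h.le]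
    exact ⟨b, hf.add_of_lt hg h⟩
  · rw [max_self]
    refine ⟨max a b, ?_⟩
    filter_upwards [hf, hg] with s h1 h2
    rw [Rat.val_add, h1, h2, max_add_add_right (a) b _ |>.symm]
    exact (EReal.coe_strictMono.monotone.map_max).symm
  · rw [max_eq_left h.le, add_comm]
    exact ⟨a, hg.add_of_lt hf h⟩

theorem hasEndSlope_algebraMap (e : E) (a : ℝ) :
    HasEndSlope (algebraMap TropR (G.Rat G.whole) (TropR.ofReal a)).val e a 0 :=
  Eventually.of_forall fun s => by simp

end algebra

end TropModel

/-- A lattice-ordered group of continuous functions on a compact space that contains the constants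
and separates points contains every function that it contains locally. -/
theorem mem_of_separates_of_locally_mem {X : Type*} [TopologicalSpace X] [CompactSpace X]
    {Λ : AddSubgroup (X → ℝ)} (hcont : ∀ φ ∈ Λ, Continuous φ)
    (hconst : ∀ c : ℝ, (fun _ => c) ∈ Λ) (hsup : ∀ φ ∈ Λ, ∀ ψ ∈ Λ, φ ⊔ ψ ∈ Λ)
    (hsep : ∀ x y, x ≠ y → ∃ φ ∈ Λ, φ x ≠ φ y) {f : X → ℝ} (hf : Continuous f)
    (hloc : ∀ x, ∃ φ ∈ Λ, ∀ᶠ y in 𝓝 x, φ y = f y) : f ∈ Λ := by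
  have hinf : ∀ φ ∈ Λ, ∀ ψ ∈ Λ, φ ⊓ ψ ∈ Λ := fun φ hφ ψ hψ => by
    have := Λ.neg_mem (hsup _ (Λ.neg_mem hφ) _ (Λ.neg_mem hψ))
    rwa [neg_sup, neg_neg, neg_neg] at this
  have hpair : ∀ x y, ∃ φ ∈ Λ, (∀ᶠ z in 𝓝 x, f z ≤ φ z) ∧ ∀ᶠ z in 𝓝 y, φ z ≤ f z := by
    intro x y
    -- For x = y no strict inequalities are available, and a function that agrees with f near x
    -- serves both purposes.
    rcases eq_or_ne x y with rfl | hxy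
    · obtain ⟨φ, hφ, h⟩ := hloc x
      exact ⟨φ, hφ, h.mono fun z hz => hz.ge, h.mono fun z hz => hz.le⟩
    obtain ⟨φ, hφ, hlt⟩ : ∃ φ ∈ Λ, φ y < φ x := by
      obtain ⟨φ, hφ, h⟩ := hsep x y hxy
      rcases lt_or_gt_of_ne h with h | h
      · exact ⟨-φ, Λ.neg_mem hφ, neg_lt_neg h⟩
      · exact ⟨φ, hφ, h⟩
    -- Λ is only a group, so the separating function is stretched by an integer, chosen such that
    -- the value drops from f x + 1 at x to at most f y - 1 at y.
    obtain ⟨n, hn⟩ := Archimedean.arch (f x + 1 - f y + 1) (sub_pos.2 hlt)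
    let ψ : X → ℝ := n • φ + fun _ => f x + 1 - n • φ x
    have hψ : ψ ∈ Λ := Λ.add_mem (Λ.nsmul_mem hφ n) (hconst _)
    have h1 : f x < ψ x := by simp [ψ]
    have h2 : ψ y < f y := by
      simp only [ψ, Pi.add_apply, Pi.smul_apply]
      rw [nsmul_sub] at hn
      linarith
    exact ⟨ψ, hψ, (hf.continuousAt.eventually_lt (hcont ψ hψ).continuousAt h1).mono fun _ h => h.le,
      ((hcont ψ hψ).continuousAt.eventually_lt hf.continuousAt h2).mono fun _ h => h.le⟩
  -- For fixed x, the minimum over a finite cover by neighbourhoods of points y lies below f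
  -- everywhere and is still at least f near x.
  have hpoint : ∀ x, ∃ φ ∈ Λ, (∀ z ∈ univ, φ z ≤ f z) ∧ ∀ᶠ z in 𝓝 x, f z ≤ φ z := by
    intro x
    refine isCompact_univ.induction_on
      (p := fun S => ∃ φ ∈ Λ, (∀ z ∈ S, φ z ≤ f z) ∧ ∀ᶠ z in 𝓝 x, f z ≤ φ z) ?_ ?_ ?_ ?_
    · obtain ⟨φ, hφ, h⟩ := hloc x
      exact ⟨φ, hφ, by simp, h.mono fun z hz => hz.ge⟩
    · rintro S T hST ⟨φ, hφ, h1, h2⟩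
      exact ⟨φ, hφ, fun z hz => h1 z (hST hz), h2⟩
    · rintro S T ⟨φ, hφ, h1, h2⟩ ⟨ψ, hψ, h3, h4⟩
      refine ⟨φ ⊓ ψ, hinf φ hφ ψ hψ, ?_, ?_⟩
      · rintro z (hz | hz)
        · exact (min_le_left _ _).trans (h1 z hz)
        · exact (min_le_right _ _).trans (h3 z hz)
      · filter_upwards [h2, h4] with z h5 h6 using le_min h5 h6
    · intro y _
      obtain ⟨φ, hφ, h1, h2⟩ := hpair x y
      exact ⟨_, mem_nhdsWithin_of_mem_nhds h2, φ, hφ, fun z hz => hz, h1⟩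
  rcases isEmpty_or_nonempty X with hX | ⟨⟨x₀⟩⟩
  · have : f = 0 := funext fun x => hX.elim x
    rw [this]
    exact Λ.zero_mem
  -- The maximum over a finite cover by neighbourhoods of points x stays below f and reaches it
  -- everywhere.
  obtain ⟨φ, hφ, h1, h2⟩ : ∃ φ ∈ Λ, (∀ z, φ z ≤ f z) ∧ ∀ z ∈ univ, f z ≤ φ z := by
    refine isCompact_univ.induction_on
      (p := fun S => ∃ φ ∈ Λ, (∀ z, φ z ≤ f z) ∧ ∀ z ∈ S, f z ≤ φ z) ?_ ?_ ?_ ?_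
    · obtain ⟨φ, hφ, h, -⟩ := hpoint x₀
      exact ⟨φ, hφ, fun z => h z (mem_univ z), by simp⟩
    · rintro S T hST ⟨φ, hφ, h1, h2⟩
      exact ⟨φ, hφ, h1, fun z hz => h2 z (hST hz)⟩
    · rintro S T ⟨φ, hφ, h1, h2⟩ ⟨ψ, hψ, h3, h4⟩
      refine ⟨φ ⊔ ψ, hsup φ hφ ψ hψ, fun z => max_le (h1 z) (h3 z), ?_⟩
      rintro z (hz | hz)
      · exact (h2 z hz).trans (le_max_left _ _)
      · exact (h4 z hz).trans (le_max_right _ _)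
    · intro y _
      obtain ⟨φ, hφ, h1, h2⟩ := hpoint y
      exact ⟨_, mem_nhdsWithin_of_mem_nhds h2, φ, hφ, fun z => h1 z (mem_univ z), fun z hz => hz⟩
  have : f = φ := funext fun z => le_antisymm (h2 z (mem_univ z)) (h1 z)
  rwa [this]

/-! ### The Stone-Weierstrass criterion for rational functions -/

namespace TropModel

variable {V E : Type*} {G : TropModel V E}

/-- The continuous real functions on `Γ` that are, at finite points, the values of an element of
`A`. -/
def realPart (A : Subalgebra TropR (G.Rat G.whole)) (hA : ∀ f ∈ A, f⁻¹ ∈ A) :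
    AddSubgroup (G.Curve → ℝ) where
  carrier := {φ | Continuous φ ∧ ∃ f ∈ A, ∀ x, x ∉ G.infPts → f.val x = φ x}
  zero_mem' := ⟨continuous_const, 1, A.one_mem, fun _ _ => rfl⟩
  add_mem' := by
    rintro φ ψ ⟨hφ, f, hf, h⟩ ⟨hψ, g, hg, h'⟩
    refine ⟨hφ.add hψ, f * g, A.mul_mem hf hg, fun x hx => ?_⟩
    rw [Rat.val_mul f g hx, h x hx, h' x hx]
    rfl
  neg_mem' := by
    rintro φ ⟨hφ, f, hf, h⟩
    refine ⟨hφ.neg, f⁻¹, hA f hf, fun x hx => ?_⟩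
    rw [Rat.val_inv (Rat.ne_zero_of_val_ne (x := x) (by rw [h x hx]; exact EReal.coe_ne_bot _)),
      h x hx]
    rfl

section realPart

variable {A : Subalgebra TropR (G.Rat G.whole)} {hA : ∀ f ∈ A, f⁻¹ ∈ A}

theorem const_mem_realPart (c : ℝ) : (fun _ => c) ∈ realPart A hA :=
  ⟨continuous_const, algebraMap _ _ (TropR.ofReal c), A.algebraMap_mem _, fun x _ => by simp⟩

theorem sup_mem_realPart {φ ψ : G.Curve → ℝ} (hφ : φ ∈ realPart A hA) (hψ : ψ ∈ realPart A hA) :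
    φ ⊔ ψ ∈ realPart A hA := by
  obtain ⟨hφ, f, hf, h⟩ := hφ
  obtain ⟨hψ, g, hg, h'⟩ := hψ
  refine ⟨hφ.sup hψ, f + g, A.add_mem hf hg, fun x hx => ?_⟩
  rw [Rat.val_add, h x hx, h' x hx]
  exact (EReal.coe_strictMono.monotone.map_max).symm

theorem inf_mem_realPart {φ ψ : G.Curve → ℝ} (hφ : φ ∈ realPart A hA) (hψ : ψ ∈ realPart A hA) :
    φ ⊓ ψ ∈ realPart A hA := by
  have := neg_mem (sup_mem_realPart (neg_mem hφ) (neg_mem hψ))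
  rwa [neg_sup, neg_neg, neg_neg] at this

/-- The values of an element of `A`, cut off at `N` and at `-N`. -/
theorem exists_clamp_mem_realPart {w : G.Rat G.whole} (hw : w ∈ A) (hw0 : w ≠ 0) (N : ℝ) :
    ∃ φ ∈ realPart A hA, ∀ x, ((φ x : ℝ) : EReal) = max (min (w.val x) N) (-N : ℝ) := by
  let c : G.Rat G.whole := algebraMap _ _ (TropR.ofReal (-N))
  have hc : c ∈ A := A.algebraMap_mem _
  -- Inverting a maximum of inverses gives the minimum of w and N; the outer summand is the maximum
  -- with -N.
  let g : G.Rat G.whole := (w⁻¹ + c)⁻¹ + c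
  have hg0 : w⁻¹ + c ≠ 0 := by
    obtain ⟨x, hx⟩ := G.exists_notMem_infPts
    refine Rat.ne_zero_of_val_ne (x := x) (ne_of_gt (lt_of_lt_of_le ?_ (le_max_right _ _)))
    exact EReal.bot_lt_coe (-N)
  have hval : ∀ x, g.val x = max (min (w.val x) N) (-N : ℝ) := by
    intro x
    have h1 : g.val x = max (-(max (-w.val x) ((-N : ℝ) : EReal))) ((-N : ℝ) : EReal) := by
      rw [Rat.val_add, Rat.val_inv hg0, Rat.val_add, Rat.val_inv hw0]
      simp [c]
    rw [h1, EReal.coe_neg]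
    congr 1
    rw [← EReal.neg_strictAnti.antitone.map_min, neg_neg]
  have hne : ∀ x, g.val x ≠ ⊤ ∧ g.val x ≠ ⊥ := by
    intro x
    rw [hval]
    constructor
    · refine ne_of_lt (max_lt (lt_of_le_of_lt (min_le_right _ _) (EReal.coe_lt_top _)) ?_)
      exact EReal.coe_lt_top _
    · exact ne_of_gt (lt_of_lt_of_le (EReal.bot_lt_coe _) (le_max_right _ _))
  have hcoe : ∀ x, (((g.val x).toReal : ℝ) : EReal) = g.val x := fun x =>
    EReal.coe_toReal (hne x).1 (hne x).2
  refine ⟨fun x => (g.val x).toReal, ⟨?_, g, ?_, fun x _ => (hcoe x).symm⟩, fun x => ?_⟩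
  · refine continuous_iff_continuousAt.2 fun x => ?_
    exact (EReal.tendsto_toReal (hne x).1 (hne x).2).comp (g.continuous_val.tendsto x)
  · exact A.add_mem (hA _ (A.add_mem (hA w hw) hc)) hc
  · rw [hcoe, hval]

/-- At a finite point the value r is real, and cutting off at |r| + 1 changes nothing nearby. Thus
slopes of elements of A become slopes of honest real functions. -/
theorem exists_eventually_eq {w : G.Rat G.whole} (hw : w ∈ A) (hw0 : w ≠ 0) {x : G.Curve}
    (hx : x ∉ G.infPts) : ∃ φ ∈ realPart A hA, ∀ᶠ y in 𝓝 x, w.val y = φ y := by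
  obtain ⟨h1, h2⟩ := Rat.val_ne hw0 hx
  obtain ⟨r, hr⟩ : ∃ r : ℝ, w.val x = r := ⟨_, (EReal.coe_toReal h2 h1).symm⟩
  obtain ⟨φ, hφ, h⟩ := exists_clamp_mem_realPart (hA := hA) hw hw0 (|r| + 1)
  refine ⟨φ, hφ, ?_⟩
  have h3 : w.val x < ((|r| + 1 : ℝ) : EReal) := by
    rw [hr, EReal.coe_lt_coe_iff]
    linarith [le_abs_self r]
  have h4 : ((-(|r| + 1) : ℝ) : EReal) < w.val x := by
    rw [hr, EReal.coe_lt_coe_iff]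
    linarith [neg_abs_le r]
  filter_upwards [(w.continuous_val.tendsto x).eventually (gt_mem_nhds h3),
    (w.continuous_val.tendsto x).eventually (lt_mem_nhds h4)] with y h5 h6
  rw [h, min_eq_left (le_of_lt h5), max_eq_left (le_of_lt h6)]

/-- A real number q strictly between the two values still separates them after cutting off at |q| +
1, even if one of the values is infinite. -/
theorem exists_ne_of_val_ne {w : G.Rat G.whole} (hw : w ∈ A) (hw0 : w ≠ 0) {x y : G.Curve}
    (hxy : w.val x ≠ w.val y) : ∃ φ ∈ realPart A hA, φ x ≠ φ y := by
  wlog hlt : w.val x < w.val y generalizing x y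
  · obtain ⟨φ, hφ, h⟩ := this hxy.symm (lt_of_le_of_ne (not_lt.1 hlt) hxy.symm)
    exact ⟨φ, hφ, h.symm⟩
  obtain ⟨q, h1, h2⟩ := EReal.lt_iff_exists_real_btwn.1 hlt
  obtain ⟨φ, hφ, h⟩ := exists_clamp_mem_realPart (hA := hA) hw hw0 (|q| + 1)
  refine ⟨φ, hφ, fun hc => ?_⟩
  have h3 : ((φ x : ℝ) : EReal) < q := by
    rw [h]
    refine max_lt (lt_of_le_of_lt (min_le_left _ _) h1) (EReal.coe_lt_coe_iff.2 ?_)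
    linarith [neg_abs_le q]
  have h4 : (q : EReal) < ((φ y : ℝ) : EReal) := by
    rw [h]
    refine lt_of_lt_of_le (lt_min h2 (EReal.coe_lt_coe_iff.2 ?_)) (le_max_left _ _)
    linarith [le_abs_self q]
  rw [hc] at h3
  exact lt_asymm h3 h4

/-- If `A` separates points and directions, then it contains all rational functions without infinite
values. -/
theorem mem_of_separates (hA : ∀ f ∈ A, f⁻¹ ∈ A)
    (hsep : ∀ x y, x ≠ y → ∃ w ∈ A, w ≠ 0 ∧ w.val x ≠ w.val y)
    (hdir : ∀ d d' : G.Dir, d.base = d'.base →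
      ∃ w ∈ A, (∃ a, HasSlope w.val d a 1) ∧ (d ≠ d' → ∃ b, HasSlope w.val d' b 0))
    {f : G.Rat G.whole} (hreal : ∀ x, f.val x ≠ ⊥ ∧ f.val x ≠ ⊤) : f ∈ A := by
  obtain ⟨x₀, hx₀⟩ := G.exists_notMem_infPts
  have hf0 : f ≠ 0 := Rat.ne_zero_of_val_ne (hreal x₀).1
  let F : G.Curve → ℝ := fun x => (f.val x).toReal
  have hF : ∀ x, f.val x = F x := fun x => (EReal.coe_toReal (hreal x).2 (hreal x).1).symm
  have hFc : Continuous F := continuous_iff_continuousAt.2 fun x =>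
    (EReal.tendsto_toReal (hreal x).2 (hreal x).1).comp (f.continuous_val.tendsto x)
  suffices h : F ∈ realPart A hA by
    obtain ⟨-, g, hg, h⟩ := h
    have : f = g := Rat.ext_val fun x hx => by rw [hF, h x hx]
    rwa [this]
  refine mem_of_separates_of_locally_mem (Λ := realPart A hA) (fun φ h => h.1) const_mem_realPart
    (fun φ hφ ψ hψ => sup_mem_realPart hφ hψ) ?_ hFc fun x => ?_
  · intro x y hxy
    obtain ⟨w, hw, hw0, h⟩ := hsep x y hxy
    exact exists_ne_of_val_ne hw hw0 h
  by_cases hx : x ∈ G.infPts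
  -- A real value at infinity forces the end slope 0, so f is constant near this point.
  · obtain ⟨e, he, rfl⟩ := mem_infPts_iff.1 hx
    obtain ⟨a, m, ham⟩ := Rat.exists_endSlope hf0 he
    obtain ⟨rfl, h1⟩ := ham.eq_zero f.continuous_val (hreal _)
    refine ⟨fun _ => a, const_mem_realPart a, eventually_nhds_pt_top he ?_ ?_⟩
    · rw [hF] at h1
      exact_mod_cast h1.symm
    · filter_upwards [ham] with t ht
      rw [hF] at ht
      have := EReal.coe_eq_coe_iff.1 ht
      simpa using this.symm
  -- The maximum of w - w(x) and 0 is nonnegative, has slope 1 along d and vanishes along d'. The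
  -- case d = d' is admitted because there may be no other direction to start from.
  · have hpair : ∀ d d' : G.Dir, d.base = x → d'.base = x → ∃ φ ∈ realPart A hA,
        0 ≤ φ ∧ φ x = 0 ∧ (∀ᶠ s in 𝓝[>] (0 : ℝ), φ (d.path s) = s) ∧
          (d ≠ d' → ∀ᶠ s in 𝓝[>] (0 : ℝ), φ (d'.path s) = 0) := by
      intro d d' hd hd'
      obtain ⟨w, hw, ⟨a, h1⟩, h2⟩ := hdir d d' (hd.trans hd'.symm)
      obtain ⟨φ, hφ, h⟩ := exists_eventually_eq (hA := hA) hw h1.ne_zero hx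
      have hwx : w.val x = a := hd ▸ h1.eq_base w.continuous_val
      have hφx : φ x = a := by exact_mod_cast h.self_of_nhds.symm.trans hwx
      refine ⟨(φ - fun _ => a) ⊔ fun _ => 0, sup_mem_realPart (sub_mem hφ (const_mem_realPart a))
        (const_mem_realPart 0), fun y => le_max_right _ _, ?_, ?_, fun hne => ?_⟩
      · simp [hφx]
      · filter_upwards [h1, d.tendsto_path.eventually (hd ▸ h), self_mem_nhdsWithin] with s h3 h4 h5
        have h6 : φ (d.path s) = a + s := by
          have := h4.symm.trans h3
          simpa using EReal.coe_eq_coe_iff.1 this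
        simp [h6, le_of_lt (show 0 < s from h5)]
      · obtain ⟨b, h2⟩ := h2 hne
        have hb : b = a := by
          have h3 := h2.eq_base w.continuous_val
          rw [hd', hwx] at h3
          exact_mod_cast h3.symm
        filter_upwards [h2, d'.tendsto_path.eventually (hd' ▸ h)] with s h3 h4
        have h6 : φ (d'.path s) = a := by
          have := h4.symm.trans h3
          simpa [hb] using EReal.coe_eq_coe_iff.1 this
        simp [h6]
    -- The minimum of these functions over all d' keeps slope 1 along d; since they are nonnegative,
    -- it vanishes along every other direction.
    have hone : ∀ d : G.Dir, d.base = x → ∀ S : Finset G.Dir, (∀ d' ∈ S, d'.base = x) →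
        ∃ φ ∈ realPart A hA, 0 ≤ φ ∧ φ x = 0 ∧ (∀ᶠ s in 𝓝[>] (0 : ℝ), φ (d.path s) = s) ∧
          ∀ d' ∈ S, d ≠ d' → ∀ᶠ s in 𝓝[>] (0 : ℝ), φ (d'.path s) = 0 := by
      classical
      intro d hd S
      induction S using Finset.induction with
      | empty =>
        intro _
        obtain ⟨φ, h1, h2, h3, h4, -⟩ := hpair d d hd hd
        exact ⟨φ, h1, h2, h3, h4, by simp⟩
      | insert d' S _ ih =>
        intro hS
        obtain ⟨φ, h1, h2, h3, h4, h5⟩ := ih fun d'' h => hS d'' (Finset.mem_insert_of_mem h)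
        obtain ⟨ψ, g1, g2, g3, g4, g5⟩ := hpair d d' hd (hS d' (Finset.mem_insert_self _ _))
        refine ⟨φ ⊓ ψ, inf_mem_realPart h1 g1, le_inf h2 g2, by simp [h3, g3], ?_, ?_⟩
        · filter_upwards [h4, g4] with s h6 h7
          simp [h6, h7]
        · intro d'' hd'' hne
          rcases Finset.mem_insert.1 hd'' with rfl | hd''
          · filter_upwards [g5 hne] with s hs
            simpa [hs] using h2 _
          · filter_upwards [h5 d'' hd'' hne] with s hs
            simpa [hs] using g2 _
    classical
    let T : Finset G.Dir := (Dir.finite_base x).toFinset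
    have hT : ∀ d, d ∈ T ↔ d.base = x := fun d => (Dir.finite_base x).mem_toFinset
    choose a m ham using fun d : G.Dir => Rat.exists_slope hf0 d
    -- The functions of `hone` form a basis for the germs at x of functions with integer slopes that
    -- vanish at x, so the slopes of f can be put in one direction at a time.
    have hall : ∀ S : Finset G.Dir, (∀ d ∈ S, d.base = x) → ∃ φ ∈ realPart A hA, φ x = F x ∧
        ∀ d ∈ T, ∀ᶠ s in 𝓝[>] (0 : ℝ), φ (d.path s) = F x + (if d ∈ S then m d else 0) * s := by
      intro S
      induction S using Finset.induction with
      | empty =>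
        intro _
        exact ⟨fun _ => F x, const_mem_realPart _, rfl, by simp⟩
      | insert d S hdS ih =>
        intro hS
        obtain ⟨φ, h1, h2, h3⟩ := ih fun d'' h => hS d'' (Finset.mem_insert_of_mem h)
        have hd := hS d (Finset.mem_insert_self _ _)
        obtain ⟨ψ, g1, g2, g3, g4, g5⟩ := hone d hd T fun d' h => (hT d').1 h
        refine ⟨φ + m d • ψ, add_mem h1 (zsmul_mem g1 _), by simp [h2, g3], fun d' hd' => ?_⟩
        by_cases hdd : d = d'
        · subst hdd
          filter_upwards [h3 d hd', g4] with s h6 h7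
          simp [h6, h7, hdS]
        · filter_upwards [h3 d' hd', g5 d' hd' hdd] with s h6 h7
          simp [h6, h7, Ne.symm hdd]
    obtain ⟨φ, h1, h2, h3⟩ := hall T fun d h => (hT d).1 h
    refine ⟨φ, h1, eventually_nhds_of_dir hx h2 fun d hd => ?_⟩
    filter_upwards [h3 d ((hT d).2 hd), ham d] with s h4 h5
    have h6 := (ham d).eq_base f.continuous_val
    rw [hd, hF, EReal.coe_eq_coe_iff] at h6
    rw [hF, EReal.coe_eq_coe_iff] at h5
    rw [h4, h5, h6, if_pos ((hT d).2 hd)]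

end realPart

end TropModel

/-! ### Generated subsemifields -/

section adjoin

variable {T K : Type*} [Semifield T] [Semifield K] [Algebra T K]

theorem subset_semifieldAdjoin (s : Set K) : s ⊆ semifieldAdjoin T s := fun x hx => by
  rw [semifieldAdjoin, SetLike.mem_coe, Algebra.mem_sInf]
  exact fun S hS => hS.1 hx

theorem inv_mem_semifieldAdjoin {s : Set K} {x : K} (hx : x ∈ semifieldAdjoin T s) :
    x⁻¹ ∈ semifieldAdjoin T s := by
  rw [semifieldAdjoin, Algebra.mem_sInf] at hx ⊢
  exact fun S hS => hS.2 x (hx S hS)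

theorem semifieldAdjoin_le {s : Set K} {S : Subalgebra T K} (h : s ⊆ S) (h' : ∀ x ∈ S, x⁻¹ ∈ S) :
    semifieldAdjoin T s ≤ S :=
  sInf_le ⟨h, h'⟩

/-- Homomorphisms map generated subsemifields into subsemifields that contain the images of the
generators. -/
theorem map_mem_of_mem_semifieldAdjoin {K' : Type*} [Semifield K'] [Algebra T K'] (φ : K →ₐ[T] K')
    {s : Set K} {S : Subalgebra T K'} (h : φ '' s ⊆ S) (h' : ∀ x ∈ S, x⁻¹ ∈ S) {x : K}
    (hx : x ∈ semifieldAdjoin T s) : φ x ∈ S := by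
  refine semifieldAdjoin_le (S := S.comap φ) (fun y hy => h (mem_image_of_mem _ hy)) ?_ hx
  intro y hy
  show φ y⁻¹ ∈ S
  rw [map_inv₀]
  exact h' _ hy

end adjoin

/-! ### Piecewise linear functions of one variable -/

/-- Filters on `ℝ` along which affine functions have a sign. -/
def AffineSign (l : Filter ℝ) : Prop :=
  ∀ a b : ℝ, (∀ᶠ t in l, 0 ≤ a + b * t) ∨ ∀ᶠ t in l, a + b * t ≤ 0

/-- Functions that are affine with integer slope along every such filter. -/
def PiecewiseLinear (ρ : ℝ → ℝ) : Prop :=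
  ∀ l, AffineSign l → ∃ (a : ℝ) (m : ℤ), ∀ᶠ t in l, ρ t = a + m * t

namespace PiecewiseLinear

theorem id : PiecewiseLinear fun t => t := fun _ _ => ⟨0, 1, Eventually.of_forall fun t => by simp⟩

theorem const (c : ℝ) : PiecewiseLinear fun _ => c := fun _ _ =>
  ⟨c, 0, Eventually.of_forall fun t => by simp⟩

theorem add {ρ ρ' : ℝ → ℝ} (h : PiecewiseLinear ρ) (h' : PiecewiseLinear ρ') :
    PiecewiseLinear fun t => ρ t + ρ' t := by
  intro l hl
  obtain ⟨a, m, h1⟩ := h l hl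
  obtain ⟨b, n, h2⟩ := h' l hl
  refine ⟨a + b, m + n, ?_⟩
  filter_upwards [h1, h2] with t h3 h4
  rw [h3, h4]
  push_cast
  ring

theorem neg {ρ : ℝ → ℝ} (h : PiecewiseLinear ρ) : PiecewiseLinear fun t => -ρ t := by
  intro l hl
  obtain ⟨a, m, h1⟩ := h l hl
  refine ⟨-a, -m, ?_⟩
  filter_upwards [h1] with t h3
  rw [h3]
  push_cast
  ring

theorem sub {ρ ρ' : ℝ → ℝ} (h : PiecewiseLinear ρ) (h' : PiecewiseLinear ρ') :
    PiecewiseLinear fun t => ρ t - ρ' t := by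
  simpa [sub_eq_add_neg] using h.add h'.neg

/-- The difference of the two affine functions has a sign along the filter, so the same one of them
is eventually the larger. This is the only use of `AffineSign`. -/
theorem max {ρ ρ' : ℝ → ℝ} (h : PiecewiseLinear ρ) (h' : PiecewiseLinear ρ') :
    PiecewiseLinear fun t => max (ρ t) (ρ' t) := by
  intro l hl
  obtain ⟨a, m, h1⟩ := h l hl
  obtain ⟨b, n, h2⟩ := h' l hl
  rcases hl (a - b) (m - n) with h3 | h3
  · refine ⟨a, m, ?_⟩
    filter_upwards [h1, h2, h3] with t h4 h5 h6
    rw [h4, h5]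
    exact max_eq_left (by linarith)
  · refine ⟨b, n, ?_⟩
    filter_upwards [h1, h2, h3] with t h4 h5 h6
    rw [h4, h5]
    exact max_eq_right (by linarith)

theorem min {ρ ρ' : ℝ → ℝ} (h : PiecewiseLinear ρ) (h' : PiecewiseLinear ρ') :
    PiecewiseLinear fun t => min (ρ t) (ρ' t) := by
  have := (h.neg.max h'.neg).neg
  simpa [max_neg_neg] using this

end PiecewiseLinear

/-- Together with the right neighbourhoods of 0 this covers the two kinds of germs in which slopes
are taken: ends at infinity and directions at finite points. -/
theorem affineSign_atTop : AffineSign atTop := by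
  intro a b
  rcases lt_trichotomy b 0 with h | rfl | h
  · right
    filter_upwards [eventually_ge_atTop (a / -b)] with t ht
    rw [div_le_iff₀ (neg_pos.2 h)] at ht
    linarith
  · rcases le_total 0 a with h | h
    · exact Or.inl (Eventually.of_forall fun t => by simpa using h)
    · exact Or.inr (Eventually.of_forall fun t => by simpa using h)
  · left
    filter_upwards [eventually_ge_atTop (-a / b)] with t ht
    rw [div_le_iff₀ h] at ht
    linarith

theorem affineSign_nhdsGT : AffineSign (𝓝[>] (0 : ℝ)) := by
  intro a b
  have hc : Tendsto (fun t : ℝ => a + b * t) (𝓝[>] 0) (𝓝 a) := by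
    have h : Continuous fun t : ℝ => a + b * t := by fun_prop
    simpa using (h.tendsto 0).mono_left (nhdsWithin_le_nhds (s := Ioi 0))
  rcases lt_trichotomy a 0 with h | rfl | h
  · exact Or.inr ((hc.eventually (gt_mem_nhds h)).mono fun _ h => h.le)
  · rcases le_total 0 b with h | h
    · left
      filter_upwards [self_mem_nhdsWithin] with t ht
      rw [zero_add]
      exact mul_nonneg h (le_of_lt ht)
    · right
      filter_upwards [self_mem_nhdsWithin] with t ht
      rw [zero_add]
      exact mul_nonpos_of_nonpos_of_nonneg h (le_of_lt ht)
  · exact Or.inl ((hc.eventually (lt_mem_nhds h)).mono fun _ h => h.le)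

namespace TropModel

variable {V E : Type*} {G : TropModel V E}

theorem Dir.affineSign (d : G.Dir) : AffineSign (map d.coord (𝓝[>] 0)) := by
  intro a b
  simp only [eventually_map]
  refine (affineSign_nhdsGT (a + b * d.pos) (b * d.sgn)).imp (fun h => h.mono fun s hs => ?_)
    fun h => h.mono fun s hs => ?_ <;>
  · rw [coord]
    linarith

theorem hasSlope_of_coord {f : G.Curve → EReal} {d : G.Dir} {a : ℝ} {m : ℤ}
    (h : ∀ᶠ s in 𝓝[>] (0 : ℝ), f (d.path s) = ((a + m * d.coord s : ℝ) : EReal)) :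
    HasSlope f d (a + m * d.pos) (m * d.isgn) := by
  filter_upwards [h] with s hs
  rw [hs]
  congr 1
  push_cast
  rw [d.coe_isgn, Dir.coord]
  ring

/-- The rational function that is given on every edge by a piecewise linear function. -/
noncomputable def Rat.ofPiecewiseLinear (φ : G.Curve → ℝ≥0∞) (hφ : Continuous φ)
    (htop : ∀ x, x ∉ G.infPts → φ x ≠ ⊤)
    (h : ∀ e, ∃ ρ, PiecewiseLinear ρ ∧ ∀ t : ℝ, 0 ≤ t → ENNReal.ofReal t ≤ G.len e →
      φ (G.pt e (ENNReal.ofReal t)) = ENNReal.ofReal (ρ t)) : G.Rat G.whole :=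
  Rat.ofSlopes (fun x => (φ x : EReal)) (continuous_coe_ennreal_ereal.comp hφ)
    (fun x hx => ⟨EReal.coe_ennreal_ne_bot _, by simpa using htop x hx⟩)
    (fun d => by
      obtain ⟨ρ, hρ, h1⟩ := h d.edge
      -- `ENNReal.ofReal` cuts off negative values, so the values are those of max ρ 0.
      obtain ⟨a, m, h2⟩ := (hρ.max (PiecewiseLinear.const 0)) _ d.affineSign
      refine ⟨_, _, hasSlope_of_coord (a := a) (m := m) ?_⟩
      filter_upwards [eventually_map.1 h2, d.eventually_inner] with s h3 h4
      rw [Dir.path, h1 _ h4.1.le h4.2.le, EReal.coe_ennreal_ofReal, h3])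
    (fun e he => by
      obtain ⟨ρ, hρ, h1⟩ := h e
      obtain ⟨a, m, h2⟩ := (hρ.max (PiecewiseLinear.const 0)) _ affineSign_atTop
      refine ⟨a, m, ?_⟩
      filter_upwards [h2, eventually_ge_atTop 0] with t h3 h4
      rw [h1 t h4 (he ▸ le_top), EReal.coe_ennreal_ofReal, h3])

theorem exists_vertex_notMem_infPts (G : TropModel V E) : ∃ v, G.vertex v ∉ G.infPts := by
  obtain ⟨x, hx⟩ := G.exists_notMem_infPts
  rcases vertex_or_pt x with ⟨v, rfl⟩ | ⟨e, t, -, rfl⟩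
  · exact ⟨v, hx⟩
  · exact ⟨G.src e, by rw [← pt_zero]; exact pt_notMem_infPts ENNReal.zero_ne_top⟩

theorem sep_ne_top (i : Option (E × Bool)) {x : G.Curve} (hx : x ∉ G.infPts) : G.sep i x ≠ ⊤ := by
  obtain ⟨v, hv⟩ := G.exists_vertex_notMem_infPts
  refine (edgeLip_sep i).ne_top hv ?_ hx
  rcases i with _ | ⟨e, b⟩
  · exact ENNReal.coe_ne_top
  · show G.tentOn e b _ ≠ ⊤
    rw [tentOn_vertex fun he h => hv ⟨e, he, by rw [h]⟩]
    exact ENNReal.zero_ne_top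

theorem tent_piecewiseLinear (l : ℝ≥0∞) (b : Bool) : ∃ ρ, PiecewiseLinear ρ ∧ ∀ t : ℝ, 0 ≤ t →
    tent l b (ENNReal.ofReal t) = ENNReal.ofReal (ρ t) := by
  by_cases hl : l = ⊤
  · exact ⟨_, PiecewiseLinear.id, fun t _ => by rw [hl, tent_top]⟩
  · rw [← ENNReal.ofReal_toReal hl]
    exact ⟨_, PiecewiseLinear.id.min ((PiecewiseLinear.const _).sub PiecewiseLinear.id),
      fun t ht => tent_ofReal b ENNReal.toReal_nonneg ht⟩

theorem sep_piecewiseLinear (i : Option (E × Bool)) (e : E) : ∃ ρ, PiecewiseLinear ρ ∧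
    ∀ t : ℝ, 0 ≤ t → ENNReal.ofReal t ≤ G.len e →
      G.sep i (G.pt e (ENNReal.ofReal t)) = ENNReal.ofReal (ρ t) := by
  rcases i with _ | ⟨e', b⟩
  · obtain ⟨a, b, h⟩ := G.exists_height_pt e
    refine ⟨_, (((PiecewiseLinear.const a).add PiecewiseLinear.id).min
      (PiecewiseLinear.const b)).max ((PiecewiseLinear.const a).sub PiecewiseLinear.id), ?_⟩
    intro t ht hle
    have h1 : G.sep none = G.height := rfl
    rw [h1, h _ hle, ENNReal.ofReal_mono.map_max, ENNReal.ofReal_mono.map_min,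
      ENNReal.ofReal_add a.coe_nonneg ht, ENNReal.ofReal_sub _ ht, ENNReal.ofReal_coe_nnreal,
      ENNReal.ofReal_coe_nnreal]
  · by_cases he : e = e'
    · subst he
      obtain ⟨ρ, hρ, h⟩ := tent_piecewiseLinear (G.len e) b
      refine ⟨ρ, hρ, fun t ht hle => ?_⟩
      rw [← h t ht]
      exact tentOn_pt hle
    · refine ⟨_, PiecewiseLinear.const 0, fun t ht hle => ?_⟩
      rw [ENNReal.ofReal_zero]
      exact tentOn_pt_of_ne he hle

/-- Finitely many rational functions that generate the rational functions without infinite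
values. -/
noncomputable def gen (G : TropModel V E) (i : Option (E × Bool)) : G.Rat G.whole :=
  Rat.ofPiecewiseLinear (G.sep i) (continuous_sep i) (fun _ hx => sep_ne_top i hx)
    (sep_piecewiseLinear i)

theorem gen_val (i : Option (E × Bool)) (x : G.Curve) : (G.gen i).val x = (G.sep i x : EReal) := rfl

theorem gen_ne_zero (i : Option (E × Bool)) : G.gen i ≠ 0 := by
  obtain ⟨x, hx⟩ := G.exists_notMem_infPts
  exact Rat.ne_zero_of_val_ne (x := x) (by rw [gen_val]; exact EReal.coe_ennreal_ne_bot _)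

theorem HasSlope.of_eq {f : G.Curve → EReal} {d : G.Dir} {a b : ℝ} {m n : ℤ} (h : HasSlope f d a m)
    (hab : a = b) (hmn : m = n) : HasSlope f d b n := hab ▸ hmn ▸ h

/-- After normalization to the value 0 at the base point, the maximum with 0 turns the slopes 1 and
-1 into 1 and 0. If the signs are the other way round, w is first inverted. -/
theorem exists_slope_of_opposite {A : Subalgebra TropR (G.Rat G.whole)} (hA : ∀ f ∈ A, f⁻¹ ∈ A)
    {d d' : G.Dir} (hd : d.base = d'.base) {w : G.Rat G.whole} (hw : w ∈ A) {a b : ℝ} {p : ℤ}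
    (hp : p = 1 ∨ p = -1) (h : HasSlope w.val d a p) (h' : d ≠ d' → HasSlope w.val d' b (-p)) :
    ∃ w ∈ A, (∃ a, HasSlope w.val d a 1) ∧ (d ≠ d' → ∃ b, HasSlope w.val d' b 0) := by
  wlog hp1 : p = 1 generalizing w a b p
  · have hp2 : p = -1 := hp.resolve_left hp1
    exact this (hA w hw) (p := -p) (by simp [hp2]) h.inv (fun hne => (h' hne).inv) (by simp [hp2])
  subst hp1
  refine ⟨w * algebraMap _ _ (TropR.ofReal (-a)) + algebraMap _ _ (TropR.ofReal 0),
    A.add_mem (A.mul_mem hw (A.algebraMap_mem _)) (A.algebraMap_mem _), ⟨0, ?_⟩, fun hne => ⟨0, ?_⟩⟩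
  · have h1 := h.mul (hasSlope_algebraMap d (-a))
    exact ((h1.of_eq (add_neg_cancel a) rfl).add (hasSlope_algebraMap d 0)).of_eq rfl (by simp)
  · have h2 := h' hne
    have hab : a = b := by
      have h3 := h.eq_base w.continuous_val
      rw [hd, h2.eq_base w.continuous_val] at h3
      exact_mod_cast h3.symm
    have h1 := h2.mul (hasSlope_algebraMap d' (-a))
    exact ((h1.of_eq (by rw [hab, add_neg_cancel]) rfl).add (hasSlope_algebraMap d' 0)).of_eq rfl
      (by simp)

theorem Dir.cases (d : G.Dir) : (0 < d.pos ∧ ENNReal.ofReal d.pos < G.len d.edge) ∨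
    (d.pos = 0 ∧ d.up = true) ∨ (ENNReal.ofReal d.pos = G.len d.edge ∧ d.up = false) := by
  by_cases h0 : 0 < d.pos
  · rcases d.pos_le.lt_or_eq with h1 | h1
    · exact Or.inl ⟨h0, h1⟩
    · refine Or.inr (Or.inr ⟨h1, ?_⟩)
      by_contra h2
      exact (d.pos_lt_of_up (by simpa using h2)).ne h1
  · refine Or.inr (Or.inl ⟨le_antisymm (not_lt.1 h0) d.pos_nonneg, ?_⟩)
    by_contra h2
    exact h0 (d.pos_of_down (by simpa using h2))

theorem Dir.inner_of_base_eq {d d' : G.Dir} (h : d.base = d'.base) (h0 : 0 < d.pos)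
    (h1 : ENNReal.ofReal d.pos < G.len d.edge) : d'.edge = d.edge ∧ d'.pos = d.pos := by
  obtain ⟨h2, h3⟩ := pt_eq_pt (ENNReal.ofReal_pos.2 h0) h1 d'.pos_le h
  exact ⟨h2.symm, ((ENNReal.ofReal_eq_ofReal_iff d.pos_nonneg d'.pos_nonneg).1 h3).symm⟩

theorem hasSlope_gen_of_edge_ne {d : G.Dir} {e : E} (b : Bool) (h : d.edge ≠ e) :
    HasSlope (G.gen (some (e, b))).val d 0 0 := by
  filter_upwards [d.eventually_inner] with s hs
  have h1 : G.sep (some (e, b)) (d.path s) = 0 := tentOn_pt_of_ne h hs.2.le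
  rw [gen_val, h1]
  simp

theorem hasSlope_gen {d : G.Dir} {b : Bool} {a : ℝ} {m : ℤ}
    (h : ∀ᶠ s in 𝓝[>] (0 : ℝ), tent (G.len d.edge) b (ENNReal.ofReal (d.coord s)) =
      ENNReal.ofReal (a + m * s)) (h' : ∀ᶠ s in 𝓝[>] (0 : ℝ), 0 ≤ a + m * s) :
    HasSlope (G.gen (some (d.edge, b))).val d a m := by
  filter_upwards [h, h', d.eventually_inner] with s h1 h2 h3
  have h4 : G.sep (some (d.edge, b)) (d.path s) = tent (G.len d.edge) b _ := tentOn_pt h3.2.le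
  rw [gen_val, h4, h1, EReal.coe_ennreal_ofReal, max_eq_left h2]

theorem hasSlope_gen_of_pos_eq_zero {d : G.Dir} (h0 : d.pos = 0) (hup : d.up = true) (b : Bool) :
    HasSlope (G.gen (some (d.edge, b))).val d 0 1 := by
  have hc : ∀ s, d.coord s = s := fun s => by simp [Dir.coord, Dir.sgn, h0, hup]
  refine hasSlope_gen ?_ ?_
  · by_cases hl : G.len d.edge = ⊤
    · exact Eventually.of_forall fun s => by simp [hl, tent_top, hc]
    · have hl0 : 0 < (G.len d.edge).toReal := ENNReal.toReal_pos (G.len_pos _).ne' hl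
      refine eventually_of_pos (δ := (G.len d.edge).toReal / 3) (by positivity) fun s h1 h2 => ?_
      rw [← ENNReal.ofReal_toReal hl, hc, tent_ofReal b hl0.le h1.le, min_eq_left]
      · simp
      · unfold tentLen
        split_ifs <;> linarith
  · filter_upwards [self_mem_nhdsWithin] with s hs
    have : 0 < s := hs
    simpa using this.le

/-- The short tent vanishes on the last third of the edge, whereas both tents rise with slope 1 at
its beginning. This tells the two ends of a loop apart. -/
theorem hasSlope_gen_of_pos_eq_len {d : G.Dir} (h0 : ENNReal.ofReal d.pos = G.len d.edge)
    (hup : d.up = false) (b : Bool) :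
    HasSlope (G.gen (some (d.edge, b))).val d 0 (if b then 1 else 0) := by
  have hc : ∀ s, d.coord s = d.pos - s := fun s => by simp [Dir.coord, Dir.sgn, hup, sub_eq_add_neg]
  have hpos := d.pos_of_down hup
  have hs : (0 : ℝ) < d.pos / 3 := by positivity
  refine hasSlope_gen (eventually_of_pos hs fun s h1 h2 => ?_)
    (eventually_of_pos hs fun s h1 h2 => ?_)
  · rw [← h0, hc, tent_ofReal b hpos.le (by linarith), min_eq_right]
    · cases b
      · rw [ENNReal.ofReal_of_nonpos]
        · simp
        · simp only [tentLen, Bool.false_eq_true, if_false]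
          linarith
      · simp [tentLen]
    · unfold tentLen
      split_ifs <;> linarith
  · cases b <;> simp [h1.le]

/-- At an inner point it suffices that one of the tents is affine with slope ±1 nearby. Its slopes
in the two directions are then opposite. -/
theorem exists_hasSlope_gen_of_inner (e : E) {t : ℝ} (h0 : 0 < t) (h1 : ENNReal.ofReal t < G.len e) :
    ∃ b a, ∃ p : ℤ, (p = 1 ∨ p = -1) ∧ ∀ d : G.Dir, d.edge = e → d.pos = t →
      HasSlope (G.gen (some (e, b))).val d (a + p * t) (p * d.isgn) := by
  suffices h : ∃ b a, ∃ p : ℤ, (p = 1 ∨ p = -1) ∧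
      ∀ᶠ u in 𝓝 t, tent (G.len e) b (ENNReal.ofReal u) = ENNReal.ofReal (a + p * u) ∧ 0 ≤ a + p * u by
    obtain ⟨b, a, p, hp, h⟩ := h
    refine ⟨b, a, p, hp, ?_⟩
    rintro d rfl rfl
    refine hasSlope_of_coord ?_
    have hc : Tendsto d.coord (𝓝[>] 0) (𝓝 d.pos) := by
      rw [← d.coord_zero]
      exact (d.continuous_coord.tendsto 0).mono_left nhdsWithin_le_nhds
    filter_upwards [hc.eventually h, d.eventually_inner] with s h2 h3
    have h4 : G.sep (some (d.edge, b)) (d.path s) = tent (G.len d.edge) b _ := tentOn_pt h3.2.le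
    rw [gen_val, h4, h2.1, EReal.coe_ennreal_ofReal, max_eq_left h2.2]
  by_cases hl : G.len e = ⊤
  · refine ⟨true, 0, 1, Or.inl rfl, ?_⟩
    filter_upwards [lt_mem_nhds h0] with u hu
    rw [hl, tent_top]
    simp [hu.le]
  · have hl0 : 0 < (G.len e).toReal := ENNReal.toReal_pos (G.len_pos _).ne' hl
    rw [← ENNReal.ofReal_toReal hl, ENNReal.ofReal_lt_ofReal_iff hl0] at h1
    set l := (G.len e).toReal
    rw [← ENNReal.ofReal_toReal hl]
    rcases lt_trichotomy t (l / 2) with h2 | h2 | h2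
    · refine ⟨true, 0, 1, Or.inl rfl, ?_⟩
      filter_upwards [lt_mem_nhds h0, gt_mem_nhds h2] with u h3 h4
      rw [tent_ofReal true hl0.le h3.le, min_eq_left (by simp only [tentLen, if_true]; linarith)]
      simp [h3.le]
    -- The full tent has its kink at the midpoint; the short one is affine there, being on its
    -- descent from l / 3 to 2 / 3 * l.
    · refine ⟨false, 2 / 3 * l, -1, Or.inr rfl, ?_⟩
      filter_upwards [lt_mem_nhds (show l / 3 < t by linarith),
        gt_mem_nhds (show t < 2 / 3 * l by linarith)] with u h3 h4
      rw [tent_ofReal false hl0.le (by linarith), min_eq_right]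
      · simp only [tentLen, Bool.false_eq_true, if_false]
        constructor
        · congr 1
          push_cast
          ring
        · push_cast
          linarith
      · simp only [tentLen, Bool.false_eq_true, if_false]
        linarith
    · refine ⟨true, l, -1, Or.inr rfl, ?_⟩
      filter_upwards [lt_mem_nhds h2, gt_mem_nhds h1] with u h3 h4
      rw [tent_ofReal true hl0.le (by linarith), min_eq_right]
      · simp only [tentLen, if_true]
        constructor
        · congr 1
          push_cast
          ring
        · push_cast
          linarith
      · simp only [tentLen, if_true]
        linarith

/-- The functions `gen` separate directions. -/
theorem exists_slope_of_gen_mem {A : Subalgebra TropR (G.Rat G.whole)} (hA : ∀ f ∈ A, f⁻¹ ∈ A)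
    (hgen : ∀ i, G.gen i ∈ A) {d d' : G.Dir} (hd : d.base = d'.base) :
    ∃ w ∈ A, (∃ a, HasSlope w.val d a 1) ∧ (d ≠ d' → ∃ b, HasSlope w.val d' b 0) := by
  have hnot : ¬ (0 < d.pos ∧ ENNReal.ofReal d.pos < G.len d.edge) →
      ¬ (0 < d'.pos ∧ ENNReal.ofReal d'.pos < G.len d'.edge) := by
    rintro h ⟨h1, h2⟩
    obtain ⟨h3, h4⟩ := Dir.inner_of_base_eq hd.symm h1 h2
    rw [h3, h4] at h
    exact h ⟨h1, h2⟩
  rcases d.cases with ⟨h0, h1⟩ | h | h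
  -- At an inner point the only directions are the two opposite ones on the same edge.
  · obtain ⟨h2, h3⟩ := Dir.inner_of_base_eq hd h0 h1
    obtain ⟨b, a, p, hp, h⟩ := exists_hasSlope_gen_of_inner d.edge h0 h1
    refine exists_slope_of_opposite hA hd (hgen (some (d.edge, b))) ?_ (h d rfl rfl)
      (b := a + p * d.pos) fun hne => ?_
    · rcases hp with rfl | rfl <;> unfold Dir.isgn <;> split_ifs <;> simp
    · convert h d' h2 h3 using 1
      have hup : d.up ≠ d'.up := fun hup => hne (Dir.ext_iff'.2 ⟨h2.symm, h3.symm, hup⟩)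
      unfold Dir.isgn
      rcases Bool.eq_false_or_eq_true d.up with h4 | h4 <;>
        rcases Bool.eq_false_or_eq_true d'.up with h5 | h5 <;> simp_all
  · have hni : ¬ (0 < d.pos ∧ ENNReal.ofReal d.pos < G.len d.edge) := fun h2 => h2.1.ne' h.1
    refine ⟨_, hgen (some (d.edge, false)), ⟨_, hasSlope_gen_of_pos_eq_zero h.1 h.2 false⟩,
      fun hne => ⟨0, ?_⟩⟩
    by_cases he : d'.edge = d.edge
    · rcases d'.cases with h' | h' | h'
      · exact absurd h' (hnot hni)
      · exact absurd (Dir.ext_iff'.2 ⟨he.symm, h.1.trans h'.1.symm, h.2.trans h'.2.symm⟩) hne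
      · have := hasSlope_gen_of_pos_eq_len h'.1 h'.2 false
        rw [he] at this
        simpa using this
    · exact hasSlope_gen_of_edge_ne false he
  · have hni : ¬ (0 < d.pos ∧ ENNReal.ofReal d.pos < G.len d.edge) := fun h2 => h2.2.ne h.1
    -- The quotient of the full tent by the short one has slope 1 - 0 at the end of the edge and
    -- slope 1 - 1 at its beginning, which matters if the edge is a loop.
    refine ⟨G.gen (some (d.edge, true)) * (G.gen (some (d.edge, false)))⁻¹,
      A.mul_mem (hgen _) (hA _ (hgen _)), ⟨0 + -0, ?_⟩, fun hne => ⟨0 + -0, ?_⟩⟩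
    · simpa using (hasSlope_gen_of_pos_eq_len h.1 h.2 true).mul
        (hasSlope_gen_of_pos_eq_len h.1 h.2 false).inv
    by_cases he : d'.edge = d.edge
    · rcases d'.cases with h' | h' | h'
      · exact absurd h' (hnot hni)
      · have := (hasSlope_gen_of_pos_eq_zero h'.1 h'.2 true).mul
          (hasSlope_gen_of_pos_eq_zero h'.1 h'.2 false).inv
        rw [he] at this
        simpa using this
      · refine absurd (Dir.ext_iff'.2 ⟨he.symm, ?_, h.2.trans h'.2.symm⟩) hne
        rw [← ENNReal.ofReal_eq_ofReal_iff d.pos_nonneg d'.pos_nonneg, h.1, h'.1, he]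
    · simpa using (hasSlope_gen_of_edge_ne true he).mul (hasSlope_gen_of_edge_ne false he).inv

theorem exists_gen_val_ne {x y : G.Curve} (h : x ≠ y) : ∃ i, (G.gen i).val x ≠ (G.gen i).val y := by
  obtain ⟨i, hi⟩ := exists_sep_ne h
  exact ⟨i, fun h => hi (EReal.coe_ennreal_injective h)⟩

/-- Rational functions without infinite values are generated by finitely many functions. -/
theorem mem_semifieldAdjoin_range_gen {f : G.Rat G.whole}
    (hreal : ∀ x, f.val x ≠ ⊥ ∧ f.val x ≠ ⊤) : f ∈ semifieldAdjoin TropR (range G.gen) := by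
  have hA : ∀ f ∈ semifieldAdjoin TropR (range G.gen), f⁻¹ ∈ semifieldAdjoin TropR (range G.gen) :=
    fun _ => inv_mem_semifieldAdjoin
  have hgen : ∀ i, G.gen i ∈ semifieldAdjoin TropR (range G.gen) := fun i =>
    subset_semifieldAdjoin _ (mem_range_self i)
  refine mem_of_separates hA (fun x y hxy => ?_)
    (fun d d' hd => exists_slope_of_gen_mem hA hgen hd) hreal
  obtain ⟨i, hi⟩ := exists_gen_val_ne hxy
  exact ⟨_, hgen i, gen_ne_zero i, hi⟩

/-! ### Distances are rational functions -/

theorem continuous_of_dir {Y : Type*} [TopologicalSpace Y] {F : G.Curve → Y}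
    (hdir : ∀ d : G.Dir, Tendsto (fun s => F (d.path s)) (𝓝[>] 0) (𝓝 (F d.base)))
    (hend : ∀ e, G.len e = ⊤ →
      Tendsto (fun t : ℝ => F (G.pt e (ENNReal.ofReal t))) atTop (𝓝 (F (G.pt e ⊤)))) :
    Continuous F := by
  refine continuous_iff_continuousAt.2 fun x => ?_
  intro N hN
  by_cases hx : x ∈ G.infPts
  · obtain ⟨e, he, rfl⟩ := mem_infPts_iff.1 hx
    exact eventually_nhds_pt_top he (p := fun y => F y ∈ N) (mem_of_mem_nhds hN) (hend e he hN)
  · refine eventually_nhds_of_dir hx (p := fun y => F y ∈ N) (mem_of_mem_nhds hN) fun d hd => ?_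
    exact hdir d (hd ▸ hN)

theorem gap_ofReal {a b : ℝ} (ha : 0 ≤ a) (hb : 0 ≤ b) :
    gap (ENNReal.ofReal a) (ENNReal.ofReal b) = ENNReal.ofReal |a - b| := by
  rw [gap, ← ENNReal.ofReal_sub _ hb, ← ENNReal.ofReal_sub _ ha, ← ENNReal.ofReal_mono.map_max,
    abs_eq_max_neg, neg_sub]

theorem gap_triangle (u s t : ℝ≥0∞) : gap u t ≤ gap u s + gap s t := by
  refine max_le (tsub_le_iff_right.2 ?_) (tsub_le_iff_left.2 ?_)
  · refine (le_add_gap s u).trans ((add_le_add (le_add_gap t s) le_rfl).trans ?_)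
    rw [gap_comm t s, gap_comm s u]
    exact (by ring : t + gap s t + gap u s = gap u s + gap s t + t).le
  · refine (le_add_gap s t).trans ((add_le_add (le_add_gap u s) le_rfl).trans ?_)
    rw [add_assoc]

theorem gap_add {u s t : ℝ≥0∞} (h : u ≤ s) (h' : s ≤ t) : gap u s + gap s t = gap u t := by
  rw [gap_of_le h, gap_of_le h', gap_of_le (h.trans h'), add_comm]
  exact tsub_add_tsub_cancel h' h

theorem Dir.gap_coord (d : G.Dir) {s : ℝ} (hs : 0 ≤ s) (h : 0 ≤ d.coord s) :
    gap (ENNReal.ofReal d.pos) (ENNReal.ofReal (d.coord s)) = ENNReal.ofReal s := by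
  rw [gap_ofReal d.pos_nonneg h, coord]
  congr 1
  rcases d.sgn_cases with ⟨-, h⟩ | ⟨-, h⟩ <;> rw [h]
  · simp [abs_of_nonneg hs]
  · simp [abs_of_nonneg hs]

theorem EdgeLip.eventually_path {Φ : G.Curve → ℝ≥0∞} (h : G.EdgeLip Φ) (d : G.Dir) :
    ∀ᶠ s in 𝓝[>] (0 : ℝ), Φ (d.path s) ≤ Φ d.base + ENNReal.ofReal s ∧
      Φ d.base ≤ Φ (d.path s) + ENNReal.ofReal s := by
  filter_upwards [d.eventually_inner, self_mem_nhdsWithin] with s h1 h2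
  have h3 := d.gap_coord (le_of_lt h2) h1.1.le
  constructor
  · rw [← h3]
    exact h _ _ _ d.pos_le h1.2.le
  · rw [← h3, gap_comm]
    exact h _ _ _ h1.2.le d.pos_le

theorem EdgeLip.eventually_abs_le {Φ : G.Curve → ℝ≥0∞} (h : G.EdgeLip Φ)
    (hfin : ∀ x, x ∉ G.infPts → Φ x ≠ ⊤) (d : G.Dir) :
    ∀ᶠ s in 𝓝[>] (0 : ℝ), |(Φ (d.path s)).toReal - (Φ d.base).toReal| ≤ s := by
  filter_upwards [h.eventually_path d, self_mem_nhdsWithin] with s ⟨h1, h2⟩ h3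
  have h3 : 0 < s := h3
  have h4 := ENNReal.toReal_mono (ENNReal.add_ne_top.2 ⟨hfin _ d.base_notMem_infPts,
    ENNReal.ofReal_ne_top⟩) h1
  have h5 := ENNReal.toReal_mono (ENNReal.add_ne_top.2 ⟨hfin _ (d.path_notMem_infPts s),
    ENNReal.ofReal_ne_top⟩) h2
  rw [ENNReal.toReal_add (hfin _ d.base_notMem_infPts) ENNReal.ofReal_ne_top,
    ENNReal.toReal_ofReal h3.le] at h4
  rw [ENNReal.toReal_add (hfin _ (d.path_notMem_infPts s)) ENNReal.ofReal_ne_top,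
    ENNReal.toReal_ofReal h3.le] at h5
  rw [abs_le]
  constructor <;> linarith

theorem EdgeLip.tendsto_path {Φ : G.Curve → ℝ≥0∞} (h : G.EdgeLip Φ)
    (hfin : ∀ x, x ∉ G.infPts → Φ x ≠ ⊤) (d : G.Dir) :
    Tendsto (fun s => Φ (d.path s)) (𝓝[>] 0) (𝓝 (Φ d.base)) := by
  have h1 : Tendsto (fun s => (Φ (d.path s)).toReal) (𝓝[>] 0) (𝓝 (Φ d.base).toReal) := by
    rw [tendsto_iff_dist_tendsto_zero]
    refine squeeze_zero' (Eventually.of_forall fun _ => _root_.dist_nonneg)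
      (h.eventually_abs_le hfin d) ?_
    exact tendsto_nhdsWithin_of_tendsto_nhds tendsto_id
  have h2 := (ENNReal.continuous_ofReal.tendsto _).comp h1
  rw [ENNReal.ofReal_toReal (hfin _ d.base_notMem_infPts)] at h2
  exact h2.congr fun s => ENNReal.ofReal_toReal (hfin _ (d.path_notMem_infPts s))

section interval

variable {A : Set G.Curve} {e : E} {u v : ℝ≥0∞}

/-- On a segment of an edge whose interior does not meet `A`, the distance from `A` is realized by
paths through one of the ends of the segment. -/
theorem setDist_pt_eq_min (huv : u ≤ v) (hv : v ≤ G.len e)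
    (hA : ∀ t, u < t → t < v → G.pt e t ∉ A) {t : ℝ≥0∞} (hut : u ≤ t) (htv : t ≤ v) :
    G.setDist A (G.pt e t) =
      min (G.setDist A (G.pt e u) + gap u t) (G.setDist A (G.pt e v) + gap v t) := by
  classical
  have hD := edgeLip_setDist (G := G) A
  let D := G.setDist A
  let M : ℝ≥0∞ → ℝ≥0∞ := fun t => min (D (G.pt e u) + gap u t) (D (G.pt e v) + gap v t)
  have hle : ∀ t, t ≤ G.len e → D (G.pt e t) ≤ M t := fun t ht =>
    le_min (hD e u t (huv.trans hv) ht) (hD e v t hv ht)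
  refine le_antisymm (hle t (htv.trans hv)) ?_
  have hML : Lip M := fun s t => by
    simp only [M]
    rw [min_add_add_right _ _ (gap s t) |>.symm, add_assoc, add_assoc]
    exact min_le_min (add_le_add le_rfl (gap_triangle _ _ _)) (add_le_add le_rfl (gap_triangle _ _ _))
  -- The distance with its values inside the segment replaced by M. It still vanishes on A and is
  -- edgewise Lipschitz, because the segment can be left only through its ends; hence it is a lower
  -- bound for the distance.
  let Φ : G.Curve → ℝ≥0∞ := fun x => if h : ∃ t, u < t ∧ t < v ∧ x = G.pt e t then M h.choose else D x
  have hin : ∀ t, u < t → t < v → Φ (G.pt e t) = M t := by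
    intro t h1 h2
    have h : ∃ t', u < t' ∧ t' < v ∧ G.pt e t = G.pt e t' := ⟨t, h1, h2, rfl⟩
    have h3 : Φ (G.pt e t) = M h.choose := dif_pos h
    obtain ⟨h4, h5, h6⟩ := h.choose_spec
    rw [h3, ← (pt_eq_pt (bot_le.trans_lt h1) (h2.trans_le hv) (h5.le.trans hv) h6).2]
  have hout : ∀ x, (¬ ∃ t, u < t ∧ t < v ∧ x = G.pt e t) → Φ x = D x := fun x h => dif_neg h
  have hDΦ : ∀ x, D x ≤ Φ x := by
    intro x
    by_cases h : ∃ t, u < t ∧ t < v ∧ x = G.pt e t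
    · obtain ⟨t, h1, h2, rfl⟩ := h
      rw [hin t h1 h2]
      exact hle t (h2.le.trans hv)
    · exact (hout x h).ge
  have hMu : M u ≤ D (G.pt e u) := (min_le_left _ _).trans (by rw [gap_self, add_zero])
  have hMv : M v ≤ D (G.pt e v) := (min_le_right _ _).trans (by rw [gap_self, add_zero])
  have hΦ : G.EdgeLip Φ := by
    intro e' s' t' hs' ht'
    by_cases h : ∃ t, u < t ∧ t < v ∧ G.pt e' t' = G.pt e t
    · obtain ⟨t, h1, h2, h3⟩ := h
      obtain ⟨rfl, rfl⟩ := pt_eq_pt (bot_le.trans_lt h1) (h2.trans_le hv) ht' h3.symm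
      rw [hin t h1 h2]
      rcases lt_or_ge u s' with h4 | h4
      · rcases lt_or_ge s' v with h5 | h5
        · rw [hin s' h4 h5]
          exact hML s' t
        · refine (hML v t).trans ((add_le_add (hMv.trans (hD e s' v hs' hv)) le_rfl).trans ?_)
          rw [add_assoc]
          refine add_le_add (hDΦ _) (le_of_eq ?_)
          rw [gap_comm s' v, gap_comm v t, add_comm, gap_add h2.le h5, gap_comm]
      · refine (hML u t).trans
          ((add_le_add (hMu.trans (hD e s' u hs' (huv.trans hv))) le_rfl).trans ?_)
        rw [add_assoc]
        refine add_le_add (hDΦ _) (le_of_eq ?_)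
        rw [gap_add h4 h1.le]
    · rw [hout _ h]
      exact (hD e' s' t' hs' ht').trans (add_le_add (hDΦ _) le_rfl)
  have hΦA : ∀ y ∈ A, Φ y = 0 := by
    intro y hy
    refine (hout y ?_).trans (setDist_of_mem hy)
    rintro ⟨t, h1, h2, rfl⟩
    exact hA t h1 h2 hy
  have hmain := hΦ.le_setDist hΦA (G.pt e t)
  rcases eq_or_lt_of_le hut with rfl | h1
  · exact (min_le_left _ _).trans (by rw [gap_self, add_zero])
  rcases eq_or_lt_of_le htv with rfl | h2
  · exact (min_le_right _ _).trans (by rw [gap_self, add_zero])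
  rwa [hin t h1 h2] at hmain

end interval

/-- An infinite edge passes through each of the finitely many frontier points at most once. Beyond
the last of them it cannot change sides, since half-lines are connected. -/
theorem eventually_mem_or_of_end {A : Set G.Curve} (hA : (frontier A).Finite) {e : E}
    (he : G.len e = ⊤) :
    (∃ T : ℝ, 0 ≤ T ∧ ∀ t, T < t → G.pt e (ENNReal.ofReal t) ∈ A) ∨
      ∃ T : ℝ, 0 ≤ T ∧ ∀ t, T < t → G.pt e (ENNReal.ofReal t) ∉ A := by
  have h1 : ∀ᶠ t : ℝ in atTop, G.pt e (ENNReal.ofReal t) ∉ frontier A := by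
    have : ∀ x ∈ frontier A, ∀ᶠ t : ℝ in atTop, G.pt e (ENNReal.ofReal t) ≠ x := by
      intro x _
      by_cases hx : ∃ r, 0 ≤ r ∧ G.pt e (ENNReal.ofReal r) = x
      · obtain ⟨r, hr, rfl⟩ := hx
        filter_upwards [eventually_gt_atTop r] with t ht h2
        have h3 := pt_injective he h2
        rw [ENNReal.ofReal_eq_ofReal_iff (hr.trans ht.le) hr] at h3
        exact ht.ne' h3
      · filter_upwards [eventually_ge_atTop 0] with t ht h2
        exact hx ⟨t, ht, h2⟩
    filter_upwards [(eventually_all_finite hA).2 this] with t ht h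
    exact ht _ h rfl
  obtain ⟨T, hT⟩ := eventually_atTop.1 (h1.and (eventually_ge_atTop 0))
  have hT0 : 0 ≤ T := (hT T le_rfl).2
  by_contra hc
  rw [not_or] at hc
  push Not at hc
  obtain ⟨s, hs, hsA⟩ := hc.1 T hT0
  obtain ⟨t, ht, htA⟩ := hc.2 T hT0
  have hcont : Continuous fun t : ℝ => G.pt e (ENNReal.ofReal t) :=
    (continuous_pt e).comp ENNReal.continuous_ofReal
  obtain ⟨_, ⟨u, hu, rfl⟩, h2⟩ := (isPreconnected_Ioi.image _
    hcont.continuousOn).exists_mem_frontier (mem_image_of_mem _ ht) htA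
    (mem_image_of_mem _ hs) hsA
  exact (hT u (le_of_lt hu)).1 h2

section distRat

variable {A : Set G.Curve}

theorem coe_setDist (hA : ∃ a ∈ A, a ∉ G.infPts) {x : G.Curve} (hx : x ∉ G.infPts) :
    (G.setDist A x : EReal) = ((G.setDist A x).toReal : EReal) :=
  (EReal.coe_ennreal_toReal (setDist_ne_top hA hx)).symm

/-- With a finite frontier, a direction either runs in A, where the distance is 0, or avoids A for a
while; then `setDist_pt_eq_min` exhibits a minimum of two affine functions. -/
theorem exists_slope_setDist (hfr : (frontier A).Finite) (hA : ∃ a ∈ A, a ∉ G.infPts) (d : G.Dir) :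
    ∃ a m, HasSlope (fun x => -(G.setDist A x : EReal)) d a m := by
  rcases d.eventually_mem_or hfr with h | h
  · refine ⟨0, 0, ?_⟩
    filter_upwards [h] with s hs
    rw [setDist_of_mem hs]
    simp
  obtain ⟨δ, hδ, h1⟩ := exists_pos_of_eventually (h.and d.eventually_inner)
  -- Stopping halfway keeps the far end of the segment in the range where the direction is known to
  -- avoid A and to be inside the edge.
  set b := δ / 2 with hb
  have hb0 : 0 < b := by positivity
  have hbδ : b < δ := by linarith
  let α := (G.setDist A d.base).toReal
  let β := (G.setDist A (d.path b)).toReal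
  have hα : G.setDist A d.base = ENNReal.ofReal α :=
    (ENNReal.ofReal_toReal (setDist_ne_top hA d.base_notMem_infPts)).symm
  have hβ : G.setDist A (d.path b) = ENNReal.ofReal β :=
    (ENNReal.ofReal_toReal (setDist_ne_top hA (d.path_notMem_infPts b))).symm
  have key : ∀ s, 0 < s → s < b →
      G.setDist A (d.path s) = ENNReal.ofReal (min (α + s) (β + (b - s))) := by
    intro s hs hsb
    have hcs := (h1 s hs (hsb.trans hbδ)).2.1
    have hcb := (h1 b hb0 hbδ).2
    have hgap : gap (ENNReal.ofReal (d.coord b)) (ENNReal.ofReal (d.coord s)) =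
        ENNReal.ofReal (b - s) := by
      rw [gap_ofReal hcb.1.le hcs.le, Dir.coord, Dir.coord]
      congr 1
      rcases d.sgn_cases with ⟨-, h⟩ | ⟨-, h⟩ <;> rw [h]
      · rw [abs_of_pos] <;> linarith
      · rw [abs_of_neg] <;> linarith
    have h2 : G.setDist A (d.path s) = min (G.setDist A d.base + ENNReal.ofReal s)
        (G.setDist A (d.path b) + ENNReal.ofReal (b - s)) := by
      rw [← hgap, ← d.gap_coord hs.le hcs.le]
      have hmem : ∀ t, ENNReal.ofReal (min d.pos (d.coord b)) < t →
          t < ENNReal.ofReal (max d.pos (d.coord b)) → G.pt d.edge t ∉ A := by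
        intro t ht ht'
        have htop := ne_top_of_lt ht'
        rw [ENNReal.ofReal_lt_iff_lt_toReal (le_min d.pos_nonneg hcb.1.le) htop] at ht
        rw [ENNReal.lt_ofReal_iff_toReal_lt htop] at ht'
        rcases d.sgn_cases with ⟨-, h⟩ | ⟨-, h⟩
        · have h3 : d.coord b = d.pos + b := by rw [Dir.coord, h, one_mul]
          rw [h3, min_eq_left (by linarith)] at ht
          rw [h3, max_eq_right (by linarith)] at ht'
          have h4 : d.path (t.toReal - d.pos) = G.pt d.edge t := by
            rw [Dir.path, Dir.coord, h, one_mul, add_sub_cancel, ENNReal.ofReal_toReal htop]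
          rw [← h4]
          exact (h1 _ (by linarith) (by linarith)).1
        · have h3 : d.coord b = d.pos - b := by rw [Dir.coord, h]; ring
          rw [h3, min_eq_right (by linarith)] at ht
          rw [h3, max_eq_left (by linarith)] at ht'
          have h4 : d.path (d.pos - t.toReal) = G.pt d.edge t := by
            rw [Dir.path, Dir.coord, h, show d.pos + -1 * (d.pos - t.toReal) = t.toReal by ring,
              ENNReal.ofReal_toReal htop]
          rw [← h4]
          exact (h1 _ (by linarith) (by linarith)).1
      rcases d.sgn_cases with ⟨-, h⟩ | ⟨-, h⟩
      · have h3 : d.coord b = d.pos + b := by rw [Dir.coord, h, one_mul]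
        have h4 : d.coord s = d.pos + s := by rw [Dir.coord, h, one_mul]
        rw [min_eq_left (by linarith), max_eq_right (by linarith)] at hmem
        exact setDist_pt_eq_min (ENNReal.ofReal_le_ofReal (by linarith)) hcb.2.le hmem
          (ENNReal.ofReal_le_ofReal (by linarith)) (ENNReal.ofReal_le_ofReal (by linarith))
      · have h3 : d.coord b = d.pos - b := by rw [Dir.coord, h]; ring
        have h4 : d.coord s = d.pos - s := by rw [Dir.coord, h]; ring
        rw [min_eq_right (by linarith), max_eq_left (by linarith)] at hmem
        rw [min_comm]
        exact setDist_pt_eq_min (ENNReal.ofReal_le_ofReal (by linarith)) d.pos_le hmem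
          (ENNReal.ofReal_le_ofReal (by linarith)) (ENNReal.ofReal_le_ofReal (by linarith))
    rw [h2, hα, hβ, ← ENNReal.ofReal_add ENNReal.toReal_nonneg hs.le,
      ← ENNReal.ofReal_add ENNReal.toReal_nonneg (by linarith), ENNReal.ofReal_mono.map_min]
  obtain ⟨a, m, ham⟩ := (((PiecewiseLinear.const α).add PiecewiseLinear.id).min
    ((PiecewiseLinear.const β).add ((PiecewiseLinear.const b).sub PiecewiseLinear.id))).neg _
    affineSign_nhdsGT
  refine ⟨a, m, ?_⟩
  filter_upwards [ham, eventually_of_pos hb0 key, eventually_of_pos hb0 fun s h h' => And.intro h h']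
    with s h2 h3 h4
  have h5 : (0 : ℝ) ≤ α := ENNReal.toReal_nonneg
  have h6 : (0 : ℝ) ≤ β := ENNReal.toReal_nonneg
  rw [h3, EReal.coe_ennreal_ofReal, max_eq_left, ← h2, EReal.coe_neg]
  exact le_min (by linarith) (by linarith)

/-- The negative of the distance from a closed set with finite boundary. -/
theorem exists_rat_setDist (hcl : IsClosed A) (hfr : (frontier A).Finite)
    (hA : ∃ a ∈ A, a ∉ G.infPts) (hinf : ∀ x ∈ A, x ∈ G.infPts → A ∈ 𝓝 x) :
    ∃ f : G.Rat G.whole, ∀ x, f.val x = -(G.setDist A x : EReal) := by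
  have hfin : ∀ x, x ∉ G.infPts → G.setDist A x ≠ ⊤ := fun x hx => setDist_ne_top hA hx
  have hend : ∀ e, G.len e = ⊤ → (∃ a m, HasEndSlope (fun x => -(G.setDist A x : EReal)) e a m) ∧
      Tendsto (fun t : ℝ => G.setDist A (G.pt e (ENNReal.ofReal t))) atTop
        (𝓝 (G.setDist A (G.pt e ⊤))) := by
    intro e he
    rcases eventually_mem_or_of_end hfr he with ⟨T, -, hT⟩ | ⟨T, hT0, hT⟩
    · have h1 : ∀ᶠ t : ℝ in atTop, G.setDist A (G.pt e (ENNReal.ofReal t)) = 0 := by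
        filter_upwards [eventually_gt_atTop T] with t ht
        exact setDist_of_mem (hT t ht)
      refine ⟨⟨0, 0, h1.mono fun t ht => by simp [ht]⟩, ?_⟩
      have h2 : G.pt e ⊤ ∈ A := hcl.mem_of_tendsto tendsto_pt_top
        ((eventually_gt_atTop T).mono hT)
      rw [setDist_of_mem h2]
      exact tendsto_const_nhds.congr' (h1.mono fun t ht => ht.symm)
    -- By `hinf`, a point at infinity in A would bring a whole end of the edge into A.
    · have hnot : G.pt e ⊤ ∉ A := by
        intro h
        have h1 := tendsto_pt_top.eventually (hinf _ h (pt_top_mem_infPts he))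
        obtain ⟨t, h2, h3⟩ := (h1.and (eventually_gt_atTop T)).exists
        exact hT t h3 h2
      -- The coordinate on this edge, extended by 0, is Lipschitz and infinite only at this point at
      -- infinity, so all points of A are infinitely far away.
      have h1 : G.setDist A (G.pt e ⊤) = ⊤ := by
        refine iInf₂_eq_top.2 fun y hy => ?_
        have h2 := (edgeLip_sep (some (e, true))).le_add_dist y (G.pt e ⊤)
        have h3 : G.sep (some (e, true)) (G.pt e ⊤) = ⊤ := by
          show G.tentOn e true _ = _
          rw [tentOn_pt he.ge, he, tent_top]
        have h4 : G.sep (some (e, true)) y ≠ ⊤ := by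
          by_cases hy' : y ∈ G.infPts
          · obtain ⟨e', he', rfl⟩ := mem_infPts_iff.1 hy'
            show G.tentOn e true _ ≠ ⊤
            rw [tentOn_pt_of_ne (fun h : e' = e => hnot (by rw [← h]; exact hy)) he'.ge]
            exact ENNReal.zero_ne_top
          · exact sep_ne_top _ hy'
        rw [h3, top_le_iff, ENNReal.add_eq_top] at h2
        exact h2.resolve_left h4
      -- The infinite end of the segment from T to ∞ contributes nothing to the minimum, so the
      -- distance grows with slope 1.
      have h2 : ∀ t, T < t → G.setDist A (G.pt e (ENNReal.ofReal t)) =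
          G.setDist A (G.pt e (ENNReal.ofReal T)) + ENNReal.ofReal (t - T) := by
        intro t ht
        have hTt : ENNReal.ofReal T ≤ ENNReal.ofReal t := ENNReal.ofReal_le_ofReal ht.le
        rw [setDist_pt_eq_min (u := ENNReal.ofReal T) (v := ⊤) le_top (he ▸ le_rfl) ?_ hTt le_top,
          gap_of_le hTt, ENNReal.ofReal_sub _ hT0, h1, top_add]
        · exact min_eq_left le_top
        · intro w hw hw'
          rw [← ENNReal.ofReal_toReal hw'.ne]
          exact hT _ ((ENNReal.ofReal_lt_iff_lt_toReal hT0 hw'.ne).1 hw)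
      constructor
      · refine ⟨-(G.setDist A (G.pt e (ENNReal.ofReal T))).toReal + T, -1, ?_⟩
        filter_upwards [eventually_gt_atTop T] with t ht
        rw [h2 t ht, EReal.coe_ennreal_add, coe_setDist hA pt_ofReal_notMem_infPts,
          EReal.coe_ennreal_ofReal, max_eq_left (by linarith), ← EReal.coe_add, ← EReal.coe_neg]
        congr 1
        push_cast
        ring
      · rw [h1]
        refine tendsto_nhds_top_mono (f := fun t : ℝ => ENNReal.ofReal (t - T)) ?_ ?_
        · exact ENNReal.tendsto_ofReal_nhds_top.2 (tendsto_atTop_add_const_right _ _ tendsto_id)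
        · filter_upwards [eventually_gt_atTop T] with t ht
          rw [h2 t ht]
          exact le_add_self
  refine ⟨Rat.ofSlopes (fun x => -(G.setDist A x : EReal)) ?_ ?_ (exists_slope_setDist hfr hA)
    fun e he => (hend e he).1, fun x => rfl⟩
  · refine continuous_neg.comp (continuous_coe_ennreal_ereal.comp ?_)
    exact continuous_of_dir (fun d => (edgeLip_setDist A).tendsto_path hfin d)
      fun e he => (hend e he).2
  · intro x hx
    rw [coe_setDist hA hx, ← EReal.coe_neg]
    exact ⟨EReal.coe_ne_bot _, EReal.coe_ne_top _⟩

/-- Cutting off the distance at a finite l is tropical addition of the constant -l to the negative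
of the distance. -/
theorem exists_rat_chipFiring (hcl : IsClosed A) (hfr : (frontier A).Finite)
    (hA : ∃ a ∈ A, a ∉ G.infPts) (hinf : ∀ x ∈ A, x ∈ G.infPts → A ∈ 𝓝 x) (l : ℝ≥0∞) :
    ∃ f : G.Rat G.whole, ∀ x, f.val x = G.chipFiring A l x := by
  obtain ⟨f, hf⟩ := exists_rat_setDist hcl hfr hA hinf
  by_cases hl : l = ⊤
  · refine ⟨f, fun x => ?_⟩
    rw [hf, chipFiring_eq, hl, min_eq_left le_top]
  · refine ⟨f + algebraMap _ _ (TropR.ofReal (-l.toReal)), fun x => ?_⟩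
    rw [Rat.val_add, hf, chipFiring_eq, Rat.val_algebraMap, TropR.toEReal_ofReal, EReal.coe_neg,
      EReal.coe_ennreal_toReal hl, ← EReal.neg_strictAnti.antitone.map_min,
      EReal.coe_ennreal_strictMono.monotone.map_min]

end distRat

/-! ### Rays -/

theorem gap_eq_zero {s t : ℝ≥0∞} : gap s t = 0 ↔ s = t := by
  refine ⟨fun h => ?_, fun h => h ▸ gap_self s⟩
  have h1 := le_add_gap s t
  have h2 := le_add_gap t s
  rw [gap_comm t s] at h2
  rw [h, add_zero] at h1 h2
  exact le_antisymm h2 h1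

theorem gap_zero_left (t : ℝ≥0∞) : gap 0 t = t := by
  rw [gap_of_le (zero_le : 0 ≤ t), tsub_zero]

theorem gap_add_left {M : ℝ≥0∞} (hM : M ≠ ⊤) (s t : ℝ≥0∞) : gap (M + s) (M + t) = gap s t := by
  unfold gap
  rw [ENNReal.add_sub_add_eq_sub_left hM, ENNReal.add_sub_add_eq_sub_left hM]

theorem setDist_singleton (x y : G.Curve) : G.setDist {x} y = G.dist x y := by
  simp [setDist]

theorem dist_ne_top {x y : G.Curve} (hx : x ∉ G.infPts) (hy : y ∉ G.infPts) : G.dist x y ≠ ⊤ := by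
  rw [← setDist_singleton]
  exact setDist_ne_top ⟨x, mem_singleton x, hx⟩ hy

section infiniteEdge

variable {e : E}

theorem sep_pt (he : G.len e = ⊤) (t : ℝ≥0∞) : G.sep (some (e, true)) (G.pt e t) = t := by
  show G.tentOn e true _ = _
  rw [tentOn_pt (le_of_le_of_eq le_top he.symm), he, tent_top]

theorem sep_ne_top_of_ne {y : G.Curve} (hy : y ≠ G.pt e ⊤) : G.sep (some (e, true)) y ≠ ⊤ := by
  by_cases hy' : y ∈ G.infPts
  · obtain ⟨e', he', rfl⟩ := mem_infPts_iff.1 hy'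
    show G.tentOn e true _ ≠ ⊤
    rw [tentOn_pt_of_ne (fun h : e' = e => hy (by rw [h])) he'.ge]
    exact ENNReal.zero_ne_top
  · exact sep_ne_top _ hy'

theorem dist_pt_top (he : G.len e = ⊤) {y : G.Curve} (hy : y ≠ G.pt e ⊤) :
    G.dist y (G.pt e ⊤) = ⊤ ∧ G.dist (G.pt e ⊤) y = ⊤ := by
  have h1 := (edgeLip_sep (some (e, true))).le_add_dist y (G.pt e ⊤)
  have h2 := (edgeLip_sep (some (e, true))).le_add_dist' (G.pt e ⊤) y
  rw [sep_pt he, top_le_iff, ENNReal.add_eq_top] at h1 h2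
  exact ⟨h1.resolve_left (sep_ne_top_of_ne hy), h2.resolve_left (sep_ne_top_of_ne hy)⟩

theorem dist_pt_pt (he : G.len e = ⊤) (s t : ℝ≥0∞) : G.dist (G.pt e s) (G.pt e t) = gap s t := by
  refine le_antisymm (dist_pt_le (le_of_le_of_eq le_top he.symm) (le_of_le_of_eq le_top he.symm)) ?_
  have h1 := (edgeLip_sep (some (e, true))).le_add_dist (G.pt e s) (G.pt e t)
  have h2 := (edgeLip_sep (some (e, true))).le_add_dist' (G.pt e s) (G.pt e t)
  rw [sep_pt he, sep_pt he] at h1 h2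
  exact max_le (tsub_le_iff_left.2 h2) (tsub_le_iff_left.2 h1)

theorem isRayChart_pt (he : G.len e = ⊤) (M : ℝ≥0) : G.IsRayChart fun t => G.pt e (M + t) := by
  refine ⟨(continuous_pt e).comp (by fun_prop), fun s t => ?_, ?_⟩
  · rw [dist_pt_pt he, gap_add_left ENNReal.coe_ne_top]
    rfl
  · convert G.isOpen_tail e he M using 1
    rw [tail_eq]
    ext x
    constructor
    · rintro ⟨t, ht, rfl⟩
      exact ⟨_, ENNReal.lt_add_right ENNReal.coe_ne_top (ne_of_gt ht), rfl⟩
    · rintro ⟨t, ht, rfl⟩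
      refine ⟨t - M, mem_Ioi.2 (tsub_pos_of_lt (mem_Ioi.1 ht)), ?_⟩
      show G.pt e _ = _
      rw [add_tsub_cancel_of_le (le_of_lt ht)]

theorem isRay_range_pt (he : G.len e = ⊤) : G.IsRay (range (G.pt e)) :=
  ⟨_, isRayChart_pt he 0, by simp⟩

end infiniteEdge

/-! ### Isometric charts of rays -/

namespace IsRayChart

variable {p : ℝ≥0∞ → G.Curve}

theorem dist_eq (hp : G.IsRayChart p) (s t : ℝ≥0∞) : G.dist (p s) (p t) = gap s t := hp.2.1 s t

theorem injective (hp : G.IsRayChart p) : Function.Injective p := fun s t h => by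
  have h1 := hp.dist_eq s t
  rw [h, dist_self] at h1
  exact gap_eq_zero.1 h1.symm

/-- A point at infinity is infinitely far from every other point, but p t and p (t + 1) have a
finite distance. -/
theorem notMem_infPts (hp : G.IsRayChart p) {t : ℝ≥0∞} (ht : t ≠ ⊤) : p t ∉ G.infPts := by
  intro h
  obtain ⟨e, he, h1⟩ := mem_infPts_iff.1 h
  have ht1 : t + 1 ≠ ⊤ := ENNReal.add_ne_top.2 ⟨ht, ENNReal.one_ne_top⟩
  have h2 : p (t + 1) ≠ G.pt e ⊤ := fun h2 => by
    have h3 := hp.injective (h2.trans h1.symm)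
    exact (ENNReal.lt_add_right ht one_ne_zero).ne' h3
  have h3 := (dist_pt_top he h2).1
  rw [← h1, hp.dist_eq] at h3
  exact gap_ne_top ht1 ht h3

theorem top_mem_infPts (hp : G.IsRayChart p) : p ⊤ ∈ G.infPts := by
  by_contra h
  refine dist_ne_top (hp.notMem_infPts ENNReal.zero_ne_top) h ?_
  rw [hp.dist_eq, gap_zero_left]

theorem mem_infPts_iff (hp : G.IsRayChart p) {t : ℝ≥0∞} : p t ∈ G.infPts ↔ t = ⊤ :=
  ⟨fun h => by_contra fun h' => hp.notMem_infPts h' h, fun h => h ▸ hp.top_mem_infPts⟩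

theorem isClosed_range (hp : G.IsRayChart p) : IsClosed (range p) :=
  (isCompact_range hp.1).isClosed

theorem mem_image_or_eq (p : ℝ≥0∞ → G.Curve) {x : G.Curve} (hx : x ∈ range p) :
    x ∈ p '' Ioi 0 ∨ x = p 0 := by
  obtain ⟨t, rfl⟩ := hx
  rcases eq_or_lt_of_le (zero_le : 0 ≤ t) with rfl | h
  · exact Or.inr rfl
  · exact Or.inl ⟨t, h, rfl⟩

theorem closure_image (hp : G.IsRayChart p) : closure (p '' Ioi 0) = range p := by
  refine Subset.antisymm (closure_minimal (image_subset_range _ _) hp.isClosed_range) ?_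
  have h := image_closure_subset_closure_image hp.1 (s := Ioi 0)
  rw [closure_Ioi' ⟨⊤, ENNReal.zero_lt_top⟩] at h
  rintro _ ⟨t, rfl⟩
  exact h ⟨t, mem_Ici.2 zero_le, rfl⟩

theorem frontier_image (hp : G.IsRayChart p) : frontier (p '' Ioi 0) ⊆ {p 0} := by
  rw [hp.2.2.frontier_eq, hp.closure_image]
  rintro x ⟨h1, h2⟩
  exact (mem_image_or_eq p h1).resolve_left h2

theorem frontier_range (hp : G.IsRayChart p) : frontier (range p) ⊆ {p 0} := by
  rw [hp.isClosed_range.frontier_eq]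
  rintro x ⟨h1, h2⟩
  exact (mem_image_or_eq p h1).resolve_left fun h =>
    h2 (interior_maximal (image_subset_range _ _) hp.2.2 h)

open Classical in
/-- The coordinate on a ray, extended by `0`. -/
noncomputable def coordOn (p : ℝ≥0∞ → G.Curve) (x : G.Curve) : ℝ≥0∞ :=
  if h : x ∈ range p then h.choose else 0

theorem coordOn_apply (hp : G.IsRayChart p) (t : ℝ≥0∞) : coordOn p (p t) = t := by
  have h : p t ∈ range p := mem_range_self t
  have h1 : coordOn p (p t) = h.choose := dif_pos h
  rw [h1]
  exact hp.injective h.choose_spec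

theorem coordOn_of_notMem (hp : G.IsRayChart p) {x : G.Curve} (hx : x ∉ p '' Ioi 0) :
    coordOn p x = 0 := by
  by_cases h : x ∈ range p
  · rw [(mem_image_or_eq p h).resolve_left hx, hp.coordOn_apply]
  · exact dif_neg h

/-- The only frontier point of the open ray is p 0, so an edge can enter the ray from outside only
there, where the coordinate is 0. This function supplies the lower bound for distances from sets
that meet the ray in p 0 alone. -/
theorem edgeLip_coordOn (hp : G.IsRayChart p) : G.EdgeLip (coordOn p) := by
  intro e s t hs ht
  by_cases h : G.pt e t ∈ p '' Ioi 0
  swap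
  · rw [hp.coordOn_of_notMem h]
    exact bot_le
  by_cases h' : G.pt e s ∈ p '' Ioi 0
  · obtain ⟨b, -, hb⟩ := h
    obtain ⟨a, -, ha⟩ := h'
    rw [← ha, ← hb, hp.coordOn_apply, hp.coordOn_apply]
    refine (le_add_gap a b).trans (add_le_add le_rfl ?_)
    rw [← hp.dist_eq, ha, hb]
    exact dist_pt_le hs ht
  · have hconn : IsPreconnected (G.pt e '' uIcc s t) :=
      isPreconnected_uIcc.image _ (continuous_pt e).continuousOn
    obtain ⟨_, ⟨w, hw, rfl⟩, hz⟩ := hconn.exists_mem_frontier (mem_image_of_mem _ right_mem_uIcc) h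
      (mem_image_of_mem _ left_mem_uIcc) h'
    have hw0 : G.pt e w = p 0 := hp.frontier_image hz
    have hwl : w ≤ G.len e := hw.2.trans (max_le hs ht)
    obtain ⟨b, -, hb⟩ := h
    rw [hp.coordOn_of_notMem h', zero_add, ← hb, hp.coordOn_apply]
    calc b = G.dist (p 0) (p b) := by rw [hp.dist_eq, gap_zero_left]
      _ ≤ gap w t := by rw [hb, ← hw0]; exact dist_pt_le hwl ht
      _ ≤ gap s t := gap_le_of_mem_uIcc hw

/-- The distance from a set that meets a ray in its boundary point only. -/
theorem setDist_apply (hp : G.IsRayChart p) {A : Set G.Curve} (h0 : p 0 ∈ A)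
    (hA : ∀ t, 0 < t → p t ∉ A) (t : ℝ≥0∞) : G.setDist A (p t) = t := by
  refine le_antisymm ((iInf₂_le _ h0).trans ?_) ?_
  · rw [hp.dist_eq, gap_zero_left]
  · have h1 := hp.edgeLip_coordOn.le_setDist (A := A) (fun y hy => hp.coordOn_of_notMem ?_) (p t)
    · rwa [hp.coordOn_apply] at h1
    · rintro ⟨s, hs, rfl⟩
      exact hA s hs hy

/-- Far out, a ray coincides with an edge of infinite length. -/
theorem exists_edge (hp : G.IsRayChart p) : ∃ e, G.len e = ⊤ ∧ p ⊤ = G.pt e ⊤ ∧ ∃ c T : ℝ, 0 ≤ T ∧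
    ∀ t, T ≤ t → 0 ≤ t + c ∧ p (ENNReal.ofReal t) = G.pt e (ENNReal.ofReal (t + c)) := by
  obtain ⟨e, he, h⟩ := TropModel.mem_infPts_iff.1 hp.top_mem_infPts
  refine ⟨e, he, h, ?_⟩
  have hlim : Tendsto (fun t : ℝ => p (ENNReal.ofReal t)) atTop (𝓝 (G.pt e ⊤)) := by
    rw [← h]
    exact (hp.1.tendsto _).comp (ENNReal.tendsto_ofReal_nhds_top.2 tendsto_id)
  let φ := G.sep (some (e, true))
  have hφ : Tendsto (fun t : ℝ => φ (p (ENNReal.ofReal t))) atTop (𝓝 ⊤) := by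
    have := ((continuous_sep (G := G) (some (e, true))).tendsto _).comp hlim
    rwa [sep_pt he] at this
  let u : ℝ → ℝ := fun t => (φ (p (ENNReal.ofReal t))).toReal
  have hfin : ∀ t : ℝ, φ (p (ENNReal.ofReal t)) ≠ ⊤ := fun t =>
    sep_ne_top _ (hp.notMem_infPts ENNReal.ofReal_ne_top)
  have hu : Tendsto u atTop atTop := by
    refine tendsto_atTop.2 fun b => ?_
    filter_upwards [hφ.eventually (lt_mem_nhds (a := ENNReal.ofReal b) ENNReal.ofReal_lt_top)]
      with t ht
    exact (ENNReal.ofReal_le_iff_le_toReal (hfin t)).1 ht.le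
  have htail : ∀ᶠ t : ℝ in atTop, p (ENNReal.ofReal t) ∈ G.tail e he 0 :=
    hlim.eventually ((G.isOpen_tail e he 0).mem_nhds (pt_mem_tail he ENNReal.coe_lt_top))
  obtain ⟨T, hT⟩ := eventually_atTop.1 (htail.and (eventually_ge_atTop 0))
  have hT0 : 0 ≤ T := (hT T le_rfl).2
  have hpu : ∀ t, T ≤ t → p (ENNReal.ofReal t) = G.pt e (ENNReal.ofReal (u t)) := by
    intro t ht
    have h1 := (hT t ht).1
    rw [tail_eq] at h1
    obtain ⟨w, -, hw⟩ := h1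
    have h2 : φ (p (ENNReal.ofReal t)) = w := by rw [← hw]; exact sep_pt he w
    rw [ENNReal.ofReal_toReal (hfin t), h2, hw]
  have hu0 : ∀ t, 0 ≤ u t := fun t => ENNReal.toReal_nonneg
  have hdist : ∀ s t, T ≤ s → T ≤ t → |u s - u t| = |s - t| := by
    intro s t hs ht
    have h1 := hp.dist_eq (ENNReal.ofReal s) (ENNReal.ofReal t)
    rw [hpu s hs, hpu t ht, dist_pt_pt he, gap_ofReal (hu0 s) (hu0 t),
      gap_ofReal (hT0.trans hs) (hT0.trans ht),
      ENNReal.ofReal_eq_ofReal_iff (abs_nonneg _) (abs_nonneg _)] at h1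
    exact h1
  refine ⟨u T - T, T, hT0, fun t ht => ?_⟩
  -- An isometry between half-lines that tends to infinity is a translation: both T and t are
  -- compared with a point S so far out that all signs of the differences are known.
  have key : u t = t + (u T - T) := by
    obtain ⟨S, hS1, hS2, hS3⟩ := ((hu.eventually_ge_atTop (u T)).and
      ((hu.eventually_ge_atTop (u t)).and (eventually_ge_atTop t))).exists
    have h1 := hdist S T (ht.trans hS3) le_rfl
    have h2 := hdist S t (ht.trans hS3) ht
    rw [abs_of_nonneg (sub_nonneg.2 hS1), abs_of_nonneg (sub_nonneg.2 (ht.trans hS3))] at h1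
    rw [abs_of_nonneg (sub_nonneg.2 hS2), abs_of_nonneg (sub_nonneg.2 hS3)] at h2
    linarith
  rw [← key]
  exact ⟨hu0 t, hpu t ht⟩

/-- The edge of infinite length that shares its point at infinity with a ray. -/
theorem exists_shift (hp : G.IsRayChart p) {e : E} (he : G.len e = ⊤) (h : G.pt e ⊤ ∈ range p) :
    p ⊤ = G.pt e ⊤ ∧ ∃ c T : ℝ, 0 ≤ T ∧
      ∀ t, T ≤ t → 0 ≤ t + c ∧ p (ENNReal.ofReal t) = G.pt e (ENNReal.ofReal (t + c)) := by
  obtain ⟨e', he', h1, h2⟩ := hp.exists_edge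
  obtain ⟨t, ht⟩ := h
  have h3 : t = ⊤ := hp.mem_infPts_iff.1 (ht ▸ pt_top_mem_infPts he)
  rw [h3] at ht
  have h4 := pt_top_injective he' he (h1.symm.trans ht)
  rw [← h4]
  exact ⟨h1, h2⟩

end IsRayChart

/-- Far out, chart and edge coordinate differ by a translation, which changes the constant term but
not the slope. In particular the choice of the chart is immaterial. -/
theorem hasSlopeAtInfinity_iff {L : Set G.Curve} (hL : G.IsRay L) {e : E} (he : G.len e = ⊤)
    (h : G.pt e ⊤ ∈ L) {f : G.Rat G.whole} {m : ℤ} :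
    G.HasSlopeAtInfinity f L m ↔ ∃ a, HasEndSlope f.val e a m := by
  constructor
  · rintro ⟨p, hp, rfl, a, S, hS⟩
    obtain ⟨-, c, T, hT0, hT⟩ := hp.exists_shift he h
    refine ⟨a - m * c, ?_⟩
    filter_upwards [eventually_ge_atTop (T + c), eventually_ge_atTop (S + c)] with t h1 h2
    have h3 := (hT (t - c) (by linarith)).2
    rw [sub_add_cancel] at h3
    rw [← h3]
    have h4 := hS (t - c).toNNReal (by rw [← NNReal.coe_le_coe, Real.coe_toNNReal] <;> linarith)
    refine h4.trans ?_
    rw [Real.coe_toNNReal _ (by linarith)]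
    congr 1
    ring
  · rintro ⟨a, ha⟩
    obtain ⟨p, hp, rfl⟩ := hL
    obtain ⟨-, c, T, hT0, hT⟩ := hp.exists_shift he h
    obtain ⟨S, hS⟩ := eventually_atTop.1 ha
    refine ⟨p, hp, rfl, a + m * c, (max T (S - c)).toNNReal, fun t ht => ?_⟩
    have h1 : max T (S - c) ≤ t := Real.toNNReal_le_iff_le_coe.1 ht
    have h2 := (hT t ((le_max_left _ _).trans h1)).2
    have h3 := hS (t + c) (by linarith [(le_max_right _ _).trans h1])
    rw [ENNReal.ofReal_coe_nnreal] at h2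
    show f.val (p t) = _
    rw [h2, h3]
    congr 1
    ring

/-! ### Parallel rays and end slopes -/

namespace Parallelization

variable {R : G.Parallelization} {L L' L'' : Set G.Curve}

theorem Parallel.symm (h : R.Parallel L L') : R.Parallel L' L :=
  let ⟨h1, h2, h3⟩ := h
  ⟨h2, h1, R.rel.symm h3⟩

theorem Parallel.trans (h : R.Parallel L L') (h' : R.Parallel L' L'') : R.Parallel L L'' :=
  let ⟨h1, _, h3⟩ := h
  let ⟨_, h2', h3'⟩ := h'
  ⟨h1, h2', R.rel.trans h3 h3'⟩

theorem parallel_refl (R : G.Parallelization) (h : G.IsRay L) : R.Parallel L L :=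
  ⟨h, h, R.rel.refl _⟩

/-- A tail of the edge lies in L as well as in the edge and is itself a ray, so it is parallel to
both. -/
theorem parallel_range_pt (R : G.Parallelization) (hL : G.IsRay L) {e : E} (he : G.len e = ⊤)
    (h : G.pt e ⊤ ∈ L) : R.Parallel L (range (G.pt e)) := by
  have hL' := hL
  obtain ⟨p, hp, rfl⟩ := hL
  obtain ⟨htop, c, T, hT0, hT⟩ := hp.exists_shift he h
  have hM : G.IsRay (range fun t => G.pt e ((T + c).toNNReal + t)) := ⟨_, isRayChart_pt he _, rfl⟩
  have h1 := R.rel_of_subset ⟨_, hM⟩ ⟨_, hL'⟩ (by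
    rintro _ ⟨t, rfl⟩
    by_cases ht : t = ⊤
    · rw [ht]
      exact ⟨⊤, by simp only [htop, add_top]⟩
    · refine ⟨ENNReal.ofReal (T + t.toReal), ?_⟩
      have h0 : 0 ≤ t.toReal := ENNReal.toReal_nonneg
      rw [(hT _ (by linarith)).2]
      show _ = G.pt e (ENNReal.ofReal (T + c) + t)
      rw [← ENNReal.ofReal_toReal ht, ← ENNReal.ofReal_add (hT T le_rfl).1 ENNReal.toReal_nonneg,
        ENNReal.toReal_ofReal h0]
      congr 2
      ring)
  have h2 := R.rel_of_subset ⟨_, hM⟩ ⟨_, isRay_range_pt he⟩ (by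
    rintro _ ⟨t, rfl⟩
    exact mem_range_self _)
  exact ⟨hL', isRay_range_pt he, R.rel.trans (R.rel.symm h1) h2⟩

/-- Membership in `Rat(Γ_par)` in terms of the edges of infinite length. -/
theorem mem_ratPar_iff {f : G.Rat G.whole} : f ∈ R.ratPar ↔ f = 0 ∨ ∀ e e', G.len e = ⊤ →
    G.len e' = ⊤ → R.Parallel (range (G.pt e)) (range (G.pt e')) →
      ∃ m, (∃ a, HasEndSlope f.val e a m) ∧ ∃ a, HasEndSlope f.val e' a m := by
  refine or_congr ⟨fun h => Rat.ext' (funext h), fun h x => by rw [h]; rfl⟩ ⟨fun h e e' he he' hee => ?_,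
    fun h L L' hLL => ?_⟩
  · obtain ⟨m, h1, h2⟩ := h _ _ hee
    exact ⟨m, (hasSlopeAtInfinity_iff (isRay_range_pt he) he (mem_range_self _)).1 h1,
      (hasSlopeAtInfinity_iff (isRay_range_pt he') he' (mem_range_self _)).1 h2⟩
  · obtain ⟨hL, hL', -⟩ := id hLL
    have hend : ∀ L, G.IsRay L → ∃ e, G.len e = ⊤ ∧ G.pt e ⊤ ∈ L := by
      rintro _ ⟨p, hp, rfl⟩
      obtain ⟨e, he, h1, -⟩ := hp.exists_edge
      exact ⟨e, he, h1 ▸ mem_range_self _⟩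
    obtain ⟨e, he, h1⟩ := hend L hL
    obtain ⟨e', he', h1'⟩ := hend L' hL'
    obtain ⟨m, h2, h3⟩ := h e e' he he'
      ((R.parallel_range_pt hL he h1).symm.trans (hLL.trans (R.parallel_range_pt hL' he' h1')))
    exact ⟨m, (hasSlopeAtInfinity_iff hL he h1).2 h2, (hasSlopeAtInfinity_iff hL' he' h1').2 h3⟩

/-- Real values at infinity force all end slopes to be 0, and the parallelism relation imposes
nothing more. -/
theorem mem_ratPar_of_real {f : G.Rat G.whole} (h : ∀ x, f.val x ≠ ⊥ ∧ f.val x ≠ ⊤) :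
    f ∈ R.ratPar := by
  refine mem_ratPar_iff.2 (Or.inr fun e e' he he' _ => ⟨0, ?_⟩)
  obtain ⟨x, -⟩ := G.exists_notMem_infPts
  have hf := Rat.ne_zero_of_val_ne (h x).1
  have key : ∀ e, G.len e = ⊤ → ∃ a, HasEndSlope f.val e a 0 := by
    intro e he
    obtain ⟨a, m, ham⟩ := Rat.exists_endSlope hf he
    obtain ⟨rfl, -⟩ := ham.eq_zero f.continuous_val (h _)
    exact ⟨a, ham⟩
  exact ⟨key e he, key e' he'⟩

theorem inv_mem_ratPar {f : G.Rat G.whole} (hf : f ∈ R.ratPar) : f⁻¹ ∈ R.ratPar := by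
  rw [mem_ratPar_iff] at hf ⊢
  rcases hf with rfl | hf
  · exact Or.inl inv_zero
  refine Or.inr fun e e' he he' h => ?_
  obtain ⟨m, ⟨a, ha⟩, b, hb⟩ := hf e e' he he' h
  exact ⟨-m, ⟨_, ha.inv⟩, _, hb.inv⟩

theorem algebraMap_mem_ratPar (R : G.Parallelization) (a : TropR) :
    algebraMap TropR (G.Rat G.whole) a ∈ R.ratPar := by
  induction a using TropR.cases' with
  | h₁ => exact Or.inl fun _ => rfl
  | h₂ a => exact mem_ratPar_of_real fun x => ⟨EReal.coe_ne_bot a, EReal.coe_ne_top a⟩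

/-- `Rat(Γ_par)` as a subalgebra. -/
noncomputable def ratParSubalgebra (R : G.Parallelization) : Subalgebra TropR (G.Rat G.whole) where
  carrier := R.ratPar
  algebraMap_mem' := R.algebraMap_mem_ratPar
  mul_mem' := by
    intro f g hf hg
    rw [mem_ratPar_iff] at hf hg ⊢
    rcases hf with rfl | hf
    · exact Or.inl (zero_mul _)
    rcases hg with rfl | hg
    · exact Or.inl (mul_zero _)
    refine Or.inr fun e e' he he' h => ?_
    obtain ⟨m, ⟨a, ha⟩, b, hb⟩ := hf e e' he he' h
    obtain ⟨n, ⟨a', ha'⟩, b', hb'⟩ := hg e e' he he' h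
    exact ⟨m + n, ⟨_, ha.mul ha'⟩, _, hb.mul hb'⟩
  add_mem' := by
    intro f g hf hg
    rw [mem_ratPar_iff] at hf hg ⊢
    rcases hf with rfl | hf
    · rw [zero_add]
      exact hg
    rcases hg with rfl | hg
    · rw [add_zero]
      exact Or.inr hf
    refine Or.inr fun e e' he he' h => ?_
    obtain ⟨m, ⟨a, ha⟩, b, hb⟩ := hf e e' he he' h
    obtain ⟨n, ⟨a', ha'⟩, b', hb'⟩ := hg e e' he he' h
    exact ⟨max m n, ha.exists_add ha', hb.exists_add hb'⟩

end Parallelization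

end TropModel

theorem mem_connectedComponentIn_of_mem_closure {X : Type*} [TopologicalSpace X] {F : Set X}
    {x y : X} (h : y ∈ closure (connectedComponentIn F x)) (hy : y ∈ F) :
    y ∈ connectedComponentIn F x := by
  have hx : x ∈ F := connectedComponentIn_nonempty_iff.1 (closure_nonempty_iff.1 ⟨y, h⟩)
  refine (IsPreconnected.subset_closure (t := insert y (connectedComponentIn F x))
    isPreconnected_connectedComponentIn (subset_insert _ _)
    (insert_subset h subset_closure)).subset_connectedComponentIn
    (mem_insert_of_mem _ (mem_connectedComponentIn hx))
    (insert_subset hy (connectedComponentIn_subset _ _)) (mem_insert _ _)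

namespace TropModel

variable {V E : Type*} {G : TropModel V E}

/-! ### Cores and their outer rays -/

/-- Γ is locally connected: a point is joined inside F to the beginnings of all its directions, and
a point at infinity to an end of its edge. -/
theorem isOpen_connectedComponentIn {F : Set G.Curve} (hF : IsOpen F) (x : G.Curve) :
    IsOpen (connectedComponentIn F x) := by
  refine isOpen_iff_eventually.2 fun y hy => ?_
  have hyF := connectedComponentIn_subset _ _ hy
  rw [connectedComponentIn_eq hy]
  by_cases hinf : y ∈ G.infPts
  · obtain ⟨e, he, rfl⟩ := mem_infPts_iff.1 hinf
    obtain ⟨T, hT⟩ := eventually_atTop.1 (tendsto_pt_top.eventually (hF.mem_nhds hyF))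
    refine eventually_nhds_pt_top he (p := fun z => z ∈ connectedComponentIn F (G.pt e ⊤))
      (mem_connectedComponentIn hyF) ?_
    filter_upwards [eventually_ge_atTop T] with t ht
    refine (isPreconnected_Ici.image _ (continuous_pt e).continuousOn).subset_connectedComponentIn
      (mem_image_of_mem _ (mem_Ici.2 (le_top : ENNReal.ofReal t ≤ ⊤))) ?_
      (mem_image_of_mem _ (mem_Ici.2 le_rfl))
    rintro _ ⟨w, hw, rfl⟩
    by_cases hw' : w = ⊤
    · rwa [hw']
    · rw [← ENNReal.ofReal_toReal hw']
      exact hT _ (ht.trans ((ENNReal.ofReal_le_iff_le_toReal hw').1 hw))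
  · refine eventually_nhds_of_dir hinf (p := fun z => z ∈ connectedComponentIn F y)
      (mem_connectedComponentIn hyF) fun d hd => ?_
    obtain ⟨δ, hδ, h⟩ := exists_pos_of_eventually
      (d.tendsto_path.eventually (hF.mem_nhds (hd.symm ▸ hyF)))
    refine eventually_of_pos hδ fun s h1 h2 => ?_
    refine ((isPreconnected_Icc (a := (0 : ℝ)) (b := s)).image _
      d.continuous_path.continuousOn).subset_connectedComponentIn
      ⟨0, left_mem_Icc.2 h1.le, d.path_zero.trans hd⟩ ?_ (mem_image_of_mem _ (right_mem_Icc.2 h1.le))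
    rintro _ ⟨u, hu, rfl⟩
    rcases eq_or_lt_of_le hu.1 with rfl | h3
    · rw [d.path_zero, hd]
      exact hyF
    · exact h u h3 (hu.2.trans_lt h2)

/-- The restriction of rational functions to the core. -/
noncomputable def Region.restriction (C : G.Region) : G.Rat G.whole →ₐ[TropR] G.Rat C where
  toFun f := ⟨fun x => f.val x.1, f.continuous_val.comp continuous_subtype_val,
    f.2.2.imp (fun h x => h _) fun h => ⟨fun x hx => h.1 ⟨x.1, mem_univ _⟩ hx, fun e =>
      let ⟨P, hP, hU, hI⟩ := h.2 e
      ⟨P, hP, hU, fun I hIP =>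
        let ⟨h1, a, m, ham⟩ := hI I hIP
        ⟨h1, a, m, fun t ht hl _ => ham t ht hl (mem_univ _)⟩⟩⟩⟩
  map_one' := rfl
  map_zero' := rfl
  map_add' _ _ := rfl
  map_mul' f g := Rat.ext_fin fun x hx => by
    rw [Rat.mul_apply _ _ hx]
    exact Rat.val_mul f g hx
  commutes' _ := rfl

theorem Region.restriction_apply (C : G.Region) (f : G.Rat G.whole) (x : C.carrier) :
    C.restriction f x = f.val x.1 := rfl

namespace Region.IsCore

variable {C : G.Region}

/-- The hypothesis only says that the closure of a component K is a ray. That the ray leaves the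
core exactly at its finite end follows from connectedness of K, of Γ, and from the absence of points
at infinity in the core. -/
theorem exists_chart (hC : C.IsCore) (L : C.outerRays) : ∃ p, G.IsRayChart p ∧ range p = L.1 ∧
    p 0 ∈ C.carrier ∧ (∀ t, 0 < t → p t ∉ C.carrier) ∧
      ∀ t, 0 < t → L.1 = closure (connectedComponentIn C.carrierᶜ (p t)) := by
  obtain ⟨p, hp, hpL⟩ := hC.isRay L.1 L.2
  obtain ⟨x, hx, hxL⟩ := L.2
  refine ⟨p, hp, hpL, ?_⟩
  set K := connectedComponentIn C.carrierᶜ x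
  have hKo : IsOpen K := isOpen_connectedComponentIn C.closed.isOpen_compl x
  have hxK : x ∈ K := mem_connectedComponentIn hx
  have hKp : closure K = range p := hxL.symm.trans hpL.symm
  have hK : ∀ t, p t ∉ C.carrier → p t ∈ K := fun t ht =>
    mem_connectedComponentIn_of_mem_closure (hKp ▸ mem_range_self t) ht
  have htop : p ⊤ ∈ K := hK ⊤ fun h => disjoint_left.1 hC.finite_points h hp.top_mem_infPts
  have hout : ∀ t, 0 < t → p t ∉ C.carrier := by
    intro t ht htC
    have hcl : ∀ S : Set ℝ≥0∞, IsClosed S → IsClosed (p '' S) := fun S hS =>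
      (hS.isCompact.image hp.1).isClosed
    -- Otherwise the closure of K would lie in the part of the ray from p t on and miss p 0.
    have hne : (K ∩ p '' Iic t).Nonempty := by
      by_contra hemp
      have h1 : K ⊆ p '' Ici t := by
        intro y hy
        obtain ⟨s, rfl⟩ : y ∈ range p := hKp ▸ subset_closure hy
        rcases le_total s t with h | h
        · exact absurd ⟨p s, hy, s, h, rfl⟩ hemp
        · exact ⟨s, h, rfl⟩
      have h2 := closure_minimal h1 (hcl _ isClosed_Ici)
      rw [hKp] at h2
      obtain ⟨s, hs, h3⟩ := h2 (mem_range_self 0)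
      rw [hp.injective h3] at hs
      exact absurd ht (not_lt.2 hs)
    have hcov : K ⊆ p '' Iic t ∪ p '' Ici t := by
      intro y hy
      obtain ⟨s, rfl⟩ : y ∈ range p := hKp ▸ subset_closure hy
      exact (le_total s t).imp (fun h => ⟨s, h, rfl⟩) fun h => ⟨s, h, rfl⟩
    -- The two closed parts of the ray meet only at p t, so the connected set K would have to
    -- contain p t, a point of the core.
    obtain ⟨_, hy, ⟨a, ha, rfl⟩, b, hb, hab⟩ := isPreconnected_closed_iff.1
      (isPreconnected_connectedComponentIn (F := C.carrierᶜ) (x := x)) _ _ (hcl _ isClosed_Iic)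
      (hcl _ isClosed_Ici) hcov hne ⟨p ⊤, htop, ⊤, mem_Ici.2 le_top, rfl⟩
    rw [hp.injective hab] at hb
    rw [le_antisymm (mem_Iic.1 ha) (mem_Ici.1 hb)] at hy
    exact connectedComponentIn_subset _ _ hy htC
  refine ⟨?_, hout, fun t ht => ?_⟩
  -- If p 0 were outside the core, K would be the whole ray, hence closed as well as open, and would
  -- exhaust the connected space Γ.
  · by_contra h0
    have h1 : range p ⊆ K := by
      rintro _ ⟨t, rfl⟩
      rcases eq_or_lt_of_le (zero_le : 0 ≤ t) with rfl | ht
      · exact hK 0 h0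
      · exact hK t (hout t ht)
    have h2 : IsClopen K := ⟨closure_subset_iff_isClosed.1 (hKp.le.trans h1), hKo⟩
    obtain ⟨c, hc⟩ := C.nonempty
    have h3 := h2.eq_univ ⟨x, hxK⟩
    exact connectedComponentIn_subset _ _ (h3 ▸ mem_univ c : c ∈ K) hc
  · exact hxL.trans (congrArg closure (connectedComponentIn_eq (hK t (hout t ht))))

/-- A parametrization of an outer ray of a core, starting at the core. -/
noncomputable def chart (hC : C.IsCore) (L : C.outerRays) : ℝ≥0∞ → G.Curve :=
  (hC.exists_chart L).choose

section chart

variable (hC : C.IsCore)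

theorem isRayChart_chart (L : C.outerRays) : G.IsRayChart (hC.chart L) :=
  (hC.exists_chart L).choose_spec.1

theorem range_chart (L : C.outerRays) : range (hC.chart L) = L.1 :=
  (hC.exists_chart L).choose_spec.2.1

theorem chart_zero_mem (L : C.outerRays) : hC.chart L 0 ∈ C.carrier :=
  (hC.exists_chart L).choose_spec.2.2.1

theorem chart_notMem (L : C.outerRays) {t : ℝ≥0∞} (ht : 0 < t) : hC.chart L t ∉ C.carrier :=
  (hC.exists_chart L).choose_spec.2.2.2.1 t ht

theorem eq_closure_component (L : C.outerRays) {t : ℝ≥0∞} (ht : 0 < t) :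
    L.1 = closure (connectedComponentIn C.carrierᶜ (hC.chart L t)) :=
  (hC.exists_chart L).choose_spec.2.2.2.2 t ht

/-- The outer ray without its boundary point. -/
def outer (L : C.outerRays) : Set G.Curve := hC.chart L '' Ioi 0

theorem isOpen_outer (L : C.outerRays) : IsOpen (hC.outer L) := (hC.isRayChart_chart L).2.2

theorem outer_subset (L : C.outerRays) : hC.outer L ⊆ L.1 := by
  rw [← hC.range_chart L]
  exact image_subset_range _ _

theorem notMem_of_mem_outer {L : C.outerRays} {x : G.Curve} (hx : x ∈ hC.outer L) :
    x ∉ C.carrier := by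
  obtain ⟨t, ht, rfl⟩ := hx
  exact hC.chart_notMem L ht

theorem eq_of_mem_outer {L L' : C.outerRays} {x : G.Curve} (hx : x ∈ hC.outer L)
    (hx' : x ∈ hC.outer L') : L = L' := by
  obtain ⟨t, ht, rfl⟩ := hx
  obtain ⟨t', ht', h⟩ := hx'
  refine Subtype.ext ?_
  rw [hC.eq_closure_component L ht, hC.eq_closure_component L' ht', h]

theorem chart_mem_outer {L L' : C.outerRays} {t : ℝ≥0∞} :
    hC.chart L t ∈ hC.outer L' ↔ 0 < t ∧ L = L' := by
  constructor
  · intro h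
    have ht : 0 < t := by
      refine pos_iff_ne_zero.2 ?_
      rintro rfl
      exact hC.notMem_of_mem_outer h (hC.chart_zero_mem L)
    exact ⟨ht, hC.eq_of_mem_outer ⟨t, ht, rfl⟩ h⟩
  · rintro ⟨ht, rfl⟩
    exact ⟨t, ht, rfl⟩

theorem mem_outer_or_eq {L : C.outerRays} {x : G.Curve} (hx : x ∈ L.1) :
    x ∈ hC.outer L ∨ x = hC.chart L 0 :=
  IsRayChart.mem_image_or_eq _ (hC.range_chart L ▸ hx)

theorem mem_iff {L : C.outerRays} {x : G.Curve} (hx : x ∉ C.carrier) :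
    x ∈ L.1 ↔ x ∈ hC.outer L :=
  ⟨fun h => (hC.mem_outer_or_eq h).resolve_right fun h => hx (h ▸ hC.chart_zero_mem L),
    fun h => hC.outer_subset L h⟩

theorem exists_mem_outer {x : G.Curve} (hx : x ∉ C.carrier) : ∃ L, x ∈ hC.outer L := by
  let L : C.outerRays := ⟨closure (connectedComponentIn C.carrierᶜ x), x, hx, rfl⟩
  exact ⟨L, (hC.mem_iff (L := L) hx).1 (subset_closure (mem_connectedComponentIn hx))⟩

theorem notMem_of_mem_infPts (hC : C.IsCore) {x : G.Curve} (hx : x ∈ G.infPts) : x ∉ C.carrier :=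
  fun h => disjoint_left.1 hC.finite_points h hx

theorem notMem_infPts (hC : C.IsCore) (x : C.carrier) : x.1 ∉ G.infPts := fun h =>
  hC.notMem_of_mem_infPts h x.2

/-- Different outer rays are disjoint away from the core, so their points at infinity differ, and
these belong to the finitely many edges. -/
theorem finite_outerRays (hC : C.IsCore) : C.outerRays.Finite := by
  have := G.finite_edges
  have hend : ∀ L, ∃ e, hC.chart L ⊤ = G.pt e ⊤ := fun L =>
    let ⟨e, _, h, _⟩ := (hC.isRayChart_chart L).exists_edge
    ⟨e, h⟩
  choose e h using hend
  have : Finite C.outerRays := Finite.of_injective e fun L L' hLL => by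
    have h1 : hC.chart L ⊤ ∈ hC.outer L' := by
      rw [h, hLL, ← h]
      exact hC.chart_mem_outer.2 ⟨ENNReal.zero_lt_top, rfl⟩
    exact (hC.chart_mem_outer.1 h1).2
  exact Set.toFinite _

theorem finite_frontier_biUnion (s : Set C.outerRays) :
    (frontier (⋃ L ∈ s, hC.outer L)).Finite := by
  have : Finite C.outerRays := hC.finite_outerRays
  refine (finite_range fun L => hC.chart L 0).subset ?_
  rw [(isOpen_biUnion fun L _ => hC.isOpen_outer L).frontier_eq, s.toFinite.closure_biUnion]
  rintro x ⟨h1, h2⟩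
  obtain ⟨L, hL, hx⟩ := mem_iUnion₂.1 h1
  rw [outer, (hC.isRayChart_chart L).closure_image, hC.range_chart] at hx
  refine ⟨L, ((hC.mem_outer_or_eq hx).resolve_left fun h => h2 (mem_biUnion hL h)).symm⟩

theorem finite_frontier_outer (L : C.outerRays) : (frontier (hC.outer L)).Finite :=
  (finite_singleton _).subset (hC.isRayChart_chart L).frontier_image

/-- A direction goes along the core, or along an outer ray. -/
theorem dir_cases (d : G.Dir) : (∀ᶠ s in 𝓝[>] (0 : ℝ), d.path s ∈ C.carrier) ∨
    ∃ L, ∀ᶠ s in 𝓝[>] (0 : ℝ), d.path s ∈ hC.outer L := by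
  have : Finite C.outerRays := hC.finite_outerRays
  by_cases h : ∃ L, ∀ᶠ s in 𝓝[>] (0 : ℝ), d.path s ∈ hC.outer L
  · exact Or.inr h
  left
  have h1 : ∀ L, ∀ᶠ s in 𝓝[>] (0 : ℝ), d.path s ∉ hC.outer L := fun L =>
    (d.eventually_mem_or (hC.finite_frontier_outer L)).resolve_left fun h' => h ⟨L, h'⟩
  filter_upwards [eventually_all.2 h1] with s hs
  by_contra hc
  obtain ⟨L, hL⟩ := hC.exists_mem_outer hc
  exact hs L hL

theorem base_mem_of_eventually {d : G.Dir}
    (h : ∀ᶠ s in 𝓝[>] (0 : ℝ), d.path s ∈ C.carrier) : d.base ∈ C.carrier :=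
  C.closed.mem_of_tendsto d.tendsto_path h

theorem base_mem_of_eventually_outer {L : C.outerRays} {d : G.Dir}
    (h : ∀ᶠ s in 𝓝[>] (0 : ℝ), d.path s ∈ hC.outer L) : d.base ∈ L.1 := by
  rw [← hC.range_chart L]
  refine (hC.isRayChart_chart L).isClosed_range.mem_of_tendsto d.tendsto_path
    (h.mono fun s hs => ?_)
  rw [hC.range_chart]
  exact hC.outer_subset L hs

theorem exists_end_mem (hC : C.IsCore) {e : E} (he : G.len e = ⊤) : ∃ L, G.pt e ⊤ ∈ hC.outer L ∧
    ∀ᶠ t : ℝ in atTop, G.pt e (ENNReal.ofReal t) ∈ hC.outer L := by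
  obtain ⟨L, hL⟩ := hC.exists_mem_outer (hC.notMem_of_mem_infPts (pt_top_mem_infPts he))
  exact ⟨L, hL, tendsto_pt_top.eventually ((hC.isOpen_outer L).mem_nhds hL)⟩

end chart

/-! ### The contraction to a core -/

open Classical in
/-- The map to the core that contracts the outer rays to their boundary points. -/
noncomputable def contraction (hC : C.IsCore) (x : G.Curve) : C.carrier :=
  if h : x ∈ C.carrier then ⟨x, h⟩
  else ⟨hC.chart (hC.exists_mem_outer h).choose 0, hC.chart_zero_mem _⟩

theorem contraction_of_mem (hC : C.IsCore) {x : G.Curve} (hx : x ∈ C.carrier) :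
    hC.contraction x = ⟨x, hx⟩ := dif_pos hx

theorem contraction_chart (hC : C.IsCore) (L : C.outerRays) (t : ℝ≥0∞) :
    hC.contraction (hC.chart L t) = ⟨hC.chart L 0, hC.chart_zero_mem L⟩ := by
  rcases eq_or_lt_of_le (zero_le : 0 ≤ t) with rfl | ht
  · exact hC.contraction_of_mem _
  · have h := hC.exists_mem_outer (hC.chart_notMem L ht)
    have h1 : hC.contraction (hC.chart L t) = ⟨hC.chart h.choose 0, hC.chart_zero_mem _⟩ :=
      dif_neg (hC.chart_notMem L ht)
    rw [h1]
    have h2 := (hC.chart_mem_outer.1 h.choose_spec).2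
    simp only [← h2]

theorem contraction_of_mem_ray (hC : C.IsCore) {L : C.outerRays} {x : G.Curve} (hx : x ∈ L.1) :
    hC.contraction x = ⟨hC.chart L 0, hC.chart_zero_mem L⟩ := by
  rw [← hC.range_chart L] at hx
  obtain ⟨t, rfl⟩ := hx
  exact hC.contraction_chart L t

theorem isContraction_contraction (hC : C.IsCore) : C.IsContraction hC.contraction := by
  refine ⟨fun x => hC.contraction_of_mem x.2, fun L hL x hx => ?_⟩
  rw [hC.contraction_of_mem_ray (L := ⟨L, hL⟩) hx]
  show hC.chart ⟨L, hL⟩ 0 ∈ (⟨L, hL⟩ : C.outerRays).1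
  rw [← hC.range_chart]
  exact mem_range_self _

theorem continuous_contraction (hC : C.IsCore) : Continuous hC.contraction := by
  refine continuous_of_dir (fun d => ?_) fun e he => ?_
  · rcases hC.dir_cases d with h | ⟨L, h⟩
    · rw [tendsto_subtype_rng, hC.contraction_of_mem (base_mem_of_eventually h)]
      refine d.tendsto_path.congr' (h.mono fun s hs => ?_)
      simp only [hC.contraction_of_mem hs]
    · rw [hC.contraction_of_mem_ray (hC.base_mem_of_eventually_outer h)]
      refine tendsto_const_nhds.congr' (h.mono fun s hs => ?_)
      simp only [hC.contraction_of_mem_ray (hC.outer_subset L hs)]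
  · obtain ⟨L, h1, h2⟩ := hC.exists_end_mem he
    rw [hC.contraction_of_mem_ray (hC.outer_subset L h1)]
    refine tendsto_const_nhds.congr' (h2.mono fun s hs => ?_)
    simp only [hC.contraction_of_mem_ray (hC.outer_subset L hs)]

/-- Every direction runs along the core, where the slopes are those of f, or along an outer ray,
where the function is constant. Its values are real even at infinity because the core has no points
at infinity. -/
theorem isRational_comp_contraction (hC : C.IsCore) (f : G.Rat C) :
    G.IsRational G.whole.carrier fun x => f (hC.contraction x.1) := by
  refine ⟨f.2.1.comp (hC.continuous_contraction.comp continuous_subtype_val), ?_⟩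
  rcases f.2.2 with h | ⟨h1, h2⟩
  · exact Or.inl fun x => h _
  have hreal : ∀ x, f x ≠ ⊥ ∧ f x ≠ ⊤ := fun x => h1 x (hC.notMem_infPts x)
  have hconst : ∀ x : C.carrier, ∃ a : ℝ, f x = a := fun x => by
    lift f x to ℝ using ⟨(hreal x).2, (hreal x).1⟩ with a
    exact ⟨a, rfl⟩
  refine Or.inr ⟨fun x _ => hreal _,
    piecewiseAffine_of_slopes (F := fun x => f (hC.contraction x)) (fun x _ => hreal _)
      (fun d => ?_) fun e he => ?_⟩
  · rcases hC.dir_cases d with h | ⟨L, h⟩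
    · obtain ⟨a, m, ham⟩ := h2.exists_slope d
      refine ⟨a, m, ?_⟩
      filter_upwards [h, ham] with s hs hs'
      rw [hC.contraction_of_mem hs]
      exact hs' hs
    · obtain ⟨a, ha⟩ := hconst ⟨hC.chart L 0, hC.chart_zero_mem L⟩
      refine ⟨a, 0, h.mono fun s hs => ?_⟩
      show f _ = _
      rw [hC.contraction_of_mem_ray (hC.outer_subset L hs), ha]
      simp
  · obtain ⟨L, -, h⟩ := hC.exists_end_mem he
    obtain ⟨a, ha⟩ := hconst ⟨hC.chart L 0, hC.chart_zero_mem L⟩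
    refine ⟨a, 0, h.mono fun s hs => ?_⟩
    show f _ = _
    rw [hC.contraction_of_mem_ray (hC.outer_subset L hs), ha]
    simp

/-- The pull-back of rational functions along the contraction. -/
noncomputable def pullback (hC : C.IsCore) : G.Rat C →ₐ[TropR] G.Rat G.whole where
  toFun f := ⟨_, hC.isRational_comp_contraction f⟩
  map_one' := rfl
  map_zero' := rfl
  map_add' _ _ := rfl
  map_mul' f g := Rat.ext_fin fun x hx => by
    rw [Rat.mul_apply _ _ hx]
    exact Rat.mul_apply f g (hC.notMem_infPts _)
  commutes' _ := rfl

theorem pullback_val (hC : C.IsCore) (f : G.Rat C) (x : G.Curve) :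
    (hC.pullback f).val x = f (hC.contraction x) := rfl

theorem restriction_pullback (hC : C.IsCore) (f : G.Rat C) :
    C.restriction (hC.pullback f) = f := by
  refine Rat.ext_fin fun x _ => ?_
  rw [Region.restriction_apply, pullback_val, hC.contraction_of_mem x.2]

theorem pullback_restriction_val (hC : C.IsCore) (f : G.Rat G.whole) (x : G.Curve) :
    (hC.pullback (C.restriction f)).val x = f.val (hC.contraction x) := rfl

theorem pullback_real (hC : C.IsCore) {f : G.Rat C} (hf : f ≠ 0) (x : G.Curve) :
    (hC.pullback f).val x ≠ ⊥ ∧ (hC.pullback f).val x ≠ ⊤ :=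
  (f.2.2.resolve_left fun h => hf (Rat.ext' (funext h))).1 _ (hC.notMem_infPts _)

/-- A pulled-back function other than -∞ has no infinite values, so it is generated by the functions
`gen`. Applying restriction, a homomorphism that undoes the pull-back, gives generators on the core.
-/
theorem exists_finite_generators (hC : C.IsCore) :
    ∃ s : Set (G.Rat C), s.Finite ∧ 0 ∉ s ∧ semifieldAdjoin TropR s = ⊤ := by
  have := G.finite_edges
  refine ⟨C.restriction '' range G.gen, (finite_range _).image _, ?_, ?_⟩
  · rintro ⟨_, ⟨i, rfl⟩, h⟩
    obtain ⟨x, hx⟩ := C.nonempty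
    have h1 := congrArg (fun f : G.Rat C => f ⟨x, hx⟩) h
    exact (EReal.coe_ennreal_ne_bot _ : (G.gen i).val x ≠ ⊥) h1
  · refine eq_top_iff.2 fun f _ => ?_
    by_cases hf : f = 0
    · rw [hf]
      exact zero_mem _
    rw [← hC.restriction_pullback f]
    exact map_mem_of_mem_semifieldAdjoin C.restriction (subset_semifieldAdjoin _)
      (fun _ => inv_mem_semifieldAdjoin) (mem_semifieldAdjoin_range_gen (hC.pullback_real hf))

end Region.IsCore

/-! ### Existence of a core -/

open Classical in
/-- The map that contracts the edges of infinite length. -/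
noncomputable def shrink (G : TropModel V E) : G.Curve → G.Curve :=
  G.glue (fun v => if h : ∃ e, G.len e = ⊤ ∧ G.tgt e = v then G.vertex (G.src h.choose)
      else G.vertex v)
    (fun e t => if G.len e = ⊤ then G.vertex (G.src e) else G.pt e t)
    (fun e => by
      rw [dif_neg]
      · rw [pt_zero, ite_self]
      · rintro ⟨e', he', h⟩
        exact G.leaf_src e' he' e h.symm)
    (fun e => by
      by_cases he : G.len e = ⊤
      · have h : ∃ e', G.len e' = ⊤ ∧ G.tgt e' = G.tgt e := ⟨e, he, rfl⟩
        rw [if_pos he, dif_pos h, ← G.leaf_tgt _ h.choose_spec.1 e h.choose_spec.2.symm]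
      · rw [if_neg he, pt_len, dif_neg]
        rintro ⟨e', he', h⟩
        exact he (by rw [G.leaf_tgt e' he' e h.symm, he']))

theorem continuous_shrink (G : TropModel V E) : Continuous G.shrink := by
  refine continuous_of_edges fun e => ?_
  by_cases he : G.len e = ⊤
  · exact continuousOn_const.congr fun t ht => by rw [shrink, glue_pt ht, if_pos he]
  · exact (continuous_pt e).continuousOn.congr fun t ht => by rw [shrink, glue_pt ht, if_neg he]

/-- The union of the inner points of the edges of infinite length and of the points at infinity. -/
def tails (G : TropModel V E) : Set G.Curve := {x | ∃ e he, x ∈ G.tail e he 0}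

theorem isOpen_tails (G : TropModel V E) : IsOpen G.tails := by
  have : G.tails = ⋃ (e) (he), G.tail e he 0 := by
    ext x
    simp [tails]
  rw [this]
  exact isOpen_iUnion fun e => isOpen_iUnion fun he => G.isOpen_tail e he 0

theorem vertex_notMem_tails {v : V} (hv : ∀ e, G.len e = ⊤ → G.tgt e ≠ v) :
    G.vertex v ∉ G.tails := by
  rintro ⟨e, he, h⟩
  exact hv e he (Eq.symm h)

theorem pt_notMem_tails {e : E} (he : G.len e ≠ ⊤) {t : ℝ≥0∞} (ht : t ≤ G.len e) :
    G.pt e t ∉ G.tails := by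
  rintro ⟨e', he', h⟩
  rw [pt_of_le ht] at h
  have h1 : e = e' := h.1
  exact he (h1 ▸ he')

theorem shrink_notMem_tails (x : G.Curve) : G.shrink x ∉ G.tails := by
  have hsrc : ∀ e, G.vertex (G.src e) ∉ G.tails := fun e =>
    vertex_notMem_tails fun e' he' h => G.leaf_src e' he' e h.symm
  rcases vertex_or_pt x with ⟨v, rfl⟩ | ⟨e, t, ht, rfl⟩
  · rw [shrink, glue_vertex]
    split_ifs with h
    · exact hsrc _
    · exact vertex_notMem_tails fun e he h' => h ⟨e, he, h'⟩
  · rw [shrink, glue_pt ht]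
    split_ifs with he
    · exact hsrc _
    · exact pt_notMem_tails he ht

theorem shrink_of_notMem_tails {x : G.Curve} (hx : x ∉ G.tails) : G.shrink x = x := by
  rcases vertex_or_pt x with ⟨v, rfl⟩ | ⟨e, t, ht, rfl⟩
  · rw [shrink, glue_vertex, dif_neg]
    rintro ⟨e, he, rfl⟩
    exact hx ⟨e, he, rfl⟩
  · rw [shrink, glue_pt ht]
    split_ifs with he
    · rcases eq_or_lt_of_le (zero_le : 0 ≤ t) with rfl | h
      · rw [pt_zero]
      · exact absurd ⟨e, he, pt_mem_tail he h⟩ hx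
    · rfl

theorem range_shrink (G : TropModel V E) : range G.shrink = G.tailsᶜ := by
  refine Subset.antisymm ?_ fun x hx => ⟨x, shrink_of_notMem_tails hx⟩
  rintro _ ⟨x, rfl⟩
  exact shrink_notMem_tails x

theorem disjoint_tails_compl_infPts (G : TropModel V E) : Disjoint G.tailsᶜ G.infPts := by
  refine disjoint_left.2 fun x hx hinf => hx ?_
  obtain ⟨e, he, rfl⟩ := mem_infPts_iff.1 hinf
  exact ⟨e, he, pt_mem_tail he ENNReal.coe_lt_top⟩

/-- The curve without its edges of infinite length. -/
def finitePart (G : TropModel V E) : G.Region where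
  carrier := G.tailsᶜ
  nonempty := by
    rw [← range_shrink]
    exact range_nonempty _
  closed := G.isOpen_tails.isClosed_compl
  mem_closure x hx := subset_closure ⟨hx, fun h => disjoint_left.1 G.disjoint_tails_compl_infPts hx h⟩

/-- Connectedness comes from the retraction `shrink`. The components of the complement are the open
infinite edges with their points at infinity, whose closures are rays. -/
theorem isCore_finitePart (G : TropModel V E) : G.finitePart.IsCore where
  connected := by
    show IsConnected G.tailsᶜ
    rw [← range_shrink]
    exact isConnected_range G.continuous_shrink
  finite_points := G.disjoint_tails_compl_infPts
  isRay := by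
    rintro L ⟨x, hx, rfl⟩
    have hc : G.finitePart.carrierᶜ = G.tails := compl_compl _
    rw [hc] at hx ⊢
    obtain ⟨e, he, hxe⟩ := id hx
    have htail : G.tail e he 0 = G.pt e '' Ioi 0 := G.tail_eq he 0
    have h1 : connectedComponentIn G.tails x = G.tail e he 0 := by
      refine Subset.antisymm ?_ ?_
      -- The remaining tails form an open set disjoint from this one, so a connected set that meets
      -- this tail stays inside it.
      · let U := ⋃ (e') (_ : e' ≠ e) (he'), G.tail e' he' 0
        have hU : IsOpen U := isOpen_iUnion fun e' => isOpen_iUnion fun _ => isOpen_iUnion fun he' =>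
          G.isOpen_tail e' he' 0
        refine isPreconnected_connectedComponentIn.subset_left_of_subset_union
          (G.isOpen_tail e he 0) hU ?_ ?_ ⟨x, mem_connectedComponentIn hx, hxe⟩
        · refine disjoint_left.2 fun y hy hyU => ?_
          simp only [U, mem_iUnion] at hyU
          obtain ⟨e', hne, he', hy'⟩ := hyU
          rw [tail_eq] at hy hy'
          obtain ⟨s, hs, rfl⟩ := hy
          obtain ⟨t, ht, h⟩ := hy'
          by_cases hs' : s = ⊤
          · subst hs'
            have h2 := (pt_mem_infPts_iff (t := t) (le_of_le_of_eq le_top he'.symm)).1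
              (h ▸ pt_top_mem_infPts he)
            exact hne (pt_top_injective he' he (h2 ▸ h))
          · exact hne (pt_eq_pt (by simpa using hs) (he ▸ lt_top_iff_ne_top.2 hs')
              (le_of_le_of_eq le_top he'.symm) h.symm).1.symm
        · intro y hy
          obtain ⟨e', he', hy'⟩ := connectedComponentIn_subset _ _ hy
          by_cases hee : e' = e
          · subst hee
            exact Or.inl hy'
          · exact Or.inr (mem_iUnion.2 ⟨e', mem_iUnion.2 ⟨hee, mem_iUnion.2 ⟨he', hy'⟩⟩⟩)
      · refine IsPreconnected.subset_connectedComponentIn ?_ hxe fun y hy => ⟨e, he, hy⟩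
        rw [htail]
        exact isPreconnected_Ioi.image _ (continuous_pt e).continuousOn
    rw [h1, htail]
    have h2 := isRayChart_pt he 0
    simp only [ENNReal.coe_zero, zero_add] at h2
    exact ⟨_, h2, h2.closure_image.symm⟩

/-! ### Slopes of chip firing moves -/

section slopes

variable {f : G.Rat G.whole} {d : G.Dir} {a : ℝ} {m : ℤ}

theorem HasSlope.ne_zero_of_ne (h : HasSlope f.val d a m)
    (hne : ∀ᶠ s in 𝓝[>] (0 : ℝ), f.val (d.path s) ≠ f.val d.base) : m ≠ 0 := by
  rintro rfl
  obtain ⟨s, h1, h2⟩ := (Eventually.and h hne).exists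
  exact h2 (by rw [h1, h.eq_base f.continuous_val]; simp)

theorem HasSlope.abs_le_one_of_chipFiring {A : Set G.Curve} {l : ℝ≥0∞}
    (hf : ∀ x, f.val x = G.chipFiring A l x) (hA : ∃ a ∈ A, a ∉ G.infPts)
    (h : HasSlope f.val d a m) : |m| ≤ 1 := by
  let Φ : G.Curve → ℝ≥0∞ := fun x => min (G.setDist A x) l
  have hΦ : G.EdgeLip Φ := by
    intro e s t hs ht
    simp only [Φ]
    rw [← min_add_add_right]
    exact min_le_min (edgeLip_setDist A e s t hs ht) le_self_add
  have hfin : ∀ x, x ∉ G.infPts → Φ x ≠ ⊤ := fun x hx =>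
    ne_top_of_le_ne_top (setDist_ne_top hA hx) (min_le_left _ _)
  have hfΦ : ∀ x, x ∉ G.infPts → f.val x = ((-(Φ x).toReal : ℝ) : EReal) := by
    intro x hx
    rw [hf, chipFiring_eq, EReal.coe_neg, EReal.coe_ennreal_toReal (hfin x hx)]
  have hbase := h.eq_base f.continuous_val
  rw [hfΦ _ d.base_notMem_infPts, EReal.coe_eq_coe_iff] at hbase
  obtain ⟨s, h1, h2, h3⟩ := (Eventually.and h ((hΦ.eventually_abs_le hfin d).and
    self_mem_nhdsWithin)).exists
  have h3 : 0 < s := h3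
  rw [hfΦ _ (d.path_notMem_infPts s), EReal.coe_eq_coe_iff] at h1
  have h4 : (Φ (d.path s)).toReal - (Φ d.base).toReal = -(m * s) := by linarith
  rw [h4, abs_neg, abs_mul, abs_of_pos h3] at h2
  have h5 : |(m : ℝ)| ≤ 1 := le_of_mul_le_mul_right (by linarith) h3
  exact_mod_cast h5

theorem HasSlope.eq_one_or_of_chipFiring {A : Set G.Curve} {l : ℝ≥0∞}
    (hf : ∀ x, f.val x = G.chipFiring A l x) (hA : ∃ a ∈ A, a ∉ G.infPts)
    (h : HasSlope f.val d a m)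
    (hne : ∀ᶠ s in 𝓝[>] (0 : ℝ), f.val (d.path s) ≠ f.val d.base) : m = 1 ∨ m = -1 := by
  have h1 := h.ne_zero_of_ne hne
  have h2 := abs_le.1 (h.abs_le_one_of_chipFiring hf hA)
  omega

/-- Out of the set `A`, the slope of a chip firing move is `-1`. -/
theorem HasSlope.eq_neg_one_of_chipFiring {A : Set G.Curve} {l : ℝ≥0∞}
    (hf : ∀ x, f.val x = G.chipFiring A l x) (hd : d.base ∈ A) (h : HasSlope f.val d a m)
    (hne : ∀ᶠ s in 𝓝[>] (0 : ℝ), f.val (d.path s) ≠ 0) : a = 0 ∧ m = -1 := by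
  have h0 : f.val d.base = 0 := by
    rw [hf, chipFiring_eq, setDist_of_mem hd]
    simp
  have ha : a = 0 := by
    have h1 := h.eq_base f.continuous_val
    rw [h0] at h1
    exact_mod_cast h1.symm
  refine ⟨ha, ?_⟩
  refine (h.eq_one_or_of_chipFiring hf ⟨_, hd, d.base_notMem_infPts⟩ (by rwa [h0])).resolve_left ?_
  rintro rfl
  obtain ⟨s, h1, h2⟩ := (Eventually.and h self_mem_nhdsWithin).exists
  have h2 : 0 < s := h2
  have h3 : f.val (d.path s) ≤ 0 := by
    rw [hf, chipFiring_eq, EReal.neg_le, neg_zero]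
    exact EReal.coe_ennreal_nonneg _
  rw [h1, ha] at h3
  have h4 : (0 + ((1 : ℤ) : ℝ) * s) ≤ 0 := by exact_mod_cast h3
  push_cast at h4
  linarith

theorem HasEndSlope.exists_zpow {e : E} (h : HasEndSlope f.val e a m) (n : ℤ) :
    ∃ b, HasEndSlope (f ^ n).val e b (n * m) := by
  have hpow : ∀ k : ℕ, ∃ b, HasEndSlope (f ^ k).val e b (k * m) := by
    intro k
    induction k with
    | zero =>
      refine ⟨0, ?_⟩
      have h1 := hasEndSlope_algebraMap (G := G) e 0
      have h2 : algebraMap TropR (G.Rat G.whole) (TropR.ofReal 0) = f ^ 0 := by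
        rw [pow_zero, ← TropR.one_def, map_one]
      rw [h2] at h1
      simpa only [Nat.cast_zero, zero_mul] using h1
    | succ k ih =>
      obtain ⟨b, hb⟩ := ih
      refine ⟨b + a, ?_⟩
      have h1 := hb.mul h
      rw [← pow_succ] at h1
      convert h1 using 1
      push_cast
      ring
  obtain ⟨k, rfl | rfl⟩ := n.eq_nat_or_neg
  · obtain ⟨b, hb⟩ := hpow k
    exact ⟨b, by rwa [zpow_natCast]⟩
  · obtain ⟨b, hb⟩ := hpow k
    refine ⟨-b, ?_⟩
    rw [zpow_neg, zpow_natCast, neg_mul]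
    exact hb.inv

end slopes

theorem zpow_mem_of_inv_mem {A : Subalgebra TropR (G.Rat G.whole)} (hA : ∀ f ∈ A, f⁻¹ ∈ A)
    {f : G.Rat G.whole} (hf : f ∈ A) (n : ℤ) : f ^ n ∈ A := by
  obtain ⟨k, rfl | rfl⟩ := n.eq_nat_or_neg
  · rw [zpow_natCast]
    exact A.pow_mem hf k
  · rw [zpow_neg, zpow_natCast]
    exact hA _ (A.pow_mem hf k)

/-! ### Generators of the rational functions on a curve with parallel rays -/

namespace Region.IsCore

variable {C : G.Region} (R : G.Parallelization)

/-- Taking the closure adds at most boundary points of outer rays, and these lie on the core anyway.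
In this form the set is visibly closed with finite frontier. -/
theorem awayFrom_eq (hC : C.IsCore) (L : C.outerRays) :
    R.awayFrom C L.1 = (⋃ L' ∈ {L' : C.outerRays | R.Parallel L.1 L'.1}, hC.outer L')ᶜ := by
  have hopen : IsOpen (⋃ L' ∈ {L' : C.outerRays | R.Parallel L.1 L'.1}, hC.outer L') :=
    isOpen_biUnion fun L' _ => hC.isOpen_outer L'
  refine Subset.antisymm (union_subset ?_ (closure_minimal ?_ hopen.isClosed_compl)) ?_
  · intro x hx hU
    obtain ⟨L', -, h⟩ := mem_iUnion₂.1 hU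
    exact hC.notMem_of_mem_outer h hx
  · refine compl_subset_compl.2 fun x hx => ?_
    obtain ⟨L', hL', h⟩ := mem_iUnion₂.1 hx
    exact ⟨L'.1, ⟨L'.2, hL'⟩, hC.outer_subset L' h⟩
  · intro x hx
    by_cases hxC : x ∈ C.carrier
    · exact Or.inl hxC
    refine Or.inr (subset_closure ?_)
    rintro ⟨L', ⟨hL', hpar⟩, hxL'⟩
    exact hx (mem_biUnion (x := (⟨L', hL'⟩ : C.outerRays)) hpar
      ((hC.mem_iff (L := ⟨L', hL'⟩) hxC).1 hxL'))

theorem exists_mem_awayFrom (hC : C.IsCore) (L : C.outerRays) : ∃ a ∈ R.awayFrom C L.1, a ∉ G.infPts :=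
  ⟨hC.chart L 0, Or.inl (hC.chart_zero_mem L), hC.notMem_infPts ⟨_, hC.chart_zero_mem L⟩⟩

theorem exists_mem_ray (hC : C.IsCore) (L : C.outerRays) : ∃ a ∈ L.1, a ∉ G.infPts :=
  ⟨hC.chart L 0, hC.range_chart L ▸ mem_range_self _, hC.notMem_infPts ⟨_, hC.chart_zero_mem L⟩⟩

theorem outer_subset_awayFrom (hC : C.IsCore) {L L' : C.outerRays} (h : ¬ R.Parallel L.1 L'.1) :
    hC.outer L' ⊆ R.awayFrom C L.1 := by
  intro x hx
  rw [hC.awayFrom_eq R]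
  intro hU
  obtain ⟨L'', h1, h2⟩ := mem_iUnion₂.1 hU
  rw [hC.eq_of_mem_outer hx h2] at h
  exact h h1

theorem exists_chipFiring_awayFrom (hC : C.IsCore) (L : C.outerRays) :
    ∃ f : G.Rat G.whole, ∀ x, f.val x = G.chipFiring (R.awayFrom C L.1) ⊤ x := by
  refine exists_rat_chipFiring ?_ ?_ (hC.exists_mem_awayFrom R L) ?_ ⊤
  · exact (C.closed).union isClosed_closure
  · rw [hC.awayFrom_eq R, frontier_compl]
    exact hC.finite_frontier_biUnion _
  · intro x hx hinf
    obtain ⟨L', hL'⟩ := hC.exists_mem_outer (hC.notMem_of_mem_infPts hinf)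
    refine mem_of_superset ((hC.isOpen_outer L').mem_nhds hL') (hC.outer_subset_awayFrom R fun h => ?_)
    rw [hC.awayFrom_eq R] at hx
    exact hx (mem_biUnion (x := L') h hL')

theorem exists_chipFiring_ray (hC : C.IsCore) (L : C.outerRays) (l : ℝ≥0∞) :
    ∃ f : G.Rat G.whole, ∀ x, f.val x = G.chipFiring L.1 l x := by
  have hp := hC.isRayChart_chart L
  have hr := hC.range_chart L
  refine exists_rat_chipFiring ?_ ?_ (hC.exists_mem_ray L) ?_ l
  · rw [← hr]
    exact hp.isClosed_range
  · rw [← hr]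
    exact (finite_singleton _).subset hp.frontier_range
  · intro x hx hinf
    refine mem_of_superset ((hC.isOpen_outer L).mem_nhds ?_) (hC.outer_subset L)
    exact (hC.mem_iff (hC.notMem_of_mem_infPts hinf)).1 hx

/-! ### Values and end slopes of the functions `g_L` -/

section values

variable {L : C.outerRays} {g : G.Rat G.whole} {R : G.Parallelization}

theorem val_chart (hC : C.IsCore) (hg : ∀ x, g.val x = G.chipFiring (R.awayFrom C L.1) ⊤ x) {L' : C.outerRays}
    (h : R.Parallel L.1 L'.1) (t : ℝ≥0∞) : g.val (hC.chart L' t) = -(t : EReal) := by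
  rw [hg, chipFiring_eq, min_eq_left le_top,
    (hC.isRayChart_chart L').setDist_apply (Or.inl (hC.chart_zero_mem L'))]
  intro t ht hmem
  rw [hC.awayFrom_eq R] at hmem
  exact hmem (mem_biUnion (x := L') h (hC.chart_mem_outer.2 ⟨ht, rfl⟩))

theorem val_chart_self (hC : C.IsCore) (hg : ∀ x, g.val x = G.chipFiring (R.awayFrom C L.1) ⊤ x) (t : ℝ≥0∞) :
    g.val (hC.chart L t) = -(t : EReal) :=
  hC.val_chart hg (R.parallel_refl (hC.isRay L.1 L.2)) t

theorem injOn_val (hC : C.IsCore) (hg : ∀ x, g.val x = G.chipFiring (R.awayFrom C L.1) ⊤ x) {x y : G.Curve}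
    (hx : x ∈ L.1) (hy : y ∈ L.1) (h : g.val x = g.val y) : x = y := by
  rw [← hC.range_chart L] at hx hy
  obtain ⟨s, rfl⟩ := hx
  obtain ⟨t, rfl⟩ := hy
  rw [hC.val_chart_self hg, hC.val_chart_self hg, neg_inj, EReal.coe_ennreal_eq_coe_ennreal_iff] at h
  rw [h]

-- The end of an infinite edge lies on an outer ray parallel to the edge. There the function is the
-- negative of the coordinate if that ray is parallel to L, and 0 otherwise.
open Classical in
theorem exists_endSlope_awayFrom (hC : C.IsCore) (hg : ∀ x, g.val x = G.chipFiring (R.awayFrom C L.1) ⊤ x) {e : E}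
    (he : G.len e = ⊤) :
    ∃ a, HasEndSlope g.val e a (if R.Parallel L.1 (range (G.pt e)) then -1 else 0) := by
  obtain ⟨L', h1, h2⟩ := hC.exists_end_mem he
  have h3 := R.parallel_range_pt (hC.isRay L'.1 L'.2) he (hC.outer_subset L' h1)
  split_ifs with h
  · have hpar : R.Parallel L.1 L'.1 := h.trans h3.symm
    obtain ⟨-, c, T, hT0, hT⟩ := (hC.isRayChart_chart L').exists_shift he
      (hC.range_chart L' ▸ hC.outer_subset L' h1)
    refine ⟨c, ?_⟩
    filter_upwards [eventually_ge_atTop (T + c)] with t ht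
    have h4 := (hT (t - c) (by linarith)).2
    rw [sub_add_cancel] at h4
    rw [← h4, hC.val_chart hg hpar, EReal.coe_ennreal_ofReal, max_eq_left (by linarith),
      ← EReal.coe_neg]
    congr 1
    push_cast
    ring
  · have hpar : ¬ R.Parallel L.1 L'.1 := fun h4 => h (h4.trans h3)
    refine ⟨0, h2.mono fun t ht => ?_⟩
    rw [hg, chipFiring_eq, setDist_of_mem (hC.outer_subset_awayFrom R hpar ht)]
    simp

theorem mem_ratPar_of_chipFiring_awayFrom (hC : C.IsCore)
    (hg : ∀ x, g.val x = G.chipFiring (R.awayFrom C L.1) ⊤ x) : g ∈ R.ratPar := by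
  refine Parallelization.mem_ratPar_iff.2 (Or.inr fun e e' he he' hee => ?_)
  obtain ⟨a, ha⟩ := hC.exists_endSlope_awayFrom hg he
  obtain ⟨b, hb⟩ := hC.exists_endSlope_awayFrom hg he'
  have h : R.Parallel L.1 (range (G.pt e)) ↔ R.Parallel L.1 (range (G.pt e')) :=
    ⟨fun h => h.trans hee, fun h => h.trans hee.symm⟩
  classical
  exact ⟨_, ⟨a, ha⟩, b, by rwa [if_congr h rfl rfl]⟩

end values

theorem mem_ratPar_of_chipFiring {R : G.Parallelization} {A : Set G.Curve} {l : ℝ≥0} {f : G.Rat G.whole}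
    (hf : ∀ x, f.val x = G.chipFiring A l x) : f ∈ R.ratPar := by
  refine Parallelization.mem_ratPar_of_real fun x => ?_
  rw [hf, chipFiring_eq, Ne, Ne, EReal.neg_eq_bot_iff, EReal.neg_eq_top_iff]
  exact ⟨by simp, EReal.coe_ennreal_ne_bot _⟩

theorem pullback_mem_ratPar (hC : C.IsCore) (f : G.Rat C) : hC.pullback f ∈ R.ratPar := by
  by_cases hf : f = 0
  · rw [hf, map_zero]
    exact Or.inl fun _ => rfl
  · exact Parallelization.mem_ratPar_of_real (hC.pullback_real hf)

/-! ### Separation of points and directions by the generators -/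

section generators

variable {R} {ε : ℝ≥0} {g h : C.outerRays → G.Rat G.whole} {B : Subalgebra TropR (G.Rat G.whole)}

/-- Pulled-back functions separate points with different contractions. Otherwise one of the points
is off the core, on an outer ray L: the injective function `g L` settles the case that the other is
on L too, and `h L`, which is 0 exactly on L, the case that it is not. -/
theorem exists_val_ne (hC : C.IsCore) (hε : 0 < ε) (hg : ∀ L x, (g L).val x = G.chipFiring (R.awayFrom C L.1) ⊤ x)
    (hh : ∀ L x, (h L).val x = G.chipFiring L.1 ε x) (hgB : ∀ L, g L ∈ B) (hhB : ∀ L, h L ∈ B)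
    (hψB : ∀ f, hC.pullback f ∈ B) {x y : G.Curve} (hxy : x ≠ y) :
    ∃ w ∈ B, w ≠ 0 ∧ w.val x ≠ w.val y := by
  by_cases hr : hC.contraction x = hC.contraction y
  swap
  · obtain ⟨i, hi⟩ := exists_gen_val_ne fun h => hr (Subtype.ext h)
    refine ⟨hC.pullback (C.restriction (G.gen i)), hψB _, Rat.ne_zero_of_val_ne (x := x) ?_, hi⟩
    exact EReal.coe_ennreal_ne_bot _
  wlog hx : x ∉ C.carrier generalizing x y
  · by_cases hy : y ∈ C.carrier
    · rw [not_not] at hx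
      rw [hC.contraction_of_mem hx, hC.contraction_of_mem hy, Subtype.mk_eq_mk] at hr
      exact absurd hr hxy
    · obtain ⟨w, h1, h2, h3⟩ := this hxy.symm hr.symm hy
      exact ⟨w, h1, h2, h3.symm⟩
  obtain ⟨L, hL⟩ := hC.exists_mem_outer hx
  have hxL := hC.outer_subset L hL
  have hfin := hC.notMem_infPts ⟨_, hC.chart_zero_mem L⟩
  by_cases hy : y ∈ L.1
  · refine ⟨g L, hgB L, ?_, fun h => hxy (hC.injOn_val (hg L) hxL hy h)⟩
    refine Rat.ne_zero_of_val_ne (x := hC.chart L 0) ?_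
    rw [hC.val_chart_self (hg L)]
    simp
  · have h0 : (h L).val x = 0 := by
      rw [hh, chipFiring_eq, setDist_of_mem hxL]
      simp
    refine ⟨h L, hhB L, Rat.ne_zero_of_val_ne (x := x) (by rw [h0]; exact EReal.zero_ne_bot), ?_⟩
    rw [h0, hh, chipFiring_eq, Ne, eq_comm, EReal.neg_eq_zero_iff, EReal.coe_ennreal_eq_zero]
    refine (lt_min (setDist_pos ?_ hy) (by exact_mod_cast hε)).ne'
    rw [← hC.range_chart L]
    exact (hC.isRayChart_chart L).isClosed_range

/-- There are three cases for d: along the core, where pulled-back functions suffice; at a point of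
an open outer ray, where `g L` has opposite slopes in the two directions; and into an outer ray from
its boundary point, where `g L` and `h L` are combined. -/
theorem exists_slope (hC : C.IsCore) (hε : 0 < ε) (hB : ∀ f ∈ B, f⁻¹ ∈ B)
    (hg : ∀ L x, (g L).val x = G.chipFiring (R.awayFrom C L.1) ⊤ x)
    (hh : ∀ L x, (h L).val x = G.chipFiring L.1 ε x) (hgB : ∀ L, g L ∈ B) (hhB : ∀ L, h L ∈ B)
    (hψB : ∀ f, hC.pullback f ∈ B) {d d' : G.Dir} (hd : d.base = d'.base) :
    ∃ w ∈ B, (∃ a, HasSlope w.val d a 1) ∧ (d ≠ d' → ∃ b, HasSlope w.val d' b 0) := by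
  have hg0 : ∀ L, g L ≠ 0 := fun L => Rat.ne_zero_of_val_ne (x := hC.chart L 0) <| by
    rw [hC.val_chart_self (hg L)]
    simp
  have hh0 : ∀ L x, x ∈ L.1 → (h L).val x = 0 := fun L x hx => by
    rw [hh, chipFiring_eq, setDist_of_mem hx]
    simp
  have hhne : ∀ L, h L ≠ 0 := fun L => Rat.ne_zero_of_val_ne (x := hC.chart L 0) <| by
    rw [hh0 L _ (hC.range_chart L ▸ mem_range_self _)]
    exact EReal.zero_ne_bot
  have hgne : ∀ {L : C.outerRays} {d : G.Dir}, (∀ᶠ s in 𝓝[>] (0 : ℝ), d.path s ∈ hC.outer L) →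
      ∀ᶠ s in 𝓝[>] (0 : ℝ), (g L).val (d.path s) ≠ (g L).val d.base := by
    intro L d h
    filter_upwards [h, d.eventually_path_ne_base] with s h1 h2 h3
    exact h2 (hC.injOn_val (hg L) (hC.outer_subset L h1) (hC.base_mem_of_eventually_outer h) h3)
  have hgne' : ∀ {L : C.outerRays} {d d' : G.Dir}, d ≠ d' →
      (∀ᶠ s in 𝓝[>] (0 : ℝ), d.path s ∈ hC.outer L) →
      (∀ᶠ s in 𝓝[>] (0 : ℝ), d'.path s ∈ hC.outer L) →
      ∀ {a b m n}, HasSlope (g L).val d a m → HasSlope (g L).val d' b n → a = b → m ≠ n := by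
    intro L d d' hne h h' a b m n hm hn hab hmn
    obtain ⟨s, h1, h2, h3, h4, h5⟩ := (h.and (h'.and (Eventually.and hm (Eventually.and hn
      (Dir.eventually_path_ne hne))))).exists
    exact h5 (hC.injOn_val (hg L) (hC.outer_subset L h1) (hC.outer_subset L h2)
      (by rw [h3, h4, hab, hmn]))
  rcases hC.dir_cases d with hdC | ⟨L, hdL⟩
  · obtain ⟨w, -, ⟨a, ha⟩, hw⟩ := exists_slope_of_gen_mem
      (A := semifieldAdjoin TropR (range G.gen)) (fun _ => inv_mem_semifieldAdjoin)
      (fun i => subset_semifieldAdjoin _ (mem_range_self i)) hd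
    have hval : ∀ {x}, x ∈ C.carrier → (hC.pullback (C.restriction w)).val x = w.val x :=
      fun {x} hx => by rw [hC.pullback_restriction_val, hC.contraction_of_mem hx]
    refine ⟨hC.pullback (C.restriction w), hψB _, ⟨a, ?_⟩, fun hne => ?_⟩
    · filter_upwards [hdC, ha] with s h1 h2
      rw [hval h1, h2]
    rcases hC.dir_cases d' with hdC' | ⟨L, hdL'⟩
    · obtain ⟨b, hb⟩ := hw hne
      refine ⟨b, ?_⟩
      filter_upwards [hdC', hb] with s h1 h2
      rw [hval h1, h2]
    -- Along an outer ray a pulled-back function is constant, so its slope there is 0 whatever w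
    -- does.
    · have hfin := hC.notMem_infPts ⟨_, hC.chart_zero_mem L⟩
      have hw0 : w.val (hC.chart L 0) ≠ ⊥ ∧ w.val (hC.chart L 0) ≠ ⊤ := Rat.val_ne ha.ne_zero hfin
      refine ⟨(w.val (hC.chart L 0)).toReal, hdL'.mono fun s hs => ?_⟩
      rw [hC.pullback_restriction_val, hC.contraction_of_mem_ray (hC.outer_subset L hs)]
      simp [EReal.coe_toReal hw0.2 hw0.1]
  obtain ⟨a, m, hm⟩ := Rat.exists_slope (hg0 L) d
  have hA := hC.exists_mem_awayFrom R L
  rcases hC.mem_outer_or_eq (hC.base_mem_of_eventually_outer hdL) with hx | hx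
  · refine exists_slope_of_opposite hB hd (hgB L) (hm.eq_one_or_of_chipFiring (hg L) hA (hgne hdL))
      hm (b := a) fun hne => ?_
    have hdL' : ∀ᶠ s in 𝓝[>] (0 : ℝ), d'.path s ∈ hC.outer L :=
      d'.tendsto_path.eventually ((hC.isOpen_outer L).mem_nhds (hd ▸ hx))
    obtain ⟨b, n, hn⟩ := Rat.exists_slope (hg0 L) d'
    have hab : a = b := by
      have h1 := hm.eq_base (g L).continuous_val
      rw [hd, hn.eq_base (g L).continuous_val] at h1
      exact_mod_cast h1.symm
    refine hn.of_eq hab.symm ?_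
    have h1 := hm.eq_one_or_of_chipFiring (hg L) hA (hgne hdL)
    have h2 := hn.eq_one_or_of_chipFiring (hg L) hA (hgne hdL')
    have h3 := hgne' hne hdL hdL' hm hn hab
    omega
  · have hxC : d.base ∈ C.carrier := hx ▸ hC.chart_zero_mem L
    have hxA : d.base ∈ R.awayFrom C L.1 := Or.inl hxC
    have hxL := hC.base_mem_of_eventually_outer hdL
    have hgx : (g L).val d.base = 0 := by
      rw [hx, hC.val_chart_self (hg L)]
      simp
    have hga : ∀ {d : G.Dir}, (∀ᶠ s in 𝓝[>] (0 : ℝ), d.path s ∈ hC.outer L) →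
        d.base ∈ R.awayFrom C L.1 → (g L).val d.base = 0 → ∀ {a m}, HasSlope (g L).val d a m →
          a = 0 ∧ m = -1 := by
      intro d hdL hxA hgx a m hm
      exact hm.eq_neg_one_of_chipFiring (hg L) hxA (by simpa only [hgx] using hgne hdL)
    obtain ⟨rfl, rfl⟩ := hga hdL hxA hgx hm
    have hhd : HasSlope (h L).val d 0 0 := hdL.mono fun s hs => by
      rw [hh0 L _ (hC.outer_subset L hs)]
      simp
    -- Into L, the slopes give max 1 0 + 0 = 1. In any other direction `(h L)⁻¹` has slope 1, the
    -- largest slope possible for `(g L)⁻¹`, so the sum is 1 - 1 = 0. The factor `(g L)⁻¹` alone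
    -- would not do: another ray parallel to L may start at the same point.
    refine ⟨((g L)⁻¹ + (h L)⁻¹) * h L, B.mul_mem (B.add_mem (hB _ (hgB L)) (hB _ (hhB L))) (hhB L),
      ⟨0, ?_⟩, fun hne => ⟨0, ?_⟩⟩
    · have h1 := (hm.inv.add (hhd.inv.of_eq rfl rfl)).mul hhd
      exact h1.of_eq (by simp) (by simp)
    obtain ⟨b, n, hn⟩ := Rat.exists_slope (hg0 L) d'
    have hb : b = 0 := by
      have h1 := hn.eq_base (g L).continuous_val
      rw [← hd, hgx] at h1
      exact_mod_cast h1.symm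
    subst hb
    have hdL' : ¬ ∀ᶠ s in 𝓝[>] (0 : ℝ), d'.path s ∈ hC.outer L := fun hdL' =>
      hgne' hne hdL hdL' hm hn rfl (hga hdL' (hd ▸ hxA) (hd ▸ hgx) hn).2.symm
    have hout : ∀ᶠ s in 𝓝[>] (0 : ℝ), d'.path s ∉ L.1 := by
      filter_upwards [(d'.eventually_mem_or (hC.finite_frontier_outer L)).resolve_left hdL',
        d'.eventually_path_ne_base] with s h1 h2 h3
      exact h2 (((hC.mem_outer_or_eq h3).resolve_left h1).trans (hx.symm.trans hd))
    obtain ⟨c, k, hk⟩ := Rat.exists_slope (hhne L) d'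
    obtain ⟨rfl, rfl⟩ := hk.eq_neg_one_of_chipFiring (hh L) (hd ▸ hxL) (hout.mono fun s hs => by
      rw [hh, chipFiring_eq, Ne, EReal.neg_eq_zero_iff, EReal.coe_ennreal_eq_zero]
      refine (lt_min (setDist_pos ?_ hs) (by exact_mod_cast hε)).ne'
      rw [← hC.range_chart L]
      exact (hC.isRayChart_chart L).isClosed_range)
    have h1 := (hn.inv.add hk.inv).mul hk
    have h2 := abs_le.1 (hn.abs_le_one_of_chipFiring (hg L) hA)
    refine h1.of_eq (by simp) ?_
    rw [max_eq_right (by omega)]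
    simp

/-- The rational functions on `Γ_par` are generated by `g`, `h` and the functions that come from the
core. -/
theorem mem_of_mem_ratPar (hC : C.IsCore) (hε : 0 < ε) (hB : ∀ f ∈ B, f⁻¹ ∈ B)
    (hg : ∀ L x, (g L).val x = G.chipFiring (R.awayFrom C L.1) ⊤ x)
    (hh : ∀ L x, (h L).val x = G.chipFiring L.1 ε x) (hgB : ∀ L, g L ∈ B) (hhB : ∀ L, h L ∈ B)
    (hψB : ∀ f, hC.pullback f ∈ B) {f : G.Rat G.whole} (hf : f ∈ R.ratPar) : f ∈ B := by
  classical
  have := G.finite_edges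
  have := Fintype.ofFinite E
  by_cases hf0 : f = 0
  · rw [hf0]
    exact B.zero_mem
  -- Induction on a set of edges outside which all end slopes vanish; at the empty set the function
  -- has real values everywhere and the separation criterion applies.
  suffices key : ∀ S : Finset E, ∀ f ∈ R.ratPar, f ≠ 0 →
      (∀ e, G.len e = ⊤ → e ∉ S → ∃ a, HasEndSlope f.val e a 0) → f ∈ B from
    key Finset.univ f hf hf0 fun e _ h => absurd (Finset.mem_univ e) h
  intro S
  induction S using Finset.induction with
  | empty =>
    intro f _ hf0 hend
    refine mem_of_separates hB (fun x y hxy => hC.exists_val_ne hε hg hh hgB hhB hψB hxy)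
      (fun d d' hd => hC.exists_slope hε hB hg hh hgB hhB hψB hd) fun x => ?_
    by_cases hx : x ∈ G.infPts
    · obtain ⟨e, he, rfl⟩ := mem_infPts_iff.1 hx
      obtain ⟨a, ha⟩ := hend e he (Finset.notMem_empty e)
      have h1 : f.val (G.pt e ⊤) = a := by
        refine tendsto_nhds_unique ((f.continuous_val.tendsto _).comp tendsto_pt_top)
          (tendsto_const_nhds.congr' (ha.mono fun t ht => ?_))
        rw [Function.comp_apply, ht]
        simp
      rw [h1]
      exact ⟨EReal.coe_ne_bot a, EReal.coe_ne_top a⟩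
    · exact Rat.val_ne hf0 hx
  | insert e S heS ih =>
    intro f hf hf0 hend
    by_cases he : G.len e = ⊤
    swap
    · refine ih f hf hf0 fun e' he' h' => hend e' he' fun h => ?_
      rcases Finset.mem_insert.1 h with rfl | h
      · exact he he'
      · exact h' h
    obtain ⟨L, hL, -⟩ := hC.exists_end_mem he
    have hpar := R.parallel_range_pt (hC.isRay L.1 L.2) he (hC.outer_subset L hL)
    have hgK : g L ∈ R.ratParSubalgebra := hC.mem_ratPar_of_chipFiring_awayFrom (hg L)
    have hg0 : g L ≠ 0 := by
      obtain ⟨a, ha⟩ := hC.exists_endSlope_awayFrom (hg L) he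
      exact ha.ne_zero
    obtain ⟨a, m, hm⟩ := Rat.exists_endSlope hf0 he
    -- As `g L` has end slope -1 on e, the factor `g L ^ m` cancels the slope m of f there.
    have hfac : f = f * g L ^ m * (g L ^ m)⁻¹ := by
      rw [mul_assoc, mul_inv_cancel₀ (zpow_ne_zero _ hg0), mul_one]
    rw [hfac]
    refine B.mul_mem (ih _ ?_ (mul_ne_zero hf0 (zpow_ne_zero _ hg0)) fun e' he' h' => ?_)
      (hB _ (zpow_mem_of_inv_mem hB (hgB L) m))
    · exact R.ratParSubalgebra.mul_mem hf
        (zpow_mem_of_inv_mem (fun _ => Parallelization.inv_mem_ratPar) hgK m)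
    · obtain ⟨b, hb⟩ := hC.exists_endSlope_awayFrom (hg L) he'
      obtain ⟨c, hc⟩ := hb.exists_zpow m
      obtain ⟨a', m', hm'⟩ := Rat.exists_endSlope hf0 he'
      have h1 := hm'.mul hc
      -- On edges parallel to e the slope of f is again m and is cancelled too; on the others
      -- nothing changes, and e itself is not among them.
      suffices h2 : m' + m * (if R.Parallel L.1 (range (G.pt e')) then -1 else 0) = 0 by
        rw [h2] at h1
        exact ⟨_, h1⟩
      split_ifs with hp
      · obtain ⟨k, ⟨_, h3⟩, _, h4⟩ := (Parallelization.mem_ratPar_iff.1 hf).resolve_left hf0 e e' he he'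
          (hpar.symm.trans hp)
        rw [(hm.unique h3).2, (hm'.unique h4).2]
        ring
      · have hne : e' ∉ insert e S := fun h3 => by
          rcases Finset.mem_insert.1 h3 with rfl | h3
          · exact hp hpar
          · exact h' h3
        obtain ⟨_, h3⟩ := hend e' he' hne
        rw [(hm'.unique h3).2]
        ring

end generators

theorem semifieldAdjoin_eq (hC : C.IsCore) {R : G.Parallelization} {ε : ℝ≥0} (hε : 0 < ε)
    {g h : C.outerRays → G.Rat G.whole}
    (hg : ∀ L x, (g L).val x = G.chipFiring (R.awayFrom C L.1) ⊤ x)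
    (hh : ∀ L x, (h L).val x = G.chipFiring L.1 ε x) {s : Set (G.Rat C)}
    (hs : semifieldAdjoin TropR s = ⊤) :
    semifieldAdjoin TropR (range g ∪ range h ∪ hC.pullback '' s) = R.ratParSubalgebra := by
  refine le_antisymm (semifieldAdjoin_le ?_ fun _ => Parallelization.inv_mem_ratPar) ?_
  · rintro _ ((⟨L, rfl⟩ | ⟨L, rfl⟩) | ⟨f, -, rfl⟩)
    · exact hC.mem_ratPar_of_chipFiring_awayFrom (hg L)
    · exact mem_ratPar_of_chipFiring (hh L)
    · exact hC.pullback_mem_ratPar R f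
  · have hsub := subset_semifieldAdjoin (T := TropR) (range g ∪ range h ∪ hC.pullback '' s)
    refine fun f hf => hC.mem_of_mem_ratPar hε (fun _ => inv_mem_semifieldAdjoin) hg hh
      (fun L => hsub (Or.inl (Or.inl (mem_range_self L))))
      (fun L => hsub (Or.inl (Or.inr (mem_range_self L)))) (fun f => ?_) hf
    refine map_mem_of_mem_semifieldAdjoin hC.pullback (s := s) (subset_union_right.trans hsub)
      (fun _ => inv_mem_semifieldAdjoin) ?_
    rw [hs]
    trivial

end Region.IsCore

end TropModel

/-! ### The proposition -/

theorem proposition4p1p1 {V E : Type*} (G : TropModel V E) (R : G.Parallelization) :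
    ∃ K : Subalgebra TropR (G.Rat G.whole),
      (K : Set (G.Rat G.whole)) = R.ratPar ∧
      (∀ f ∈ K, f⁻¹ ∈ K) ∧
      (∃ s : Set (G.Rat G.whole), s.Finite ∧ 0 ∉ s ∧ semifieldAdjoin TropR s = K) ∧
      (∃ C : G.Region, C.IsCore) ∧
      ∀ C : G.Region, C.IsCore →
        C.outerRays.Finite ∧
        (∃ s : Set (G.Rat C), s.Finite ∧ 0 ∉ s ∧ semifieldAdjoin TropR s = ⊤) ∧
        ∀ ε : ℝ≥0, 0 < ε →
          ∃ (g h : C.outerRays → G.Rat G.whole) (r : G.Curve → C.carrier)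
            (ψ : G.Rat C →ₐ[TropR] G.Rat G.whole),
            (∀ L x, g L x = G.chipFiring (R.awayFrom C L) ⊤ x) ∧
            (∀ L x, h L x = G.chipFiring L ε x) ∧
            C.IsContraction r ∧ Continuous r ∧
            (∀ f x, ψ f x = f (r x)) ∧
            ∀ s : Set (G.Rat C), semifieldAdjoin TropR s = ⊤ →
              semifieldAdjoin TropR (Set.range g ∪ Set.range h ∪ ψ '' s) = K := by
  refine ⟨R.ratParSubalgebra, rfl, fun _ => TropModel.Parallelization.inv_mem_ratPar, ?_,
    ⟨_, G.isCore_finitePart⟩, fun C hC => ⟨hC.finite_outerRays, hC.exists_finite_generators,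
      fun ε hε => ?_⟩⟩
  -- Finite generation is the last statement applied to one particular core, with ε = 1.
  · have hC := G.isCore_finitePart
    have : Finite G.finitePart.outerRays := hC.finite_outerRays
    choose g hg using hC.exists_chipFiring_awayFrom R
    choose h hh using fun L => hC.exists_chipFiring_ray L ((1 : ℝ≥0) : ℝ≥0∞)
    obtain ⟨s, hs, hs0, hgen⟩ := hC.exists_finite_generators
    refine ⟨range g ∪ range h ∪ hC.pullback '' s,
      ((finite_range g).union (finite_range h)).union (hs.image _), ?_,
      hC.semifieldAdjoin_eq one_pos hg hh hgen⟩
    -- No generator is -∞: `g L` and `h L` take the value 0 at some point, and the pull-back is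
    -- injective because restriction undoes it.
    rintro ((⟨L, hL⟩ | ⟨L, hL⟩) | ⟨f, hf, hf0⟩)
    · have h1 := congrArg (fun f : G.Rat G.whole => f.val (hC.chart L 0)) hL
      simp [hC.val_chart_self (hg L)] at h1
    · obtain ⟨x, hx, -⟩ := hC.exists_mem_ray L
      have h1 := congrArg (fun f : G.Rat G.whole => f.val x) hL
      simp [hh, TropModel.chipFiring_eq, TropModel.setDist_of_mem hx] at h1
    · refine hs0 ?_
      rw [← hC.restriction_pullback f, hf0, map_zero] at hf
      exact hf
  · choose g hg using hC.exists_chipFiring_awayFrom R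
    choose h hh using fun L => hC.exists_chipFiring_ray L (ε : ℝ≥0∞)
    exact ⟨g, h, hC.contraction, hC.pullback, fun L x => hg L x, fun L x => hh L x,
      hC.isContraction_contraction, hC.continuous_contraction, fun f x => rfl,
      fun s hs => hC.semifieldAdjoin_eq hε hg hh hs⟩
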